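/- Consider a single-server system $GI^X/GI^Y/1/n$ of capacity $n$, a positive real number, driven by four mutually independent sequences of i.i.d. random variables: interarrival times $\tau_i>0$, arriving batch masses $X_i>0$, service times $\chi_i\ge 0$ and service batch masses $Y_i>0$, all real-valued with finite means, where $a=\mathsf{E}\tau_1$ and $b=\mathsf{E}\chi_1>0$. An arriving batch is admitted if its whole mass fits into the remaining capacity (the mass in service counts as present), and otherwise the whole batch is lost. While the system is not empty, services follow one another without pause; the $i$th service takes time $\chi_i$, and at its end the mass $\min(Y_i,m_i)$ leaves, where $m_i$ is the mass present immediately before the service starts. An arrival at the instant of a service completion precedes the completion. A busy period starts with the arrival of a batch at an empty system and ends when the system is empty again; a starting batch of mass greater than $n$ is lost and its busy period has length $0$. Let $M_L\in[0,\infty]$ be the total mass lost during a busy period, the starting batch included. Suppose that the distribution of $\tau_1$ is NWUE: $\mathsf{E}\{\tau_1-x\mid\tau_1>x\}\ge\mathsf{E}\tau_1$ (with $\mathsf{P}\{\tau_1>x\}>0$) for every $x\ge0$. Then $\mathsf{E}M_L=\mathsf{E}X_1$ holds for every real $n>0$ if and only if there is a number $d$ such that arrivals are Poisson (that is, $\tau_1$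 is exponentially distributed), $Y_1=d$ almost surely, $X_1$ is lattice with step $d$ (that is, $X_1$ is almost surely an integer multiple of $d$; $d$ need not be the largest such number), and $\mathsf{E}X_1=\dfrac{ad}{b}$. -/

import Mathlib

open MeasureTheory ProbabilityTheory

/-- The distribution of a random variable `ξ` belongs to the class NWUE: for every `x ≥ 0` the mean
residual life `E{ξ - x | ξ > x}` is at least `E ξ`. (If `P(ξ > x) = 0` the conditional measure is
zero, so for `E ξ > 0` this definition contains the requirement that `P(ξ > x) > 0` for all `x`.) -/
def IsNWUE {Ω : Type*} [MeasurableSpace Ω] (μ : Measure Ω) (ξ : Ω → ℝ) : Prop :=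
  ∀ x : ℝ, 0 ≤ x → μ[ξ] ≤ ∫ ω, (ξ ω - x) ∂(μ[|{ω | x < ξ ω}])

/-- The standing assumptions on the control sequences of a `GI^X/GI^Y/1/n` system: interarrival
times `τ`, arriving batches `X`, service times `χ`, service batches `Y`. Each sequence is i.i.d.,
the four sequences are independent of each other, and all means are finite. -/
structure IsControl {Ω : Type*} [MeasurableSpace Ω] (μ : Measure Ω)
    (τ X χ Y : ℕ → Ω → ℝ) : Prop where
  measurable_τ : ∀ i, Measurable (τ i)
  measurable_X : ∀ i, Measurable (X i)
  measurable_χ : ∀ i, Measurable (χ i)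
  measurable_Y : ∀ i, Measurable (Y i)
  /-- All the variables of the four sequences are jointly independent. -/
  indep : iIndepFun (fun p : Fin 4 × ℕ => ![τ, X, χ, Y] p.1 p.2) μ
  identDistrib_τ : ∀ i, IdentDistrib (τ i) (τ 0) μ μ
  identDistrib_X : ∀ i, IdentDistrib (X i) (X 0) μ μ
  identDistrib_χ : ∀ i, IdentDistrib (χ i) (χ 0) μ μ
  identDistrib_Y : ∀ i, IdentDistrib (Y i) (Y 0) μ μ
  τ_pos : ∀ i, ∀ᵐ ω ∂μ, 0 < τ i ω
  X_pos : ∀ i, ∀ᵐ ω ∂μ, 0 < X i ω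
  χ_nonneg : ∀ i, ∀ᵐ ω ∂μ, 0 ≤ χ i ω
  Y_pos : ∀ i, ∀ᵐ ω ∂μ, 0 < Y i ω
  integrable_τ : Integrable (τ 0) μ
  integrable_X : Integrable (X 0) μ
  integrable_χ : Integrable (χ 0) μ
  integrable_Y : Integrable (Y 0) μ
  /-- The mean service time is not zero. -/
  mean_χ_pos : 0 < μ[χ 0]

namespace BatchQueue

/-- The system between two consecutive events of a busy period. -/
structure State where
  /-- number of batches that have arrived so far (the one at time `0` included) -/
  arrived : ℕ
  /-- number of service completions so far; this is also the index of the current service -/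
  served : ℕ
  /-- mass present in the system, the mass in service included -/
  content : ℝ
  /-- mass that leaves at the end of the current service -/
  inService : ℝ
  /-- total mass rejected so far -/
  lost : ℝ

/-- The time of arrival of batch `k`; batch `0` arrives at time `0`. -/
noncomputable def arrivalTime (τ : ℕ → ℝ) (k : ℕ) : ℝ := ∑ i ∈ Finset.range k, τ i

/-- The time at which service `j` of the busy period ends (services are numbered from `0`). -/
noncomputable def completionTime (χ : ℕ → ℝ) (j : ℕ) : ℝ := ∑ i ∈ Finset.range (j + 1), χ i

/-- Batch `0` arrives at an empty system of capacity `n` at time `0`. If it fits, the first service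
starts at once. Otherwise it is lost, the system stays empty and the busy period has length `0`. -/
noncomputable def init (n : ℝ) (X Y : ℕ → ℝ) : State :=
  if X 0 ≤ n then
    { arrived := 1, served := 0, content := X 0, inService := min (Y 0) (X 0), lost := 0 }
  else
    { arrived := 1, served := 0, content := 0, inService := 0, lost := X 0 }

/-- An arrival of a batch (full rejection): the batch is admitted if the whole of it
fits into the remaining capacity, and otherwise the whole of it is lost. -/
noncomputable def arrive (n : ℝ) (X : ℕ → ℝ) (s : State) : State :=
  if s.content + X s.arrived ≤ n then
    { s with arrived := s.arrived + 1, content := s.content + X s.arrived }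
  else
    { s with arrived := s.arrived + 1, lost := s.lost + X s.arrived }

/-- A service completion: the served mass leaves; the next service, of index `s.served + 1`, will
process its service batch or, if less mass is present immediately before it starts, that mass. -/
noncomputable def complete (Y : ℕ → ℝ) (s : State) : State :=
  { s with
    served := s.served + 1
    content := s.content - s.inService
    inService := min (Y (s.served + 1)) (s.content - s.inService) }

/-- The next event. The busy period is over, and the state is frozen, once the system is empty. An
arrival at the very instant of a service completion precedes the completion. -/
noncomputable def step (n : ℝ) (τ X χ Y : ℕ → ℝ) (s : State) : State :=
  if s.content = 0 then s
  else if arrivalTime τ s.arrived ≤ completionTime χ s.served then arrive n X s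
  else complete Y s

/-- The state after `e` events following the arrival that starts the busy period. -/
noncomputable def state (n : ℝ) (τ X χ Y : ℕ → ℝ) (e : ℕ) : State :=
  (step n τ X χ Y)^[e] (init n X Y)

/-- The total mass `M_L` lost during the busy period. -/
noncomputable def lostMass (n : ℝ) (τ X χ Y : ℕ → ℝ) : ENNReal :=
  ⨆ e : ℕ, ENNReal.ofReal (state n τ X χ Y e).lost

end BatchQueue

/-! Let `a`, `b`, `x`, `y` be the means of an interarrival time, a service time, an arriving batch
and a service batch. For one capacity, let `S` be the mean number of services in a busy period, `A`
the mean number of arrivals after the first, `g` the mean mass served, `p` the probability that the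
starting batch is admitted, and `R` the mean time from the end of a busy period with an admitted
starting batch to the next arrival (counted as zero when that batch is lost). Wald's identity
applied to masses and to times gives `E M_L + g = x (1 + A)` and `a (p + A) = b S + R`
(`lintegral_lost_add`, `lintegral_time_balance`).

Two inequalities carry the argument. A service batch is independent of the mass `w` present at the
start of its service, so `g` is the mean of the sum of `E min(Y, w)` over the starts, and `g ≤ y S`.
Given all inputs except the interarrival time in which the busy period ends, ending there means that
this time exceeds some `z ≥ 0`, and the residual time is its excess over `z`; so NWUE yields `R ≥ a
p`, that is, `b S ≤ a A` (`mean_mul_le_lintegral_residual`, `mean_mul_numServices_le`).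

If `E M_L = x`, then `g = x A` and `x b S ≤ x a A = a g ≤ a y S`. If `x b < a y`, the mean loss
would tend to `0` as the capacity grows (`tendsto_lintegral_lostTotal`); so `x b ≥ a y` and the
chain closes up into equalities (`equalities_of_lost_eq`). Then `g = y S` says that a service batch
never exceeds the mass present. Applied to a starting batch that is served before the next arrival,
this makes the service batches constant, equal to `d`, and puts the arriving batches on the lattice
of `d` (`exists_ae_eq_of_fit`, `ae_exists_nat_mul_of_fit`). The equality `R = a p` says that the
mean residual life is `a` at the levels `z` that occur; suitable capacities and inputs make such
levels dense in the half-line (`exists_excess_eq`), so the mean residual life is constant and the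
law exponential (`real_Ioi_eq_exp`). Conversely, under the stated conditions both inequalities are
equalities at every capacity, and the balances give `E M_L = x` (`lintegral_lostTotal_eq`).

The vanishing loss at load below one rests on `exists_low_bound`: a service start with little mass
present is followed, with probability bounded below, by a quick end of the busy period, whatever the
capacity. Hence such starts are few in the mean, and all other services remove nearly `y` in the
mean.

The system is run on the product space of all inputs, with a set `F` of admissible contents that is
`Set.Iic n` for capacity `n` and `Set.univ` for the unbounded system. A state keeps the mass at the
service start instead of the mass in service; thus the service batch stays unread, hence independent
of the state, until the service is completed. -/

namespace BatchQueue

open scoped ENNReal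

/-- Input sequences of the system: the rows `0, 1, 2, 3` are the interarrival times, the batches,
the service times and the service batches. -/
abbrev Inp := Fin 4 × ℕ → ℝ

/-! ### Product measures: resampling a coordinate, independence of a box -/

section Resampling

variable {ι : Type*} [DecidableEq ι] {L : ι → Measure ℝ} [∀ i, IsProbabilityMeasure (L i)]

/-- It suffices to compare finite boxes. A box that constrains `p` splits into the constraint on the
fresh copy and a box in the other coordinates; a box that does not constrain `p` does not see the
update. -/
lemma map_update_infinitePi (p : ι) :
    ((Measure.infinitePi L).prod (L p)).map
      (fun x : (ι → ℝ) × ℝ => Function.update x.1 p x.2) = Measure.infinitePi L := by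
  have hm : Measurable (fun x : (ι → ℝ) × ℝ => Function.update x.1 p x.2) := by
    refine measurable_pi_iff.2 fun i => ?_
    by_cases h : i = p
    · subst h; simpa using measurable_snd
    · simp only [Function.update_of_ne h]; fun_prop
  refine Measure.eq_infinitePi L fun s t ht => ?_
  have htm : ∀ s' : Finset ι, MeasurableSet (Set.pi (s' : Set ι) t) := fun s' =>
    MeasurableSet.pi s'.countable_toSet fun i _ => ht i
  rw [Measure.map_apply hm (htm s)]
  by_cases hp : p ∈ s
  · have : (fun x : (ι → ℝ) × ℝ => Function.update x.1 p x.2) ⁻¹' Set.pi (s : Set ι) t =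
        (Set.pi ((s.erase p : Finset ι) : Set ι) t) ×ˢ (t p) := by
      ext ⟨v, z⟩
      simp only [Set.mem_preimage, Set.mem_pi, Finset.mem_coe, Set.mem_prod, Finset.mem_erase]
      constructor
      · intro h
        refine ⟨fun i hi => by simpa [Function.update_of_ne hi.1] using h i hi.2, by
          simpa using h p hp⟩
      · rintro ⟨h1, h2⟩ i hi
        by_cases hip : i = p
        · subst hip; simpa using h2
        · simpa [Function.update_of_ne hip] using h1 i ⟨hip, hi⟩
    rw [this, Measure.prod_prod, Measure.infinitePi_pi L fun i _ => ht i,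
      Finset.prod_erase_mul _ _ hp]
  · have : (fun x : (ι → ℝ) × ℝ => Function.update x.1 p x.2) ⁻¹' Set.pi (s : Set ι) t =
        (Set.pi (s : Set ι) t) ×ˢ Set.univ := by
      ext ⟨v, z⟩
      simp only [Set.mem_preimage, Set.mem_pi, Finset.mem_coe, Set.mem_prod, Set.mem_univ,
        and_true]
      refine forall₂_congr fun i hi => ?_
      rw [Function.update_of_ne (by rintro rfl; exact hp hi)]
    rw [this, Measure.prod_prod, Measure.infinitePi_pi L fun i _ => ht i]
    simp

lemma measurable_update_prod (p : ι) :
    Measurable (fun x : (ι → ℝ) × ℝ => Function.update x.1 p x.2) := by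
  refine measurable_pi_iff.2 fun i => ?_
  by_cases h : i = p
  · subst h; simpa using measurable_snd
  · simp only [Function.update_of_ne h]; fun_prop

/-- Replacing one coordinate by an independent copy of it does not change expectations. -/
lemma lintegral_resample (p : ι) {F : (ι → ℝ) → ℝ≥0∞} (hF : Measurable F) :
    ∫⁻ v, F v ∂(Measure.infinitePi L) =
      ∫⁻ v, ∫⁻ z, F (Function.update v p z) ∂(L p) ∂(Measure.infinitePi L) := by
  conv_lhs => rw [← map_update_infinitePi p]
  rw [lintegral_map hF (measurable_update_prod p)]
  exact lintegral_prod _ (hF.comp (measurable_update_prod p)).aemeasurable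

/-- A coordinate can be integrated out when the rest of the integrand does not depend on it. -/
lemma lintegral_of_invariant (p : ι) {f : (ι → ℝ) → ℝ → ℝ≥0∞}
    (hf : Measurable (Function.uncurry f))
    (hinv : ∀ v z w, f (Function.update v p z) w = f v w) :
    ∫⁻ v, f v (v p) ∂(Measure.infinitePi L) =
      ∫⁻ v, ∫⁻ z, f v z ∂(L p) ∂(Measure.infinitePi L) := by
  have hF : Measurable (fun v : ι → ℝ => f v (v p)) :=
    hf.comp (measurable_id.prodMk (measurable_pi_apply p))
  rw [lintegral_resample p hF]
  simp only [Function.update_self, hinv]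

/-- An event that does not depend on the coordinates in `S` is independent of a box in these
coordinates. -/
lemma infinitePi_inter_box (S : Finset ι) {E : Set (ι → ℝ)} (hE : MeasurableSet E)
    {B : ι → Set ℝ} (hB : ∀ i, MeasurableSet (B i))
    (hinv : ∀ v v' : ι → ℝ, (∀ i ∉ S, v i = v' i) → (v ∈ E ↔ v' ∈ E)) :
    Measure.infinitePi L (E ∩ {v | ∀ i ∈ S, v i ∈ B i}) =
      Measure.infinitePi L E * ∏ i ∈ S, L i (B i) := by
  induction S using Finset.induction_on generalizing E with
  | empty => simp
  | insert p S hp ih =>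
    have hbox : ∀ T : Finset ι, MeasurableSet {v : ι → ℝ | ∀ i ∈ T, v i ∈ B i} := fun T => by
      have : {v : ι → ℝ | ∀ i ∈ T, v i ∈ B i} = ⋂ i ∈ T, (fun v : ι → ℝ => v i) ⁻¹' B i := by
        ext; simp
      rw [this]
      exact Finset.measurableSet_biInter _ fun i _ => measurable_pi_apply i (hB i)
    have hup : ∀ v z, Function.update v p z ∈ E ↔ v ∈ E := fun v z =>
      hinv _ _ fun i hi => Function.update_of_ne
        (by rintro rfl; exact hi (Finset.mem_insert_self _ S)) _ _
    have h2 : ∀ v z, (Function.update v p z ∈ {v : ι → ℝ | ∀ i ∈ S, v i ∈ B i}) ↔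
        v ∈ {v : ι → ℝ | ∀ i ∈ S, v i ∈ B i} := by
      intro v z
      refine forall₂_congr fun i hi => ?_
      rw [Function.update_of_ne (by rintro rfl; exact hp hi)]
    classical
    have hfm : Measurable (Function.uncurry fun (v : ι → ℝ) (z : ℝ) =>
        (E ∩ {v | ∀ i ∈ S, v i ∈ B i}).indicator 1 v * (B p).indicator (1 : ℝ → ℝ≥0∞) z) := by
      refine Measurable.mul ?_ ?_
      · exact ((measurable_one.indicator (hE.inter (hbox S))).comp measurable_fst)
      · exact ((measurable_one.indicator (hB p)).comp measurable_snd)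
    have key := lintegral_of_invariant (L := L) p hfm (by
      intro v z w
      congr 1
      simp only [Set.indicator, Set.mem_inter_iff, hup, h2, Pi.one_apply])
    have e1 : ∀ v : ι → ℝ, (E ∩ {v | ∀ i ∈ S, v i ∈ B i}).indicator 1 v *
        (B p).indicator (1 : ℝ → ℝ≥0∞) (v p) =
        (E ∩ {v | ∀ i ∈ insert p S, v i ∈ B i}).indicator 1 v := by
      intro v
      by_cases h1 : v ∈ E <;> by_cases h3 : v p ∈ B p <;>
        by_cases h4 : ∀ i ∈ S, v i ∈ B i <;> simp [Set.indicator, h1, h3, h4]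
    simp only [e1] at key
    rw [lintegral_indicator_one (hE.inter (hbox _))] at key
    rw [key]
    simp_rw [lintegral_const_mul _ (measurable_one.indicator (hB p)),
      lintegral_indicator_one (hB p)]
    rw [lintegral_mul_const _ (measurable_one.indicator (hE.inter (hbox S))),
      lintegral_indicator_one (hE.inter (hbox S)), ih hE, Finset.prod_insert hp]
    · ring
    · intro v v' h
      refine hinv _ _ fun i hi => h i fun hiS => hi (Finset.mem_insert_of_mem hiS)

/-- Serves to replace a random coordinate index, such as the number of services completed, by fixed
ones, for which resampling is available. -/
lemma lintegral_eq_tsum_index {Ω κ : Type*} [MeasurableSpace Ω] {P : Measure Ω} [Countable κ]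
    [DecidableEq κ] (idx : Ω → κ) (f : Ω → ℝ≥0∞)
    (hf : ∀ i, Measurable fun v => if idx v = i then f v else 0) :
    ∫⁻ v, f v ∂P = ∑' i, ∫⁻ v, (if idx v = i then f v else 0) ∂P := by
  rw [← lintegral_tsum fun i => (hf i).aemeasurable]
  refine lintegral_congr fun v => ?_
  rw [tsum_eq_single (idx v)]
  · simp
  · intro i hi
    simp [Ne.symm hi]

end Resampling

end BatchQueue

/-! ### Dynamics along one input path -/

namespace BatchQueue

open scoped ENNReal

/-- The system between two events; compared with `State`, it keeps the mass present at the start of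
the current service instead of the mass in service, and whether a service has just started. -/
structure Sys where
  arr : ℕ
  served : ℕ
  content : ℝ
  work : ℝ
  lost : ℝ
  fresh : Bool

/-- The arrival time of batch `i`. -/
noncomputable def arrTime (v : Inp) (i : ℕ) : ℝ := ∑ k ∈ Finset.range i, v (0, k)

/-- The total time of the first `j` services. -/
noncomputable def srvTime (v : Inp) (j : ℕ) : ℝ := ∑ k ∈ Finset.range j, v (2, k)

open Classical in
/-- The initial state, when the set of admissible contents is `F`. -/
noncomputable def start (F : Set ℝ) (v : Inp) : Sys :=
  if v (1, 0) ∈ F then ⟨1, 0, v (1, 0), v (1, 0), 0, true⟩ else ⟨1, 0, 0, 0, v (1, 0), true⟩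

open Classical in
/-- The next event, when the set of admissible contents is `F`. -/
noncomputable def next (F : Set ℝ) (v : Inp) (s : Sys) : Sys :=
  if s.content = 0 then s
  else if arrTime v s.arr ≤ srvTime v (s.served + 1) then
    if s.content + v (1, s.arr) ∈ F then
      ⟨s.arr + 1, s.served, s.content + v (1, s.arr), s.work, s.lost, false⟩
    else ⟨s.arr + 1, s.served, s.content, s.work, s.lost + v (1, s.arr), false⟩
  else ⟨s.arr, s.served + 1, s.content - min (v (3, s.served)) s.work,
    s.content - min (v (3, s.served)) s.work, s.lost, true⟩

/-- The state after `e` events, when the set of admissible contents is `F`. -/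
noncomputable def sys (F : Set ℝ) (v : Inp) : ℕ → Sys
  | 0 => start F v
  | e + 1 => next F v (sys F v e)

/-- A service starts in state `e`. -/
def Starts (F : Set ℝ) (v : Inp) (e : ℕ) : Prop :=
  (sys F v e).content ≠ 0 ∧ (sys F v e).fresh = true

/-- The event following state `e` is an arrival. -/
def Arrives (F : Set ℝ) (v : Inp) (e : ℕ) : Prop :=
  (sys F v e).content ≠ 0 ∧ arrTime v (sys F v e).arr ≤ srvTime v ((sys F v e).served + 1)

/-- The event following state `e` ends the busy period. -/
def Ends (F : Set ℝ) (v : Inp) (e : ℕ) : Prop :=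
  (sys F v e).content ≠ 0 ∧ (sys F v (e + 1)).content = 0

/-- Positivity of the input. -/
structure Good (v : Inp) : Prop where
  τ_pos : ∀ i, 0 < v (0, i)
  X_pos : ∀ i, 0 < v (1, i)
  χ_nonneg : ∀ i, 0 ≤ v (2, i)
  Y_pos : ∀ i, 0 < v (3, i)

variable {F : Set ℝ} {v : Inp}

lemma sys_succ_cases (F : Set ℝ) (v : Inp) (e : ℕ) :
    ((sys F v e).content = 0 ∧ sys F v (e + 1) = sys F v e) ∨
    ((sys F v e).content ≠ 0 ∧ arrTime v (sys F v e).arr ≤ srvTime v ((sys F v e).served + 1) ∧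
      (sys F v e).content + v (1, (sys F v e).arr) ∈ F ∧
      sys F v (e + 1) = ⟨(sys F v e).arr + 1, (sys F v e).served,
        (sys F v e).content + v (1, (sys F v e).arr), (sys F v e).work, (sys F v e).lost, false⟩) ∨
    ((sys F v e).content ≠ 0 ∧ arrTime v (sys F v e).arr ≤ srvTime v ((sys F v e).served + 1) ∧
      (sys F v e).content + v (1, (sys F v e).arr) ∉ F ∧
      sys F v (e + 1) = ⟨(sys F v e).arr + 1, (sys F v e).served,
        (sys F v e).content, (sys F v e).work, (sys F v e).lost + v (1, (sys F v e).arr), false⟩) ∨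
    ((sys F v e).content ≠ 0 ∧ srvTime v ((sys F v e).served + 1) < arrTime v (sys F v e).arr ∧
      sys F v (e + 1) = ⟨(sys F v e).arr, (sys F v e).served + 1,
        (sys F v e).content - min (v (3, (sys F v e).served)) (sys F v e).work,
        (sys F v e).content - min (v (3, (sys F v e).served)) (sys F v e).work,
        (sys F v e).lost, true⟩) := by
  change (_ ∧ next F v (sys F v e) = _) ∨ (_ ∧ _ ∧ _ ∧ next F v (sys F v e) = _) ∨
    (_ ∧ _ ∧ _ ∧ next F v (sys F v e) = _) ∨ (_ ∧ _ ∧ next F v (sys F v e) = _)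
  unfold next
  split_ifs with h1 h2 h3
  · exact Or.inl ⟨h1, rfl⟩
  · exact Or.inr (Or.inl ⟨h1, h2, h3, rfl⟩)
  · exact Or.inr (Or.inr (Or.inl ⟨h1, h2, h3, rfl⟩))
  · exact Or.inr (Or.inr (Or.inr ⟨h1, not_le.1 h2, rfl⟩))

lemma arrTime_succ (v : Inp) (i : ℕ) : arrTime v (i + 1) = arrTime v i + v (0, i) :=
  Finset.sum_range_succ _ _

lemma srvTime_succ (v : Inp) (i : ℕ) : srvTime v (i + 1) = srvTime v i + v (2, i) :=
  Finset.sum_range_succ _ _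

lemma Good.arrTime_mono (h : Good v) : Monotone (arrTime v) :=
  monotone_nat_of_le_succ fun i => by rw [arrTime_succ]; linarith [h.τ_pos i]

lemma Good.srvTime_mono (h : Good v) : Monotone (srvTime v) :=
  monotone_nat_of_le_succ fun i => by rw [srvTime_succ]; linarith [h.χ_nonneg i]

lemma Good.arrTime_nonneg (h : Good v) (i : ℕ) : 0 ≤ arrTime v i :=
  Finset.sum_nonneg fun k _ => (h.τ_pos k).le

lemma Good.srvTime_nonneg (h : Good v) (i : ℕ) : 0 ≤ srvTime v i :=
  Finset.sum_nonneg fun k _ => h.χ_nonneg k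

lemma served_mono (F : Set ℝ) (v : Inp) : Monotone fun e => (sys F v e).served := by
  refine monotone_nat_of_le_succ fun e => ?_
  rcases sys_succ_cases F v e with ⟨-, h⟩ | ⟨-, -, -, h⟩ | ⟨-, -, -, h⟩ | ⟨-, -, h⟩ <;> simp [h]

lemma arr_mono (F : Set ℝ) (v : Inp) : Monotone fun e => (sys F v e).arr := by
  refine monotone_nat_of_le_succ fun e => ?_
  rcases sys_succ_cases F v e with ⟨-, h⟩ | ⟨-, -, -, h⟩ | ⟨-, -, -, h⟩ | ⟨-, -, h⟩ <;> simp [h]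

lemma sys_of_empty {e : ℕ} (h : (sys F v e).content = 0) {e' : ℕ} (he : e ≤ e') :
    sys F v e' = sys F v e := by
  induction e', he using Nat.le_induction with
  | base => rfl
  | succ k _ ih =>
    rcases sys_succ_cases F v k with ⟨-, h'⟩ | ⟨h', -⟩ | ⟨h', -⟩ | ⟨h', -⟩
    · rw [h', ih]
    all_goals exact absurd (ih ▸ h) h'

lemma content_ne_zero_of_le {e e' : ℕ} (he : e ≤ e') (h : (sys F v e').content ≠ 0) :
    (sys F v e).content ≠ 0 := fun h0 => h (by rw [sys_of_empty h0 he]; exact h0)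

lemma one_le_arr (F : Set ℝ) (v : Inp) (e : ℕ) : 1 ≤ (sys F v e).arr := by
  have h := arr_mono F v (Nat.zero_le e)
  have h0 : (sys F v 0).arr = 1 := by
    change (start F v).arr = 1
    unfold start; split_ifs <;> rfl
  simpa [h0] using h

lemma sys_zero_arr (F : Set ℝ) (v : Inp) : (sys F v 0).arr = 1 := by
  change (start F v).arr = 1
  unfold start; split_ifs <;> rfl

lemma sys_zero_served (F : Set ℝ) (v : Inp) : (sys F v 0).served = 0 := by
  change (start F v).served = 0
  unfold start; split_ifs <;> rfl

lemma sys_zero_fresh (F : Set ℝ) (v : Inp) : (sys F v 0).fresh = true := by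
  change (start F v).fresh = true
  unfold start; split_ifs <;> rfl

lemma sys_zero_of_mem (h : v (1, 0) ∈ F) :
    sys F v 0 = ⟨1, 0, v (1, 0), v (1, 0), 0, true⟩ := by
  change start F v = _
  unfold start; rw [if_pos h]

lemma sys_zero_of_notMem (h : v (1, 0) ∉ F) : sys F v 0 = ⟨1, 0, 0, 0, v (1, 0), true⟩ := by
  change start F v = _
  unfold start; rw [if_neg h]

lemma Good.content_zero_ne_zero_iff (h : Good v) :
    (sys F v 0).content ≠ 0 ↔ v (1, 0) ∈ F := by
  by_cases hF : v (1, 0) ∈ F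
  · simp [sys_zero_of_mem hF, hF, (h.X_pos 0).ne']
  · simp [sys_zero_of_notMem hF, hF]

/-- The basic sign properties of the states. -/
lemma Good.sys_inv (h : Good v) (F : Set ℝ) (e : ℕ) :
    0 ≤ (sys F v e).work ∧ (sys F v e).work ≤ (sys F v e).content ∧
    ((sys F v e).fresh = true → (sys F v e).work = (sys F v e).content) ∧
    0 ≤ (sys F v e).lost ∧ ((sys F v e).content ≠ 0 → 0 < (sys F v e).work) := by
  induction e with
  | zero =>
    by_cases hF : v (1, 0) ∈ F
    · simp [sys_zero_of_mem hF, (h.X_pos 0).le, h.X_pos 0]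
    · simp [sys_zero_of_notMem hF, (h.X_pos 0).le]
  | succ e ih =>
    obtain ⟨i1, i2, i3, i4, i5⟩ := ih
    rcases sys_succ_cases F v e with ⟨-, h'⟩ | ⟨hc, -, -, h'⟩ | ⟨hc, -, -, h'⟩ | ⟨hc, -, h'⟩
    · rw [h']; exact ⟨i1, i2, i3, i4, i5⟩
    · rw [h']
      have := h.X_pos (sys F v e).arr
      exact ⟨i1, by dsimp only; linarith, by simp, i4, fun _ => i5 hc⟩
    · rw [h']
      have := h.X_pos (sys F v e).arr
      exact ⟨i1, i2, by simp, by dsimp only; linarith, fun _ => i5 hc⟩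
    · rw [h']
      have h1 : min (v (3, (sys F v e).served)) (sys F v e).work ≤ (sys F v e).work :=
        min_le_right _ _
      refine ⟨by dsimp only; linarith, le_rfl, fun _ => rfl, i4, fun hne => ?_⟩
      exact lt_of_le_of_ne (by dsimp only; linarith) (Ne.symm hne)

lemma Good.content_nonneg (h : Good v) (F : Set ℝ) (e : ℕ) : 0 ≤ (sys F v e).content :=
  (h.sys_inv F e).1.trans (h.sys_inv F e).2.1

lemma Good.content_le (h : Good v) {n : ℝ} (hn : 0 ≤ n) (e : ℕ) :
    (sys (Set.Iic n) v e).content ≤ n := by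
  induction e with
  | zero =>
    by_cases hF : v (1, 0) ∈ Set.Iic n
    · simpa [sys_zero_of_mem hF] using hF
    · simpa [sys_zero_of_notMem hF] using hn
  | succ e ih =>
    obtain ⟨i1, i2, -⟩ := h.sys_inv (Set.Iic n) e
    rcases sys_succ_cases (Set.Iic n) v e with
      ⟨-, h'⟩ | ⟨hc, -, hF, h'⟩ | ⟨hc, -, -, h'⟩ | ⟨hc, -, h'⟩
    · rw [h']; exact ih
    · rw [h']; exact hF
    · rw [h']; exact ih
    · rw [h']
      have := le_min (h.Y_pos (sys (Set.Iic n) v e).served).le i1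
      dsimp only
      linarith

lemma Good.work_le (h : Good v) {n : ℝ} (hn : 0 ≤ n) (e : ℕ) :
    (sys (Set.Iic n) v e).work ≤ n :=
  (h.sys_inv _ e).2.1.trans (h.content_le hn e)

lemma Good.lost_mono (h : Good v) (F : Set ℝ) : Monotone fun e => (sys F v e).lost := by
  refine monotone_nat_of_le_succ fun e => ?_
  rcases sys_succ_cases F v e with ⟨-, h'⟩ | ⟨-, -, -, h'⟩ | ⟨-, -, -, h'⟩ | ⟨-, -, h'⟩ <;>
    simp [h', (h.X_pos _).le]

section Sums

variable {M : Type*} [AddCommMonoid M]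

open Classical in
/-- A sum over the batches that have arrived is a sum over the arrival events. -/
lemma sum_range_arr (F : Set ℝ) (v : Inp) (g : ℕ → M) (H : ℕ) :
    ∑ i ∈ Finset.range (sys F v H).arr, g i =
      g 0 + ∑ e ∈ Finset.range H, if Arrives F v e then g (sys F v e).arr else 0 := by
  induction H with
  | zero => simp [sys_zero_arr]
  | succ H ih =>
    rw [Finset.sum_range_succ, ← add_assoc, ← ih]
    rcases sys_succ_cases F v H with ⟨h1, h'⟩ | ⟨h1, h2, -, h'⟩ | ⟨h1, h2, -, h'⟩ | ⟨h1, h2, h'⟩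
    · rw [if_neg fun h => h.1 h1, h', add_zero]
    · rw [if_pos ⟨h1, h2⟩, h', Finset.sum_range_succ]
    · rw [if_pos ⟨h1, h2⟩, h', Finset.sum_range_succ]
    · rw [if_neg fun h => absurd h.2 (not_le.2 h2), h', add_zero]

open Classical in
/-- The number of services that have been started. -/
noncomputable def Sys.started (s : Sys) : ℕ := if s.content = 0 then s.served else s.served + 1

open Classical in
/-- A sum over the services that have been started is a sum over the states where one starts. -/
lemma Good.sum_range_started (hv : Good v) (F : Set ℝ) (g : ℕ → M) (H : ℕ) :
    ∑ i ∈ Finset.range (sys F v H).started, g i =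
      ∑ e ∈ Finset.range (H + 1), if Starts F v e then g (sys F v e).served else 0 := by
  induction H with
  | zero =>
    by_cases hc : (sys F v 0).content = 0
    · have : ¬ Starts F v 0 := fun h => h.1 hc
      simp [Sys.started, hc, sys_zero_served, this]
    · have : Starts F v 0 := ⟨hc, sys_zero_fresh F v⟩
      simp [Sys.started, hc, sys_zero_served, this]
  | succ H ih =>
    rw [Finset.sum_range_succ, ← ih]
    rcases sys_succ_cases F v H with ⟨h1, h'⟩ | ⟨h1, h2, hF, h'⟩ | ⟨h1, h2, hF, h'⟩ | ⟨h1, h2, h'⟩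
    · rw [if_neg fun h => h.1 (h' ▸ h1), h', add_zero]
    · rw [if_neg fun h => by simpa [h'] using h.2, add_zero]
      have hz : (sys F v H).content + v (1, (sys F v H).arr) ≠ 0 :=
        (add_pos_of_nonneg_of_pos (hv.content_nonneg F H) (hv.X_pos _)).ne'
      rw [h']; simp [Sys.started, h1, hz]
    · rw [if_neg fun h => by simpa [h'] using h.2, add_zero, h']
      simp [Sys.started, h1]
    · by_cases hz : (sys F v (H + 1)).content = 0
      · rw [if_neg fun h => h.1 hz, add_zero]
        have : (sys F v (H + 1)).served = (sys F v H).served + 1 := by rw [h']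
        simp [Sys.started, hz, h1, this]
      · have hs : Starts F v (H + 1) := ⟨hz, by rw [h']⟩
        rw [if_pos hs]
        have : (sys F v (H + 1)).served = (sys F v H).served + 1 := by rw [h']
        simp only [Sys.started, hz, h1, this, if_false, Finset.sum_range_succ]

end Sums

/-- Mass balance: what is neither lost nor waiting has been taken into service. -/
lemma Good.mass_balance (hv : Good v) (F : Set ℝ) (H : ℕ) :
    (sys F v H).lost + ((sys F v H).content - min (v (3, (sys F v H).served)) (sys F v H).work) +
      ∑ e ∈ Finset.range (H + 1), (open Classical in
        if Starts F v e then min (v (3, (sys F v e).served)) (sys F v e).work else 0) =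
      ∑ i ∈ Finset.range (sys F v H).arr, v (1, i) := by
  classical
  induction H with
  | zero =>
    by_cases hF : v (1, 0) ∈ F
    · have : Starts F v 0 := ⟨(hv.content_zero_ne_zero_iff).2 hF, sys_zero_fresh F v⟩
      simp [this, sys_zero_of_mem hF]
    · have : ¬ Starts F v 0 := fun h => hF ((hv.content_zero_ne_zero_iff).1 h.1)
      simp [this, sys_zero_of_notMem hF, (hv.Y_pos 0).le]
  | succ H ih =>
    rw [Finset.sum_range_succ]
    rcases sys_succ_cases F v H with ⟨h1, h'⟩ | ⟨h1, h2, hF, h'⟩ | ⟨h1, h2, hF, h'⟩ | ⟨h1, h2, h'⟩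
    · rw [if_neg fun h => h.1 (h' ▸ h1), h', add_zero]
      exact ih
    · rw [if_neg fun h => by simpa [h'] using h.2, add_zero, h']
      dsimp only
      rw [Finset.sum_range_succ fun i => v (1, i)]
      linarith
    · rw [if_neg fun h => by simpa [h'] using h.2, add_zero, h']
      dsimp only
      rw [Finset.sum_range_succ fun i => v (1, i)]
      linarith
    · by_cases hz : (sys F v (H + 1)).content = 0
      · rw [if_neg fun h => h.1 hz]
        rw [h'] at hz ⊢
        dsimp only at hz ⊢
        rw [hz, min_eq_right (hv.Y_pos _).le]
        linarith
      · have hs : Starts F v (H + 1) := ⟨hz, by rw [h']⟩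
        rw [if_pos hs, h']
        dsimp only
        linarith

/-- Arrivals and completions alternate in the order of time. -/
lemma Good.time_inv (hv : Good v) (F : Set ℝ) (e : ℕ) :
    arrTime v ((sys F v e).arr - 1) ≤ srvTime v (sys F v e).started ∧
    srvTime v (sys F v e).served ≤ arrTime v (sys F v e).arr ∧
    ((sys F v e).content = 0 → (sys F v 0).content ≠ 0 →
      srvTime v (sys F v e).served < arrTime v (sys F v e).arr) := by
  induction e with
  | zero =>
    refine ⟨?_, ?_, fun h h' => absurd h h'⟩
    · simpa [sys_zero_arr, arrTime] using hv.srvTime_nonneg _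
    · simpa [sys_zero_served, srvTime] using hv.arrTime_nonneg _
  | succ e ih =>
    obtain ⟨i1, i2, i3⟩ := ih
    have hst : (sys F v e).content ≠ 0 → (sys F v e).started = (sys F v e).served + 1 :=
      fun h => if_neg h
    have key : (sys F v e).content ≠ 0 → arrTime v (sys F v e).arr ≤
        srvTime v ((sys F v e).served + 1) → (sys F v (e + 1)).content ≠ 0 →
        (sys F v (e + 1)).served = (sys F v e).served →
        (sys F v (e + 1)).arr = (sys F v e).arr + 1 →
        arrTime v ((sys F v (e + 1)).arr - 1) ≤ srvTime v (sys F v (e + 1)).started := by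
      intro _ h2 hc h3 h4
      rw [Sys.started, if_neg hc, h3, h4, Nat.add_sub_cancel]
      exact h2
    rcases sys_succ_cases F v e with ⟨h1, h'⟩ | ⟨h1, h2, hF, h'⟩ | ⟨h1, h2, hF, h'⟩ | ⟨h1, h2, h'⟩
    · rw [h']; exact ⟨i1, i2, i3⟩
    · have hz : (sys F v (e + 1)).content ≠ 0 := by
        rw [h']; exact (add_pos_of_nonneg_of_pos (hv.content_nonneg F e) (hv.X_pos _)).ne'
      refine ⟨key h1 h2 hz (by rw [h']) (by rw [h']), ?_, fun h => absurd h hz⟩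
      rw [h']
      exact i2.trans (hv.arrTime_mono (Nat.le_succ _))
    · have hz : (sys F v (e + 1)).content ≠ 0 := by rw [h']; exact h1
      refine ⟨key h1 h2 hz (by rw [h']) (by rw [h']), ?_, fun h => absurd h hz⟩
      rw [h']
      exact i2.trans (hv.arrTime_mono (Nat.le_succ _))
    · have e1 : (sys F v (e + 1)).served = (sys F v e).served + 1 := by rw [h']
      have e2 : (sys F v (e + 1)).arr = (sys F v e).arr := by rw [h']
      rw [e1, e2]
      refine ⟨?_, h2.le, fun _ _ => h2⟩
      rw [hst h1] at i1
      refine i1.trans (hv.srvTime_mono ?_)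
      unfold Sys.started
      split_ifs <;> omega

/-- All interarrival times but the last are over by the end of the services started. The last one
may reach far beyond, and truncation limits its contribution to `c`. -/
lemma Good.sum_min_le (hv : Good v) (F : Set ℝ) {c : ℝ} (e : ℕ) :
    ∑ i ∈ Finset.range (sys F v e).arr, min (v (0, i)) c ≤
      ∑ i ∈ Finset.range (sys F v e).started, v (2, i) + c := by
  obtain ⟨k, hk⟩ := Nat.exists_eq_add_of_le' (one_le_arr F v e)
  have h := (hv.time_inv F e).1
  rw [hk, Nat.add_sub_cancel] at h
  rw [hk, Finset.sum_range_succ]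
  exact add_le_add ((Finset.sum_le_sum fun i _ => min_le_left _ _).trans h) (min_le_right _ _)

/-- As long as the system is busy, every event is an arrival or a completion. -/
lemma arr_add_served (hb : ∀ e, (sys F v e).content ≠ 0) (e : ℕ) :
    (sys F v e).arr + (sys F v e).served = e + 1 := by
  induction e with
  | zero => simp [sys_zero_arr, sys_zero_served]
  | succ e ih =>
    rcases sys_succ_cases F v e with ⟨h1, h'⟩ | ⟨h1, h2, hF, h'⟩ | ⟨h1, h2, hF, h'⟩ | ⟨h1, h2, h'⟩
    · exact absurd h1 (hb e)
    all_goals rw [h']; dsimp only; omega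

/-- Only a completion can empty the system, since an arrival never decreases the content. -/
lemma Good.Ends_cases (hv : Good v) {e : ℕ} (he : Ends F v e) :
    srvTime v ((sys F v e).served + 1) < arrTime v (sys F v e).arr ∧
    sys F v (e + 1) = ⟨(sys F v e).arr, (sys F v e).served + 1,
        (sys F v e).content - min (v (3, (sys F v e).served)) (sys F v e).work,
        (sys F v e).content - min (v (3, (sys F v e).served)) (sys F v e).work,
        (sys F v e).lost, true⟩ := by
  rcases sys_succ_cases F v e with ⟨h1, h'⟩ | ⟨h1, h2, hF, h'⟩ | ⟨h1, h2, hF, h'⟩ | ⟨h1, h2, h'⟩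
  · exact absurd h1 he.1
  · refine absurd he.2 ?_
    rw [h']; exact (add_pos_of_nonneg_of_pos (hv.content_nonneg F e) (hv.X_pos _)).ne'
  · refine absurd he.2 ?_
    rw [h']; exact h1
  · exact ⟨h2, h'⟩

lemma exists_Ends (h0 : (sys F v 0).content ≠ 0) {H : ℕ} (hH : (sys F v H).content = 0) :
    ∃ e, Ends F v e := by
  classical
  have hex : ∃ H, (sys F v H).content = 0 := ⟨H, hH⟩
  obtain ⟨k, hk⟩ := Nat.exists_eq_succ_of_ne_zero
    (show Nat.find hex ≠ 0 from fun h => h0 (h ▸ Nat.find_spec hex))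
  exact ⟨k, Nat.find_min hex (by omega), by have := Nat.find_spec hex; rwa [hk] at this⟩

lemma Ends.unique {e e' : ℕ} (h : Ends F v e) (h' : Ends F v e') : e = e' := by
  by_contra hne
  rcases lt_or_gt_of_ne hne with hlt | hlt
  · exact content_ne_zero_of_le (show e + 1 ≤ e' from hlt) h'.1 h.2
  · exact content_ne_zero_of_le (show e' + 1 ≤ e from hlt) h.1 h'.2

/-- A system that has lost nothing behaves like the system without capacity bound. -/
lemma Good.sys_eq_univ (hv : Good v) {e : ℕ} (h : (sys F v e).lost = 0) :
    sys F v e = sys Set.univ v e := by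
  induction e with
  | zero =>
    by_cases hF : v (1, 0) ∈ F
    · rw [sys_zero_of_mem hF, sys_zero_of_mem (Set.mem_univ _)]
    · rw [sys_zero_of_notMem hF] at h
      exact absurd h (hv.X_pos 0).ne'
  | succ e ih =>
    have h0 : (sys F v e).lost = 0 :=
      le_antisymm ((hv.lost_mono F (Nat.le_succ e)).trans h.le) (hv.sys_inv F e).2.2.2.1
    specialize ih h0
    have hu : sys Set.univ v (e + 1) = next Set.univ v (sys F v e) := by rw [ih]; rfl
    rw [hu]
    rcases sys_succ_cases F v e with ⟨h1, h'⟩ | ⟨h1, h2, hF, h'⟩ | ⟨h1, h2, hF, h'⟩ | ⟨h1, h2, h'⟩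
    · simp [h', next, h1]
    · simp [h', next, h1, h2]
    · rw [h'] at h
      have := hv.X_pos (sys F v e).arr
      simp only at h
      linarith
    · simp [h', next, h1, h2]

lemma Good.content_le_sum (hv : Good v) (F : Set ℝ) (e : ℕ) :
    (sys F v e).content ≤ ∑ i ∈ Finset.range (sys F v e).arr, v (1, i) := by
  induction e with
  | zero =>
    by_cases hF : v (1, 0) ∈ F
    · simp [sys_zero_of_mem hF]
    · simp [sys_zero_of_notMem hF, (hv.X_pos 0).le]
  | succ e ih =>
    rcases sys_succ_cases F v e with ⟨h1, h'⟩ | ⟨h1, h2, hF, h'⟩ | ⟨h1, h2, hF, h'⟩ | ⟨h1, h2, h'⟩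
    · rw [h']; exact ih
    · rw [h']; dsimp only; rw [Finset.sum_range_succ]; linarith
    · rw [h']; dsimp only; rw [Finset.sum_range_succ]; linarith [hv.X_pos (sys F v e).arr]
    · rw [h']; dsimp only
      linarith [le_min (hv.Y_pos (sys F v e).served).le (hv.sys_inv F e).1]

/-- A large capacity loses nothing. -/
lemma Good.lost_eq_zero (hv : Good v) {n : ℝ} {e : ℕ}
    (hn : ∑ i ∈ Finset.range (sys Set.univ v e).arr, v (1, i) ≤ n) :
    (sys (Set.Iic n) v e).lost = 0 := by
  induction e with
  | zero =>
    rw [sys_zero_arr, Finset.sum_range_one] at hn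
    rw [sys_zero_of_mem (show v (1, 0) ∈ Set.Iic n from hn)]
  | succ e ih =>
    have ih := ih ((Finset.sum_le_sum_of_subset_of_nonneg
      (Finset.range_mono (arr_mono Set.univ v (Nat.le_succ e)))
      fun i _ _ => (hv.X_pos i).le).trans hn)
    have heq := hv.sys_eq_univ ih
    rcases sys_succ_cases (Set.Iic n) v e with
      ⟨h1, h'⟩ | ⟨h1, h2, hF, h'⟩ | ⟨h1, h2, hF, h'⟩ | ⟨h1, h2, h'⟩
    · rw [h', ih]
    · rw [h']; exact ih
    · have h4 := hv.content_le_sum Set.univ e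
      rw [heq] at h1 h2 hF
      have h5 : sys Set.univ v (e + 1) = next Set.univ v (sys Set.univ v e) := rfl
      simp only [next, if_neg h1, if_pos h2, Set.mem_univ, if_true] at h5
      rw [h5] at hn
      dsimp only at hn
      rw [Finset.sum_range_succ] at hn
      exact absurd (show _ ≤ n by linarith) hF
    · rw [h']; exact ih

/-- The inputs that the system has used in a state with the given numbers of arrivals and
completions. -/
def Agree (v v' : Inp) (i j : ℕ) (fresh : Bool) : Prop :=
  (∀ k < i, v (0, k) = v' (0, k)) ∧ (∀ k < i, v (1, k) = v' (1, k)) ∧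
  (∀ k < j, v (2, k) = v' (2, k)) ∧ (∀ k < j, v (3, k) = v' (3, k)) ∧
  (fresh = false → v (2, j) = v' (2, j))

lemma arrTime_congr {v v' : Inp} {i : ℕ} (h : ∀ k < i, v (0, k) = v' (0, k)) :
    arrTime v i = arrTime v' i :=
  Finset.sum_congr rfl fun k hk => h k (Finset.mem_range.1 hk)

lemma srvTime_congr {v v' : Inp} {i : ℕ} (h : ∀ k < i, v (2, k) = v' (2, k)) :
    srvTime v i = srvTime v' i :=
  Finset.sum_congr rfl fun k hk => h k (Finset.mem_range.1 hk)

/-- Each event reads only inputs that the new state counts as used. The time of the current service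
is first read when its end is compared with the next arrival, after which either the state is no
longer fresh or the service is complete; its batch is read only at completion. -/
lemma sys_eq_of_agree {v v' : Inp} {e : ℕ}
    (h : Agree v v' (sys F v e).arr (sys F v e).served (sys F v e).fresh) :
    sys F v e = sys F v' e := by
  induction e with
  | zero =>
    have h1 : v (1, 0) = v' (1, 0) := h.2.1 0 (by rw [sys_zero_arr]; exact one_pos)
    by_cases hF : v (1, 0) ∈ F
    · rw [sys_zero_of_mem hF, sys_zero_of_mem (h1 ▸ hF), h1]
    · rw [sys_zero_of_notMem hF, sys_zero_of_notMem (h1 ▸ hF), h1]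
  | succ e ih =>
    obtain ⟨a1, a2, a3, a4, a5⟩ := h
    have hv' : sys F v' (e + 1) = next F v' (sys F v' e) := rfl
    rcases sys_succ_cases F v e with ⟨h1, h'⟩ | ⟨h1, h2, hF, h'⟩ | ⟨h1, h2, hF, h'⟩ | ⟨h1, h2, h'⟩
    · rw [h'] at a1 a2 a3 a4 a5
      rw [hv', ← ih ⟨a1, a2, a3, a4, a5⟩, h', next, if_pos h1]
    all_goals
      rw [h'] at a1 a2 a3 a4 a5
      dsimp only at a1 a2 a3 a4 a5
      have hA : arrTime v (sys F v e).arr = arrTime v' (sys F v e).arr :=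
        arrTime_congr fun k hk => a1 k (by omega)
      have hT : srvTime v ((sys F v e).served + 1) = srvTime v' ((sys F v e).served + 1) :=
        srvTime_congr fun k hk => by
          rcases (Nat.lt_succ_iff_lt_or_eq.1 hk) with hk | rfl
          · exact a3 _ (by omega)
          · first | exact a5 rfl | exact a3 _ (by omega)
    · have hX := a2 (sys F v e).arr (by omega)
      rw [hv', ← ih ⟨fun k hk => a1 k (by omega), fun k hk => a2 k (by omega), a3, a4,
        fun _ => a5 rfl⟩, h', next, if_neg h1, if_pos (by rw [← hA, ← hT]; exact h2),
        if_pos (by rw [← hX]; exact hF), hX]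
    · have hX := a2 (sys F v e).arr (by omega)
      rw [hv', ← ih ⟨fun k hk => a1 k (by omega), fun k hk => a2 k (by omega), a3, a4,
        fun _ => a5 rfl⟩, h', next, if_neg h1, if_pos (by rw [← hA, ← hT]; exact h2),
        if_neg (by rw [← hX]; exact hF), hX]
    · have hY := a4 (sys F v e).served (by omega)
      rw [hv', ← ih ⟨a1, a2, fun k hk => a3 k (by omega), fun k hk => a4 k (by omega),
        fun _ => a3 _ (by omega)⟩, h', next, if_neg h1,
        if_neg (by rw [← hA, ← hT]; exact not_le.2 h2), hY]

/-- Changing the interarrival time in which the busy period ends has no effect as long as the next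
arrival comes after the end. -/
lemma Good.Ends_of_agree {v v' : Inp} (hv : Good v) {e k : ℕ} (hE : Ends F v e)
    (hk : (sys F v e).arr = k + 1) (hag : ∀ p, p ≠ (0, k) → v p = v' p)
    (hlt : srvTime v ((sys F v e).served + 1) < arrTime v' (k + 1)) :
    sys F v' e = sys F v e ∧ Ends F v' e := by
  have hT : ∀ j, srvTime v j = srvTime v' j := fun j =>
    srvTime_congr fun i _ => hag _ (by simp)
  have hstep : ∀ e' ≤ e, sys F v e' = sys F v' e' → sys F v (e' + 1) = sys F v' (e' + 1) := by
    intro e' he' ih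
    have hv' : sys F v' (e' + 1) = next F v' (sys F v e') := by rw [ih]; rfl
    have hc : (sys F v e').content ≠ 0 := content_ne_zero_of_le he' hE.1
    have hvv : sys F v (e' + 1) = next F v (sys F v e') := rfl
    have hX : ∀ i, v (1, i) = v' (1, i) := fun i => hag _ (by simp)
    have hY : ∀ i, v (3, i) = v' (3, i) := fun i => hag _ (by simp)
    have harr : (sys F v e').arr ≤ k + 1 := hk ▸ arr_mono F v he'
    have hsv : (sys F v e').served ≤ (sys F v e).served := served_mono F v he'
    have hiff : (arrTime v (sys F v e').arr ≤ srvTime v ((sys F v e').served + 1)) ↔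
        (arrTime v' (sys F v e').arr ≤ srvTime v' ((sys F v e').served + 1)) := by
      rcases Nat.lt_or_ge (sys F v e').arr (k + 1) with hl | hg
      · rw [hT, arrTime_congr fun i hi => hag (0, i) (by
          simp only [ne_eq, Prod.mk.injEq, true_and]; omega)]
      -- Once `k + 1` batches have arrived, both inputs let only completions follow up to the end:
      -- for `v` a further arrival would contradict the count in state `e`, for `v'` it comes too
      -- late by `hlt`.
      · have heq : (sys F v e').arr = k + 1 := le_antisymm harr hg
        refine iff_of_false (fun h => ?_) (fun h => ?_)
        · rcases Nat.lt_or_ge e' e with hl | hge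
          · have h2 : (sys F v (e' + 1)).arr = k + 2 := by
              rcases sys_succ_cases F v e' with
                ⟨h1, h'⟩ | ⟨h1, h2, hF, h'⟩ | ⟨h1, h2, hF, h'⟩ | ⟨h1, h2, h'⟩
              · exact absurd h1 hc
              · rw [h']; dsimp only; omega
              · rw [h']; dsimp only; omega
              · exact absurd h (not_le.2 h2)
            have h3 := arr_mono F v (show e' + 1 ≤ e from hl)
            dsimp only at h3
            omega
          · have : e' = e := le_antisymm he' hge
            subst this
            exact absurd h (not_le.2 (hv.Ends_cases hE).1)
        · rw [heq, ← hT] at h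
          have := hv.srvTime_mono (show (sys F v e').served + 1 ≤ (sys F v e).served + 1 by omega)
          linarith
    rw [hv', hvv]
    unfold next
    rw [hX, hY]
    simp only [hiff]
  have hall : ∀ e' ≤ e + 1, sys F v e' = sys F v' e' := by
    intro e' he'
    induction e' with
    | zero =>
      have h1 : v (1, 0) = v' (1, 0) := hag _ (by simp)
      by_cases hF : v (1, 0) ∈ F
      · rw [sys_zero_of_mem hF, sys_zero_of_mem (h1 ▸ hF), h1]
      · rw [sys_zero_of_notMem hF, sys_zero_of_notMem (h1 ▸ hF), h1]
    | succ e' ih => exact hstep e' (by omega) (ih (by omega))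
  exact ⟨(hall e (Nat.le_succ e)).symm, by
    rw [Ends, ← hall e (Nat.le_succ e), ← hall _ le_rfl]; exact hE⟩

/-- Different services start with different numbers of completions. -/
lemma Starts.served_lt {e e' : ℕ} (h : Starts F v e) (h' : Starts F v e') (he : e < e') :
    (sys F v e).served < (sys F v e').served := by
  have : ∀ k, e + 1 ≤ k → (sys F v k).content ≠ 0 →
      (sys F v e).served < (sys F v k).served ∨ (sys F v k).fresh = false := by
    intro k hk
    induction k, hk using Nat.le_induction with
    | base =>
      intro _
      rcases sys_succ_cases F v e with
        ⟨h1, h'⟩ | ⟨h1, h2, hF, h'⟩ | ⟨h1, h2, hF, h'⟩ | ⟨h1, h2, h'⟩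
      · exact absurd h1 h.1
      all_goals simp [h']
    | succ k hk ih =>
      intro hc
      have ih := ih (content_ne_zero_of_le (Nat.le_succ k) hc)
      have hm := served_mono F v (show e ≤ k by omega)
      dsimp only at hm
      rcases sys_succ_cases F v k with
        ⟨h1, h'⟩ | ⟨h1, h2, hF, h'⟩ | ⟨h1, h2, hF, h'⟩ | ⟨h1, h2, h'⟩
      · rw [h']; exact ih
      · simp [h']
      · simp [h']
      · left; rw [h']; dsimp only; omega
  rcases this e' he h'.1 with h1 | h1
  · exact h1
  · rw [h'.2] at h1; cases h1

end BatchQueue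

/-! ### A favourable box of inputs ends the busy period soon -/

namespace BatchQueue

open scoped ENNReal

variable {F : Set ℝ} {v : Inp}

/-- After a service start with little mass present, fast services and a long pause in the arrivals
after the next batch end the busy period soon. -/
lemma Good.served_lt_of_box (hv : Good v) {e K : ℕ} {c C δ B : ℝ} (hs : Starts F v e)
    (hw : (sys F v e).work ≤ c) (hδ : 0 < δ) (hC : 0 ≤ C) (hB : 0 ≤ B) (hK : c + B ≤ K * δ)
    (hτ : 2 * K * C < v (0, (sys F v e).arr)) (hX : v (1, (sys F v e).arr) ≤ B)
    (hχ : ∀ k, (sys F v e).served ≤ k → k < (sys F v e).served + 2 * K → v (2, k) ≤ C)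
    (hY : ∀ k, (sys F v e).served ≤ k → k < (sys F v e).served + 2 * K → δ ≤ v (3, k))
    {e' : ℕ} (he : e ≤ e') (hc : (sys F v e').content ≠ 0) :
    (sys F v e').served < (sys F v e).served + 2 * K := by
  set i := (sys F v e).arr with hi
  set j := (sys F v e).served with hj
  have hsrv : ∀ m, m ≤ 2 * K → srvTime v (j + m) ≤ srvTime v j + m * C := by
    intro m hm
    induction m with
    | zero => simp
    | succ m ih =>
      rw [← add_assoc, srvTime_succ]
      have := hχ (j + m) (by omega) (by omega)
      have := ih (by omega)
      push_cast
      linarith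
  -- The service starts no later than the next arrival, and `2 * K` services take at most `2 * K *
  -- C`, which is less than the interarrival time after that arrival. So at most one batch arrives
  -- during these services.
  have hblock : ∀ m, m + 1 ≤ j + 2 * K → j ≤ m → srvTime v (m + 1) < arrTime v (i + 1) := by
    intro m h1 h2
    obtain ⟨d, rfl⟩ := Nat.exists_eq_add_of_le h2
    have h3 := hsrv (d + 1) (by omega)
    have h4 := (hv.time_inv F e).2.1
    rw [arrTime_succ]
    have h5 : ((d + 1 : ℕ) : ℝ) ≤ 2 * K := by exact_mod_cast (by omega : d + 1 ≤ 2 * K)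
    have h6 := mul_le_mul_of_nonneg_right h5 hC
    rw [add_assoc]
    rw [← hi, ← hj] at h4
    linarith
  -- Before the next arrival each completion removes at least `δ` or everything. A batch arriving in
  -- mid-service is not available to that service, which may therefore remove less than `δ`; so up
  -- to `j + K` completions only the bound `c + B` is kept. From then on each completion again
  -- removes at least `δ` or everything, and `c + B ≤ K * δ` is used up within `K` more services.
  have hkey : ∀ e', e ≤ e' → (sys F v e').content = 0 ∨
      ((sys F v e').arr = i ∧ (sys F v e').content = (sys F v e').work ∧ j ≤ (sys F v e').served ∧
        (sys F v e').content + (sys F v e').served * δ ≤ c + j * δ) ∨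
      ((sys F v e').arr = i + 1 ∧ j ≤ (sys F v e').served ∧ (sys F v e').served < j + K ∧
        (sys F v e').content ≤ c + B) ∨
      ((sys F v e').arr = i + 1 ∧ (sys F v e').content = (sys F v e').work ∧
        j + K ≤ (sys F v e').served ∧
        (sys F v e').content + (sys F v e').served * δ ≤ c + B + (j + K) * δ) := by
    intro e' he'
    induction e', he' using Nat.le_induction with
    | base =>
      right; left
      have := (hv.sys_inv F e).2.2.1 hs.2
      exact ⟨rfl, this.symm, le_rfl, by rw [← this]; linarith⟩
    | succ e' _ ih =>
      have h0 := hv.content_nonneg F e'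
      set s := sys F v e' with hsdef
      have hcast : ∀ m : ℕ, s.content ≠ 0 → s.content + s.served * δ ≤ m * δ → s.served < m := by
        intro m h1 h2
        have h3 : 0 < s.content := lt_of_le_of_ne h0 (Ne.symm h1)
        have h4 : (s.served : ℝ) * δ < m * δ := by linarith
        exact_mod_cast lt_of_mul_lt_mul_right h4 hδ.le
      have hdrop : ∀ b : ℝ, j ≤ s.served → s.served < j + 2 * K → s.content = s.work →
          s.content + s.served * δ ≤ b →
          s.content - min (v (3, s.served)) s.work = 0 ∨
          s.content - min (v (3, s.served)) s.work + ((s.served + 1 : ℕ) : ℝ) * δ ≤ b := by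
        intro b h1 h2 h3 h4
        have h5 := hY _ h1 h2
        rcases le_total (v (3, s.served)) s.work with h6 | h6
        · right; rw [min_eq_left h6]; push_cast; linarith
        · left; rw [min_eq_right h6]; linarith
      rcases ih with ih | ⟨a1, a2, a3, a4⟩ | ⟨a1, a2, a3, a4⟩ | ⟨a1, a2, a3, a4⟩
      · left; rw [sys_of_empty ih (Nat.le_succ e')]; exact ih
      · by_cases hz : s.content = 0
        · left; rw [sys_of_empty hz (Nat.le_succ e')]; exact hz
        have hsK : s.served < j + K := hcast _ hz (by push_cast; linarith)
        have hcc : s.content ≤ c := by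
          have : (j : ℝ) * δ ≤ s.served * δ := by gcongr
          linarith
        rcases sys_succ_cases F v e' with
          ⟨h1, h'⟩ | ⟨h1, h2, hF, h'⟩ | ⟨h1, h2, hF, h'⟩ | ⟨h1, h2, h'⟩
        · exact absurd h1 hz
        · right; right; left
          rw [h', ← hsdef]; dsimp only
          exact ⟨by omega, a3, hsK, by rw [a1]; linarith⟩
        · right; right; left
          rw [h', ← hsdef]; dsimp only
          exact ⟨by omega, a3, hsK, by linarith⟩
        · rw [h', ← hsdef]; dsimp only
          rcases hdrop _ a3 (by omega) a2 a4 with h | h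
          · left; exact h
          · right; left
            exact ⟨a1, rfl, by omega, h⟩
      · by_cases hz : s.content = 0
        · left; rw [sys_of_empty hz (Nat.le_succ e')]; exact hz
        have hno : srvTime v (s.served + 1) < arrTime v s.arr := by
          rw [a1]; exact hblock _ (by omega) a2
        rcases sys_succ_cases F v e' with
          ⟨h1, h'⟩ | ⟨h1, h2, hF, h'⟩ | ⟨h1, h2, hF, h'⟩ | ⟨h1, h2, h'⟩
        · exact absurd h1 hz
        · exact absurd h2 (not_le.2 hno)
        · exact absurd h2 (not_le.2 hno)
        · rw [h', ← hsdef]; dsimp only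
          have h3 : 0 ≤ min (v (3, s.served)) s.work :=
            le_min (hv.Y_pos _).le (hv.sys_inv F e').1
          by_cases h4 : s.served + 1 < j + K
          · right; right; left
            exact ⟨a1, by omega, h4, by linarith⟩
          · right; right; right
            have h5 : s.served + 1 = j + K := by omega
            refine ⟨a1, rfl, by omega, ?_⟩
            rw [h5]; push_cast; linarith
      · by_cases hz : s.content = 0
        · left; rw [sys_of_empty hz (Nat.le_succ e')]; exact hz
        have hsK : s.served < j + 2 * K := hcast _ hz (by push_cast; linarith)
        have hno : srvTime v (s.served + 1) < arrTime v s.arr := by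
          rw [a1]; exact hblock _ (by omega) (by omega)
        rcases sys_succ_cases F v e' with
          ⟨h1, h'⟩ | ⟨h1, h2, hF, h'⟩ | ⟨h1, h2, hF, h'⟩ | ⟨h1, h2, h'⟩
        · exact absurd h1 hz
        · exact absurd h2 (not_le.2 hno)
        · exact absurd h2 (not_le.2 hno)
        · rw [h', ← hsdef]; dsimp only
          rcases hdrop _ (by omega) hsK a2 a4 with h | h
          · left; exact h
          · right; right; right
            exact ⟨a1, rfl, by omega, h⟩
  have h0 := hv.content_nonneg F e'
  have h3 : 0 < (sys F v e').content := lt_of_le_of_ne h0 (Ne.symm hc)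
  have hcast : (sys F v e').content + (sys F v e').served * δ ≤ (j + 2 * K : ℕ) * δ →
      (sys F v e').served < j + 2 * K := by
    intro h2
    have h4 : ((sys F v e').served : ℝ) * δ < ((j + 2 * K : ℕ) : ℝ) * δ := by linarith
    exact_mod_cast lt_of_mul_lt_mul_right h4 hδ.le
  have hKδ : 0 ≤ (K : ℝ) * δ := by positivity
  rcases hkey e' he with h | ⟨-, -, -, a4⟩ | ⟨-, -, a3, -⟩ | ⟨-, -, -, a4⟩
  · exact absurd h hc
  · exact hcast (by push_cast; linarith)
  · omega
  · exact hcast (by push_cast; linarith)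

/-- The inputs that have not been used when `i` batches have arrived and `j` services have been
completed. -/
def Unused (i j : ℕ) (p : Fin 4 × ℕ) : Prop :=
  ((p.1 = 0 ∨ p.1 = 1) ∧ i ≤ p.2) ∨ ((p.1 = 2 ∨ p.1 = 3) ∧ j ≤ p.2)

/-- At a start the state is fresh, so even the time of the service just started is unread. -/
lemma Starts.sys_eq {v v' : Inp} {e : ℕ} (h : Starts F v e)
    (hag : ∀ p, ¬ Unused (sys F v e).arr (sys F v e).served p → v p = v' p) :
    sys F v' e = sys F v e := by
  refine (sys_eq_of_agree ⟨fun k hk => hag _ ?_, fun k hk => hag _ ?_, fun k hk => hag _ ?_,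
    fun k hk => hag _ ?_, fun hf => ?_⟩).symm
  · simp [Unused, hk]
  · simp [Unused, hk]
  · simp [Unused, hk]
  · simp [Unused, hk]
  · rw [h.2] at hf; cases hf

/-- Only the arrival rows may change here: whether the next event is an arrival depends on the
current service time. -/
lemma Arrives.sys_eq {v v' : Inp} {e : ℕ} (h : Arrives F v e)
    (hag : ∀ p : Fin 4 × ℕ, ¬ ((p.1 = 0 ∨ p.1 = 1) ∧ (sys F v e).arr ≤ p.2) → v p = v' p) :
    sys F v' e = sys F v e ∧ Arrives F v' e := by
  have heq := (sys_eq_of_agree (F := F) (v := v) (v' := v') (e := e)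
    ⟨fun k hk => hag _ (by simp [hk]), fun k hk => hag _ (by simp [hk]),
      fun k hk => hag _ (by simp), fun k hk => hag _ (by simp), fun hf => hag _ (by simp)⟩).symm
  refine ⟨heq, ?_⟩
  rw [Arrives, heq, ← arrTime_congr (v := v) fun k hk => hag _ (by simp [hk]),
    ← srvTime_congr (v := v) fun k hk => hag _ (by simp)]
  exact h

/-! ### Measurability of the dynamics -/

section Measurability

lemma measurable_coord_index (k : Fin 4) {f : Inp → ℕ} (hf : Measurable f) :
    Measurable fun v : Inp => v (k, f v) := by
  have : Measurable fun x : ℕ × Inp => x.2 (k, x.1) :=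
    measurable_from_prod_countable_right fun i => measurable_pi_apply (k, i)
  exact this.comp (hf.prodMk measurable_id)

lemma measurable_arrTime {f : Inp → ℕ} (hf : Measurable f) :
    Measurable fun v : Inp => arrTime v (f v) := by
  have : Measurable fun x : ℕ × Inp => arrTime x.2 x.1 :=
    measurable_from_prod_countable_right fun i => by
      change Measurable fun v : Inp => arrTime v i
      unfold arrTime
      fun_prop
  exact this.comp (hf.prodMk measurable_id)

lemma measurable_srvTime {f : Inp → ℕ} (hf : Measurable f) :
    Measurable fun v : Inp => srvTime v (f v) := by
  have : Measurable fun x : ℕ × Inp => srvTime x.2 x.1 :=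
    measurable_from_prod_countable_right fun i => by
      change Measurable fun v : Inp => srvTime v i
      unfold srvTime
      fun_prop
  exact this.comp (hf.prodMk measurable_id)

instance : MeasurableSpace Sys :=
  MeasurableSpace.comap (fun s : Sys => (s.arr, s.served, s.content, s.work, s.lost, s.fresh))
    inferInstance

lemma measurable_toProd :
    Measurable fun s : Sys => (s.arr, s.served, s.content, s.work, s.lost, s.fresh) :=
  comap_measurable _

lemma measurable_arr : Measurable Sys.arr := measurable_toProd.fst
lemma measurable_served : Measurable Sys.served := measurable_toProd.snd.fst
lemma measurable_content : Measurable Sys.content := measurable_toProd.snd.snd.fst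
lemma measurable_work : Measurable Sys.work := measurable_toProd.snd.snd.snd.fst
lemma measurable_lost : Measurable Sys.lost := measurable_toProd.snd.snd.snd.snd.fst
lemma measurable_fresh : Measurable Sys.fresh := measurable_toProd.snd.snd.snd.snd.snd

lemma measurable_sysMk {α : Type*} [MeasurableSpace α] {a b : α → ℕ} {c d l : α → ℝ}
    {f : α → Bool} (ha : Measurable a) (hb : Measurable b) (hc : Measurable c)
    (hd : Measurable d) (hl : Measurable l) (hf : Measurable f) :
    Measurable fun x => (⟨a x, b x, c x, d x, l x, f x⟩ : Sys) := by
  refine measurable_comap_iff.2 ?_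
  exact ha.prodMk (hb.prodMk (hc.prodMk (hd.prodMk (hl.prodMk hf))))

lemma measurable_sys (hF : MeasurableSet F) (e : ℕ) : Measurable fun v : Inp => sys F v e := by
  classical
  have h1 : ∀ p : Fin 4 × ℕ, Measurable fun v : Inp => v p := measurable_pi_apply
  induction e with
  | zero =>
    change Measurable fun v => start F v
    unfold start
    refine Measurable.ite (h1 _ hF) ?_ ?_
    · exact measurable_sysMk measurable_const measurable_const (h1 _) (h1 _) measurable_const
        measurable_const
    · exact measurable_sysMk measurable_const measurable_const measurable_const measurable_const
        (h1 _) measurable_const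
  | succ e ih =>
    change Measurable fun v => next F v (sys F v e)
    have ha := measurable_arr.comp ih
    have hb := measurable_served.comp ih
    have hc := measurable_content.comp ih
    have hd := measurable_work.comp ih
    have hl := measurable_lost.comp ih
    have hA : Measurable fun v => arrTime v (sys F v e).arr := measurable_arrTime ha
    have hT : Measurable fun v => srvTime v ((sys F v e).served + 1) :=
      measurable_srvTime (hb.add_const 1)
    have hX : Measurable fun v : Inp => v (1, (sys F v e).arr) := measurable_coord_index 1 ha
    have hY : Measurable fun v : Inp => v (3, (sys F v e).served) := measurable_coord_index 3 hb
    unfold next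
    refine Measurable.ite (hc (measurableSet_singleton 0)) ih (Measurable.ite
      (measurableSet_le hA hT) (Measurable.ite ((hc.add hX) hF) ?_ ?_) ?_)
    · exact measurable_sysMk (ha.add_const 1) hb (hc.add hX) hd hl measurable_const
    · exact measurable_sysMk (ha.add_const 1) hb hc hd (hl.add hX) measurable_const
    · exact measurable_sysMk ha (hb.add_const 1) (hc.sub (hY.min hd)) (hc.sub (hY.min hd)) hl
        measurable_const

lemma measurableSet_Starts (hF : MeasurableSet F) (e : ℕ) : MeasurableSet {v | Starts F v e} :=
  ((measurable_content.comp (measurable_sys hF e)) (measurableSet_singleton 0).compl).inter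
    ((measurable_fresh.comp (measurable_sys hF e)) (measurableSet_singleton true))

lemma measurableSet_Arrives (hF : MeasurableSet F) (e : ℕ) : MeasurableSet {v | Arrives F v e} :=
  ((measurable_content.comp (measurable_sys hF e)) (measurableSet_singleton 0).compl).inter
    (measurableSet_le (measurable_arrTime (measurable_arr.comp (measurable_sys hF e)))
      (measurable_srvTime ((measurable_served.comp (measurable_sys hF e)).add_const 1)))

lemma measurableSet_Ends (hF : MeasurableSet F) (e : ℕ) : MeasurableSet {v | Ends F v e} :=
  ((measurable_content.comp (measurable_sys hF e)) (measurableSet_singleton 0).compl).inter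
    ((measurable_content.comp (measurable_sys hF (e + 1))) (measurableSet_singleton 0))

end Measurability

/-- The law of the input when the rows have the laws `L`. -/
noncomputable abbrev inputLaw (L : Fin 4 → Measure ℝ) : Measure Inp :=
  Measure.infinitePi fun p : Fin 4 × ℕ => L p.1

/-- The laws of interarrival times, batches, service times and service batches live on the positive
half-line. -/
structure PosLaw (L : Fin 4 → Measure ℝ) : Prop where
  τ_pos : ∀ᵐ z ∂L 0, 0 < z
  X_pos : ∀ᵐ z ∂L 1, 0 < z
  χ_nonneg : ∀ᵐ z ∂L 2, 0 ≤ z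
  Y_pos : ∀ᵐ z ∂L 3, 0 < z

/-! ### Unread inputs are independent of the state -/

section Law

variable {L : Fin 4 → Measure ℝ} [∀ k, IsProbabilityMeasure (L k)]

lemma ae_coord {k : Fin 4} {q : ℝ → Prop} (h : ∀ᵐ z ∂L k, q z) (i : ℕ) :
    ∀ᵐ v ∂inputLaw L, q (v (k, i)) := by
  have := measurePreserving_eval_infinitePi (fun p : Fin 4 × ℕ => L p.1) (k, i)
  exact this.quasiMeasurePreserving.ae h

lemma PosLaw.ae_good (h : PosLaw L) : ∀ᵐ v ∂inputLaw L, Good v := by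
  filter_upwards [ae_all_iff.2 fun i => ae_coord h.τ_pos i,
    ae_all_iff.2 fun i => ae_coord h.X_pos i,
    ae_all_iff.2 fun i => ae_coord h.χ_nonneg i, ae_all_iff.2 fun i => ae_coord h.Y_pos i]
    with v h0 h1 h2 h3
  exact ⟨h0, h1, h2, h3⟩

lemma lintegral_coord (k : Fin 4) (i : ℕ) {f : ℝ → ℝ≥0∞} (hf : Measurable f) :
    ∫⁻ v, f (v (k, i)) ∂inputLaw L = ∫⁻ z, f z ∂L k := by
  have := measurePreserving_eval_infinitePi (fun p : Fin 4 × ℕ => L p.1) (k, i)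
  exact this.lintegral_comp hf

open Classical in
/-- The service that starts in state `e` has fresh parameters. -/
lemma lintegral_start (hF : MeasurableSet F) (e : ℕ) {k : Fin 4} (hk : k = 2 ∨ k = 3)
    {φ : ℝ → ℝ → ℝ≥0∞} (hφ : Measurable (Function.uncurry φ)) :
    ∫⁻ v, (if Starts F v e then φ (v (k, (sys F v e).served)) (sys F v e).work else 0)
      ∂inputLaw L =
    ∫⁻ v, (if Starts F v e then ∫⁻ z, φ z (sys F v e).work ∂L k else 0) ∂inputLaw L := by
  have hs := measurable_sys hF e
  have hsv : Measurable fun v => (sys F v e).served := measurable_served.comp hs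
  have hw : Measurable fun v => (sys F v e).work := measurable_work.comp hs
  have hS := measurableSet_Starts hF e
  have hφ' : Measurable fun v : Inp => φ (v (k, (sys F v e).served)) (sys F v e).work :=
    hφ.comp ((measurable_coord_index k hsv).prodMk hw)
  have hΦ : Measurable fun m => ∫⁻ z, φ z m ∂L k :=
    Measurable.lintegral_prod_left' (f := fun x : ℝ × ℝ => φ x.1 x.2) hφ
  have hΦ' : Measurable fun v : Inp => ∫⁻ z, φ z (sys F v e).work ∂L k := hΦ.comp hw
  have hj : ∀ j, MeasurableSet {v : Inp | (sys F v e).served = j} := fun j =>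
    hsv (measurableSet_singleton j)
  rw [lintegral_eq_tsum_index (fun v => (sys F v e).served) _ (fun j => Measurable.ite (hj j)
      (Measurable.ite hS hφ' measurable_const)
      measurable_const),
    lintegral_eq_tsum_index (fun v => (sys F v e).served) _ (fun j => Measurable.ite (hj j)
      (Measurable.ite hS hΦ' measurable_const) measurable_const)]
  refine tsum_congr fun j => ?_
  have hm : MeasurableSet {v : Inp | Starts F v e ∧ (sys F v e).served = j} := hS.inter (hj j)
  have key := lintegral_of_invariant (L := fun p : Fin 4 × ℕ => L p.1) (k, j)
    (f := fun v z => if Starts F v e ∧ (sys F v e).served = j then φ z (sys F v e).work else 0)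
    (by
      refine Measurable.ite (measurable_fst hm) ?_ measurable_const
      exact hφ.comp (f := fun x : Inp × ℝ => (x.2, (sys F x.1 e).work))
        (measurable_snd.prodMk (hw.comp measurable_fst)))
    (by
      intro v z w
      have aux : ∀ v z, Starts F v e ∧ (sys F v e).served = j →
          sys F (Function.update v (k, j) z) e = sys F v e := by
        rintro v z ⟨h1, h2⟩
        refine h1.sys_eq fun p hp => (Function.update_of_ne ?_ _ _).symm
        rintro rfl
        exact hp (Or.inr ⟨hk, h2.le⟩)
      by_cases h : Starts F v e ∧ (sys F v e).served = j
      · have h1 := aux v z h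
        have h2 : Starts F (Function.update v (k, j) z) e := by
          rw [Starts, h1]; exact h.1
        simp only [h1, h2, h]
      · have h' : ¬ (Starts F (Function.update v (k, j) z) e ∧
            (sys F (Function.update v (k, j) z) e).served = j) := by
          intro h2
          have h1 := aux _ (v (k, j)) h2
          rw [Function.update_idem, Function.update_eq_self] at h1
          exact h ⟨by rw [Starts, h1]; exact h2.1, by rw [h1]; exact h2.2⟩
        simp only [h, h', if_false])
  calc _ = ∫⁻ v, (if Starts F v e ∧ (sys F v e).served = j then
        φ (v (k, j)) (sys F v e).work else 0) ∂inputLaw L := by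
        refine lintegral_congr fun v => ?_
        by_cases h1 : (sys F v e).served = j <;> by_cases h2 : Starts F v e <;> simp [h1, h2]
    _ = _ := key
    _ = _ := by
        refine lintegral_congr fun v => ?_
        by_cases h1 : (sys F v e).served = j <;> by_cases h2 : Starts F v e <;> simp [h1, h2]

open Classical in
/-- The batch that arrives after state `e`, and the interarrival time that follows, are fresh. -/
lemma lintegral_arrive (hF : MeasurableSet F) (e : ℕ) {k : Fin 4} (hk : k = 0 ∨ k = 1)
    {φ : ℝ → ℝ≥0∞} (hφ : Measurable φ) :
    ∫⁻ v, (if Arrives F v e then φ (v (k, (sys F v e).arr)) else 0) ∂inputLaw L =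
    (∫⁻ z, φ z ∂L k) * ∫⁻ v, (if Arrives F v e then 1 else 0) ∂inputLaw L := by
  have hs := measurable_sys hF e
  have hsv : Measurable fun v => (sys F v e).arr := measurable_arr.comp hs
  have hS := measurableSet_Arrives hF e
  have hφ' : Measurable fun v : Inp => φ (v (k, (sys F v e).arr)) :=
    hφ.comp (measurable_coord_index k hsv)
  have hj : ∀ j, MeasurableSet {v : Inp | (sys F v e).arr = j} := fun j =>
    hsv (measurableSet_singleton j)
  rw [← lintegral_const_mul _ (Measurable.ite hS measurable_const measurable_const)]
  rw [lintegral_eq_tsum_index (fun v => (sys F v e).arr) _ (fun j => Measurable.ite (hj j)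
      (Measurable.ite hS hφ' measurable_const)
      measurable_const),
    lintegral_eq_tsum_index (fun v => (sys F v e).arr) _ (fun j => Measurable.ite (hj j)
      ((Measurable.ite hS measurable_const measurable_const).const_mul _) measurable_const)]
  refine tsum_congr fun j => ?_
  have hm : MeasurableSet {v : Inp | Arrives F v e ∧ (sys F v e).arr = j} := hS.inter (hj j)
  have key := lintegral_of_invariant (L := fun p : Fin 4 × ℕ => L p.1) (k, j)
    (f := fun v z => if Arrives F v e ∧ (sys F v e).arr = j then φ z else 0)
    (by
      refine Measurable.ite (measurable_fst hm) ?_ measurable_const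
      exact hφ.comp measurable_snd)
    (by
      intro v z w
      have aux : ∀ v z, Arrives F v e ∧ (sys F v e).arr = j →
          Arrives F (Function.update v (k, j) z) e ∧
          (sys F (Function.update v (k, j) z) e).arr = j := by
        rintro v z ⟨h1, h2⟩
        have := h1.sys_eq (v' := Function.update v (k, j) z) fun p hp =>
          (Function.update_of_ne (by rintro rfl; exact hp ⟨hk, h2.le⟩) _ _).symm
        exact ⟨this.2, by rw [this.1]; exact h2⟩
      have hiff : (Arrives F (Function.update v (k, j) z) e ∧
          (sys F (Function.update v (k, j) z) e).arr = j) ↔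
          (Arrives F v e ∧ (sys F v e).arr = j) := by
        refine ⟨fun h => ?_, aux v z⟩
        have h1 := aux _ (v (k, j)) h
        rwa [Function.update_idem, Function.update_eq_self] at h1
      simp only [hiff])
  calc _ = ∫⁻ v, (if Arrives F v e ∧ (sys F v e).arr = j then
        φ (v (k, j)) else 0) ∂inputLaw L := by
        refine lintegral_congr fun v => ?_
        by_cases h1 : (sys F v e).arr = j <;> by_cases h2 : Arrives F v e <;> simp [h1, h2]
    _ = _ := key
    _ = _ := by
        refine lintegral_congr fun v => ?_
        by_cases h1 : (sys F v e).arr = j <;> by_cases h2 : Arrives F v e <;> simp [h1, h2]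

end Law

end BatchQueue

/-! ### Few services start with little mass present, uniformly in the capacity -/

namespace BatchQueue

open scoped ENNReal

variable {F : Set ℝ} {v : Inp}

lemma measure_eq_tsum_inter {Ω κ : Type*} [MeasurableSpace Ω] {P : Measure Ω} [Countable κ]
    [MeasurableSpace κ] [MeasurableSingletonClass κ] {idx : Ω → κ} (hidx : Measurable idx)
    {E : Set Ω} (hE : MeasurableSet E) : P E = ∑' i, P (E ∩ {v | idx v = i}) := by
  rw [← measure_iUnion]
  · congr 1
    ext v
    simp
  · intro i j hij
    refine Set.disjoint_left.2 fun v hv hv' => hij ?_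
    exact hv.2.symm.trans hv'.2
  · exact fun i => hE.inter (hidx (measurableSet_singleton i))

/-- The indicator of a family of events of which at most `N` occur. -/
lemma tsum_indicator_le_of_injOn {p : ℕ → Prop} [DecidablePred p] {f : ℕ → ℕ} {j N : ℕ}
    (hf : ∀ e, p e → j ≤ f e ∧ f e < j + N) (hinj : ∀ e e', p e → p e' → e < e' → f e < f e') :
    ∑' e, (if p e then (1 : ℝ≥0∞) else 0) ≤ N := by
  rw [ENNReal.tsum_eq_iSup_sum]
  refine iSup_le fun s => ?_
  rw [Finset.sum_ite, Finset.sum_const_zero, add_zero, Finset.sum_const, nsmul_eq_mul, mul_one]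
  have : (s.filter p).card ≤ (Finset.Ico j (j + N)).card := by
    refine Finset.card_le_card_of_injOn f (fun e he => ?_) fun e he e' he' heq => ?_
    · have := hf e (Finset.mem_filter.1 he).2
      simpa using this
    · have h1 := (Finset.mem_filter.1 he).2
      have h2 := (Finset.mem_filter.1 he').2
      by_contra hne
      rcases lt_or_gt_of_ne hne with h | h
      · exact (hinj _ _ h1 h2 h).ne heq
      · exact (hinj _ _ h2 h1 h).ne heq.symm
  rw [Nat.card_Ico, Nat.add_sub_cancel_left] at this
  exact_mod_cast this

section Law

variable {L : Fin 4 → Measure ℝ} [∀ k, IsProbabilityMeasure (L k)]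

open Classical in
-- The unread inputs after a start fall into the favourable box with the same probability,
-- independently of the past. So the left side is the mean number of the starts in question that are
-- followed by the box. From the first of these on, fewer than `2 * K` services are completed as
-- long as the busy period lasts, and distinct starts have distinct numbers of completions; hence at
-- most `2 * K` starts are counted, and none outside the event on the right.
lemma tsum_low_mul_le (hL : PosLaw L) (hF : MeasurableSet F) {c C δ B : ℝ} {K : ℕ} (hδ : 0 < δ)
    (hC : 0 ≤ C) (hB : 0 ≤ B) (hK : c + B ≤ K * δ) {Q : Sys → Prop}
    (hQ : MeasurableSet {s | Q s}) :
    (∑' e, inputLaw L {v | Starts F v e ∧ (sys F v e).work ≤ c ∧ Q (sys F v e)}) *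
      (L 0 (Set.Ioi (2 * K * C)) * L 1 (Set.Iic B) *
        (L 2 (Set.Iic C) ^ (2 * K) * L 3 (Set.Ici δ) ^ (2 * K))) ≤
      (2 * K : ℕ) * inputLaw L {v | ∃ e, Starts F v e ∧ Q (sys F v e)} := by
  set p := L 0 (Set.Ioi (2 * K * C)) * L 1 (Set.Iic B) *
        (L 2 (Set.Iic C) ^ (2 * K) * L 3 (Set.Ici δ) ^ (2 * K)) with hp
  let S : ℕ × ℕ → Finset (Fin 4 × ℕ) := fun q =>
    (({0} : Finset (Fin 4)) ×ˢ ({q.1} : Finset ℕ) ∪ ({1} : Finset (Fin 4)) ×ˢ ({q.1} : Finset ℕ)) ∪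
      ({2, 3} : Finset (Fin 4)) ×ˢ Finset.Ico q.2 (q.2 + 2 * K)
  let T : Fin 4 × ℕ → Set ℝ := fun r =>
    ![Set.Ioi (2 * K * C), Set.Iic B, Set.Iic C, Set.Ici δ] r.1
  have hT : ∀ r, MeasurableSet (T r) := by
    rintro ⟨r, k⟩
    fin_cases r
    · exact measurableSet_Ioi
    · exact measurableSet_Iic
    · exact measurableSet_Iic
    · exact measurableSet_Ici
  have hprod : ∀ q, ∏ r ∈ S q, L r.1 (T r) = p := by
    intro q
    rw [Finset.prod_union, Finset.prod_union]
    · simp only [Finset.prod_product, Finset.prod_singleton]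
      rw [Finset.prod_pair (by decide)]
      simp [T, hp]
    · simp
    · simp only [Finset.disjoint_left, Finset.mem_union, Finset.mem_product, Finset.mem_singleton,
        Finset.mem_insert]
      rintro ⟨a, b⟩ (⟨h, -⟩ | ⟨h, -⟩) ⟨h', -⟩ <;> simp only at h h' <;> subst h <;>
        exact absurd h' (by decide)
  let idx : ℕ → Inp → ℕ × ℕ := fun e v => ((sys F v e).arr, (sys F v e).served)
  have hidx : ∀ e, Measurable (idx e) := fun e =>
    (measurable_arr.comp (measurable_sys hF e)).prodMk
      (measurable_served.comp (measurable_sys hF e))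
  let E : ℕ → Set Inp := fun e => {v | Starts F v e ∧ (sys F v e).work ≤ c ∧ Q (sys F v e)}
  have hE : ∀ e, MeasurableSet (E e) := fun e => (measurableSet_Starts hF e).inter
    (((measurable_work.comp (measurable_sys hF e)) measurableSet_Iic).inter
      (measurable_sys hF e hQ))
  let G : ℕ → Set Inp := fun e => {v | ∀ r ∈ S (idx e v), v r ∈ T r}
  have hbox : ∀ q, MeasurableSet {v : Inp | ∀ r ∈ S q, v r ∈ T r} := fun q => by
    have : {v : Inp | ∀ r ∈ S q, v r ∈ T r} = ⋂ r ∈ S q, (fun v : Inp => v r) ⁻¹' T r := by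
      ext; simp
    rw [this]
    exact Finset.measurableSet_biInter _ fun r _ => measurable_pi_apply r (hT r)
  have hG : ∀ e, MeasurableSet (G e) := fun e => by
    have : G e = ⋃ q, {v | idx e v = q} ∩ {v | ∀ r ∈ S q, v r ∈ T r} := by
      ext v; simp [G]
    rw [this]
    exact MeasurableSet.iUnion fun q => ((hidx e) (measurableSet_singleton q)).inter (hbox q)
  have hstep : ∀ e, inputLaw L (E e) * p = inputLaw L (E e ∩ G e) := by
    intro e
    rw [measure_eq_tsum_inter (hidx e) (hE e),
      measure_eq_tsum_inter (hidx e) ((hE e).inter (hG e)), ← ENNReal.tsum_mul_right]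
    refine tsum_congr fun q => ?_
    have h1 : E e ∩ G e ∩ {v | idx e v = q} =
        (E e ∩ {v | idx e v = q}) ∩ {v | ∀ r ∈ S q, v r ∈ T r} := by
      ext v
      simp only [Set.mem_inter_iff, Set.mem_ofPred_eq, G]
      constructor
      · rintro ⟨⟨h1, h2⟩, h3⟩; exact ⟨⟨h1, h3⟩, h3 ▸ h2⟩
      · rintro ⟨⟨h1, h3⟩, h2⟩; exact ⟨⟨h1, h3 ▸ h2⟩, h3⟩
    rw [h1, ← hprod q]
    refine (infinitePi_inter_box (L := fun r : Fin 4 × ℕ => L r.1) (S q)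
      ((hE e).inter ((hidx e) (measurableSet_singleton q))) hT ?_).symm
    have aux : ∀ v v' : Inp, (∀ r ∉ S q, v r = v' r) → v ∈ E e ∩ {v | idx e v = q} →
        v' ∈ E e ∩ {v | idx e v = q} := by
      rintro v v' hag ⟨⟨h1, h2, h3⟩, h4⟩
      have heq := h1.sys_eq (v' := v') fun r hr => hag r fun hrS => hr (by
        have h5 : (sys F v e).arr = q.1 := congrArg Prod.fst h4
        have h6 : (sys F v e).served = q.2 := congrArg Prod.snd h4
        rw [h5, h6]
        simp only [S, Finset.mem_union, Finset.mem_product, Finset.mem_singleton, Finset.mem_insert,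
          Finset.mem_Ico] at hrS
        rcases hrS with (⟨h, h'⟩ | ⟨h, h'⟩) | ⟨h, h', -⟩
        · exact Or.inl ⟨Or.inl h, h'.ge⟩
        · exact Or.inl ⟨Or.inr h, h'.ge⟩
        · exact Or.inr ⟨h, h'⟩)
      refine ⟨⟨by rw [Starts, heq]; exact h1, by rw [heq]; exact h2, by rw [heq]; exact h3⟩, ?_⟩
      change ((sys F v' e).arr, (sys F v' e).served) = q
      rw [heq]; exact h4
    exact fun v v' hag => ⟨aux v v' hag, aux v' v fun r hr => (hag r hr).symm⟩
  rw [← ENNReal.tsum_mul_right]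
  simp only [E] at hstep
  simp_rw [hstep]
  have hmeas : ∀ e, MeasurableSet (E e ∩ G e) := fun e => (hE e).inter (hG e)
  have hU : MeasurableSet {v | ∃ e, Starts F v e ∧ Q (sys F v e)} := by
    have : {v | ∃ e, Starts F v e ∧ Q (sys F v e)} =
        ⋃ e, {v | Starts F v e} ∩ {v | Q (sys F v e)} := by ext; simp
    rw [this]
    exact MeasurableSet.iUnion fun e => (measurableSet_Starts hF e).inter (measurable_sys hF e hQ)
  calc ∑' e, inputLaw L (E e ∩ G e)
      = ∫⁻ v, ∑' e, (if v ∈ E e ∩ G e then 1 else 0) ∂inputLaw L := by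
        have hm : ∀ e, Measurable fun v => if v ∈ E e ∩ G e then (1 : ℝ≥0∞) else 0 := fun e =>
          Measurable.ite (hmeas e) measurable_const measurable_const
        rw [lintegral_tsum fun e => (hm e).aemeasurable]
        refine tsum_congr fun e => ?_
        rw [← lintegral_indicator_one (hmeas e)]
        refine lintegral_congr fun v => ?_
        simp [Set.indicator]
    _ ≤ ∫⁻ v, (2 * K : ℕ) * {v | ∃ e, Starts F v e ∧ Q (sys F v e)}.indicator 1 v ∂inputLaw L := by
        refine lintegral_mono_ae ?_
        filter_upwards [hL.ae_good] with v hv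
        by_cases hex : ∃ e, v ∈ E e ∩ G e
        · have he := Nat.find_spec hex
          set e := Nat.find hex
          have hin : v ∈ {v | ∃ e, Starts F v e ∧ Q (sys F v e)} := ⟨e, he.1.1, he.1.2.2⟩
          rw [Set.indicator_of_mem hin, Pi.one_apply, mul_one]
          have hmin : ∀ e', v ∈ E e' ∩ G e' → e ≤ e' := fun e' h => Nat.find_min' hex h
          have hGe : ∀ r ∈ S (idx e v), v r ∈ T r := he.2
          refine tsum_indicator_le_of_injOn (f := fun e' => (sys F v e').served)
            (j := (sys F v e).served) (fun e' he' => ?_) fun e' e'' h1 h2 h3 =>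
              h1.1.1.served_lt h2.1.1 h3
          refine ⟨served_mono F v (hmin e' he'), ?_⟩
          refine hv.served_lt_of_box he.1.1 he.1.2.1 hδ hC hB hK ?_ ?_ ?_ ?_ (hmin e' he')
            he'.1.1.1
          · simpa [T] using hGe (0, (sys F v e).arr) (by simp [S, idx])
          · simpa [T] using hGe (1, (sys F v e).arr) (by simp [S, idx])
          · intro k h1 h2
            simpa [T] using hGe (2, k) (by simp [S, idx, h1, h2])
          · intro k h1 h2
            simpa [T] using hGe (3, k) (by simp [S, idx, h1, h2])
        · push Not at hex
          simp [hex]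
    _ = _ := by rw [lintegral_const_mul _ (measurable_one.indicator hU), lintegral_indicator_one hU]

lemma exists_Iic_ne_zero (ν : Measure ℝ) [IsProbabilityMeasure ν] :
    ∃ B : ℝ, 0 ≤ B ∧ ν (Set.Iic B) ≠ 0 := by
  by_contra! h
  have h1 : ν (⋃ n : ℕ, Set.Iic (n : ℝ)) = 0 :=
    measure_iUnion_null fun n => h n n.cast_nonneg
  have h2 : (⋃ n : ℕ, Set.Iic (n : ℝ)) = Set.univ :=
    Set.eq_univ_of_forall fun x => Set.mem_iUnion.2 (exists_nat_ge x)
  rw [h2, measure_univ] at h1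
  exact one_ne_zero h1

lemma exists_Ici_ne_zero {ν : Measure ℝ} [IsProbabilityMeasure ν] (h : ∀ᵐ z ∂ν, 0 < z) :
    ∃ δ : ℝ, 0 < δ ∧ ν (Set.Ici δ) ≠ 0 := by
  by_contra! h0
  have h1 : ν (⋃ n : ℕ, Set.Ici (1 / ((n : ℝ) + 1))) = 0 :=
    measure_iUnion_null fun n => h0 _ (by positivity)
  have h2 : Set.Ioi (0 : ℝ) ⊆ ⋃ n : ℕ, Set.Ici (1 / ((n : ℝ) + 1)) := fun x hx => by
    obtain ⟨n, hn⟩ := exists_nat_one_div_lt (show 0 < x from hx)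
    exact Set.mem_iUnion.2 ⟨n, hn.le⟩
  have h3 : ν (Set.Ioi (0 : ℝ)) = 1 := (prob_compl_eq_zero_iff measurableSet_Ioi).1 h
  exact one_ne_zero (h3.symm.trans (measure_mono_null h2 h1))

/-- The expected number of services that start with at most the mass `c` present is bounded,
uniformly in the capacity, also after the first visit to a set `Q` of states. -/
lemma exists_low_bound (hL : PosLaw L) (hτ : ∀ t, L 0 (Set.Ioi t) ≠ 0) (c : ℝ) :
    ∃ A : ℝ≥0∞, A ≠ ⊤ ∧ ∀ F : Set ℝ, MeasurableSet F → ∀ Q : Sys → Prop, MeasurableSet {s | Q s} →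
      ∑' e, inputLaw L {v | Starts F v e ∧ (sys F v e).work ≤ c ∧ Q (sys F v e)} ≤
        A * inputLaw L {v | ∃ e, Starts F v e ∧ Q (sys F v e)} := by
  obtain ⟨B, hB, hB'⟩ := exists_Iic_ne_zero (L 1)
  obtain ⟨C, hC, hC'⟩ := exists_Iic_ne_zero (L 2)
  obtain ⟨δ, hδ, hδ'⟩ := exists_Ici_ne_zero hL.Y_pos
  obtain ⟨K, hK⟩ := exists_nat_ge ((c + B) / δ)
  rw [div_le_iff₀ hδ] at hK
  set p := L 0 (Set.Ioi (2 * K * C)) * L 1 (Set.Iic B) *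
        (L 2 (Set.Iic C) ^ (2 * K) * L 3 (Set.Ici δ) ^ (2 * K)) with hp
  have hp0 : p ≠ 0 := by
    simp only [hp, ne_eq, mul_eq_zero, not_or]
    exact ⟨⟨hτ _, hB'⟩, pow_ne_zero _ hC', pow_ne_zero _ hδ'⟩
  have hpt : p ≠ ⊤ := by
    refine ENNReal.mul_ne_top (ENNReal.mul_ne_top ?_ ?_) (ENNReal.mul_ne_top ?_ ?_)
    · exact measure_ne_top _ _
    · exact measure_ne_top _ _
    · exact ENNReal.pow_ne_top (measure_ne_top _ _)
    · exact ENNReal.pow_ne_top (measure_ne_top _ _)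
  refine ⟨(2 * K : ℕ) / p, ENNReal.div_ne_top (ENNReal.natCast_ne_top _) hp0, fun F hF Q hQ => ?_⟩
  have := tsum_low_mul_le (L := L) hL hF hδ hC hB hK hQ
  rw [ENNReal.mul_comm_div, ← mul_div_assoc]
  exact (ENNReal.le_div_iff_mul_le (Or.inl hp0) (Or.inl hpt)).2 this

end Law

end BatchQueue

/-! ### Sums over a busy period and their mean balances -/

namespace BatchQueue

open scoped ENNReal

variable {F : Set ℝ} {v : Inp}

open Classical in
/-- The sum of a functional over the states in which a service starts. -/
noncomputable def startSum (F : Set ℝ) (φ : Inp → Sys → ℝ≥0∞) (v : Inp) : ℝ≥0∞ :=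
  ∑' e, if Starts F v e then φ v (sys F v e) else 0

open Classical in
/-- The sum of a functional over the states that are followed by an arrival. -/
noncomputable def arrSum (F : Set ℝ) (φ : Inp → Sys → ℝ≥0∞) (v : Inp) : ℝ≥0∞ :=
  ∑' e, if Arrives F v e then φ v (sys F v e) else 0

open Classical in
/-- The time between the end of the busy period and the next arrival. -/
noncomputable def residual (F : Set ℝ) (v : Inp) : ℝ≥0∞ :=
  ∑' e, if Ends F v e then
    ENNReal.ofReal (arrTime v (sys F v e).arr - srvTime v ((sys F v e).served + 1)) else 0

lemma measurable_startSum (hF : MeasurableSet F) {φ : Inp → Sys → ℝ≥0∞}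
    (hφ : ∀ e, Measurable fun v => φ v (sys F v e)) : Measurable (startSum F φ) := by
  classical
  exact Measurable.tsum fun e =>
    Measurable.ite (measurableSet_Starts hF e) (hφ e) measurable_const

lemma measurable_arrSum (hF : MeasurableSet F) {φ : Inp → Sys → ℝ≥0∞}
    (hφ : ∀ e, Measurable fun v => φ v (sys F v e)) : Measurable (arrSum F φ) := by
  classical
  exact Measurable.tsum fun e =>
    Measurable.ite (measurableSet_Arrives hF e) (hφ e) measurable_const

lemma measurable_served_coord (hF : MeasurableSet F) (k : Fin 4) (e : ℕ) :
    Measurable fun v : Inp => v (k, (sys F v e).served) :=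
  measurable_coord_index k (measurable_served.comp (measurable_sys hF e))

lemma measurable_arr_coord (hF : MeasurableSet F) (k : Fin 4) (e : ℕ) :
    Measurable fun v : Inp => v (k, (sys F v e).arr) :=
  measurable_coord_index k (measurable_arr.comp (measurable_sys hF e))

lemma measurable_sys_work (hF : MeasurableSet F) (e : ℕ) :
    Measurable fun v : Inp => (sys F v e).work :=
  measurable_work.comp (measurable_sys hF e)

lemma startSum_mono {φ ψ : Inp → Sys → ℝ≥0∞} (h : ∀ s, φ v s ≤ ψ v s) :
    startSum F φ v ≤ startSum F ψ v := by
  refine ENNReal.tsum_le_tsum fun e => ?_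
  split_ifs
  exacts [h _, le_rfl]

lemma startSum_add (F : Set ℝ) (φ ψ : Inp → Sys → ℝ≥0∞) (v : Inp) :
    startSum F (fun v s => φ v s + ψ v s) v = startSum F φ v + startSum F ψ v := by
  rw [startSum, startSum, startSum, ← ENNReal.tsum_add]
  refine tsum_congr fun e => ?_
  split_ifs <;> simp

lemma startSum_const_mul (F : Set ℝ) (a : ℝ≥0∞) (φ : Inp → Sys → ℝ≥0∞) (v : Inp) :
    startSum F (fun v s => a * φ v s) v = a * startSum F φ v := by
  rw [startSum, startSum, ← ENNReal.tsum_mul_left]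
  refine tsum_congr fun e => ?_
  split_ifs <;> simp

/-- The number of services of a busy period. -/
noncomputable abbrev numServices (F : Set ℝ) : Inp → ℝ≥0∞ := startSum F fun _ _ => 1

/-- The number of arrivals of a busy period after the first one. -/
noncomputable abbrev numArrivals (F : Set ℝ) : Inp → ℝ≥0∞ := arrSum F fun _ _ => 1

section Pathwise

open Classical in
lemma startSum_of_empty {H : ℕ} (hH : (sys F v H).content = 0) (φ : Inp → Sys → ℝ≥0∞) :
    startSum F φ v = ∑ e ∈ Finset.range (H + 1), if Starts F v e then φ v (sys F v e) else 0 :=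
  tsum_eq_sum fun e he => if_neg fun h => h.1 (by
    rw [sys_of_empty hH (by simp at he; omega)]; exact hH)

open Classical in
lemma arrSum_of_empty {H : ℕ} (hH : (sys F v H).content = 0) (φ : Inp → Sys → ℝ≥0∞) :
    arrSum F φ v = ∑ e ∈ Finset.range H, if Arrives F v e then φ v (sys F v e) else 0 :=
  tsum_eq_sum fun e he => if_neg fun h => h.1 (by
    rw [sys_of_empty hH (by simpa using he)]; exact hH)

lemma add_arrSum_of_empty {H : ℕ} (hH : (sys F v H).content = 0) (g : ℕ → ℝ≥0∞) :
    g 0 + arrSum F (fun _ s => g s.arr) v = ∑ i ∈ Finset.range (sys F v H).arr, g i := by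
  rw [arrSum_of_empty hH, sum_range_arr]

lemma Good.startSum_served_of_empty (hv : Good v) {H : ℕ} (hH : (sys F v H).content = 0)
    (g : ℕ → ℝ≥0∞) :
    startSum F (fun _ s => g s.served) v = ∑ i ∈ Finset.range (sys F v H).served, g i := by
  have h := hv.sum_range_started F g H
  rw [Sys.started, if_pos hH] at h
  rw [startSum_of_empty hH, h]

lemma ofReal_sum {g : ℕ → ℝ} (hg : ∀ i, 0 ≤ g i) (n : ℕ) :
    ENNReal.ofReal (∑ i ∈ Finset.range n, g i) = ∑ i ∈ Finset.range n, ENNReal.ofReal (g i) :=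
  ENNReal.ofReal_sum_of_nonneg fun i _ => hg i

/-- Truncated interarrival times add up to at most the length of the busy period plus the
truncation level. -/
lemma Good.arrSum_min_le (hv : Good v) (F : Set ℝ) {c : ℝ} (hc : 0 ≤ c) :
    ENNReal.ofReal (min (v (0, 0)) c) +
        arrSum F (fun v s => ENNReal.ofReal (min (v (0, s.arr)) c)) v ≤
      startSum F (fun v s => ENNReal.ofReal (v (2, s.served))) v + ENNReal.ofReal c := by
  classical
  rw [arrSum, ENNReal.tsum_eq_iSup_nat, ENNReal.add_iSup]
  refine iSup_le fun H => ?_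
  rw [← sum_range_arr F v (fun i => ENNReal.ofReal (min (v (0, i)) c)) H,
    ← ofReal_sum fun i => le_min (hv.τ_pos i).le hc]
  refine (ENNReal.ofReal_le_ofReal (hv.sum_min_le F H)).trans ?_
  rw [ENNReal.ofReal_add (Finset.sum_nonneg fun i _ => hv.χ_nonneg i) hc,
    ofReal_sum fun i => hv.χ_nonneg i,
    hv.sum_range_started F (fun i => ENNReal.ofReal (v (2, i))) H]
  gcongr
  exact ENNReal.sum_le_tsum _

/-- A busy period with finitely many arrivals and services ends. -/
lemma Good.exists_empty (hv : Good v) (h1 : numServices F v ≠ ⊤) (h2 : numArrivals F v ≠ ⊤) :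
    ∃ H, (sys F v H).content = 0 := by
  classical
  by_contra! hb
  have hS : ∀ H, (((sys F v H).served + 1 : ℕ) : ℝ≥0∞) ≤ numServices F v := by
    intro H
    have h := hv.sum_range_started F (fun _ => (1 : ℝ≥0∞)) H
    rw [Sys.started, if_neg (hb H), Finset.sum_const, Finset.card_range, nsmul_eq_mul,
      mul_one] at h
    rw [h]
    exact ENNReal.sum_le_tsum _
  have hA : ∀ H, ((sys F v H).arr : ℝ≥0∞) ≤ 1 + numArrivals F v := by
    intro H
    have h := sum_range_arr F v (fun _ => (1 : ℝ≥0∞)) H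
    rw [Finset.sum_const, Finset.card_range, nsmul_eq_mul, mul_one] at h
    rw [h]
    gcongr
    exact ENNReal.sum_le_tsum _
  have hne : numServices F v + (1 + numArrivals F v) ≠ ⊤ := by simp [h1, h2]
  obtain ⟨m, hm⟩ := ENNReal.exists_nat_gt hne
  have h3 := add_le_add (hS m) (hA m)
  have h4 : ((m : ℕ) : ℝ≥0∞) ≤ (((sys F v m).served + 1 : ℕ) : ℝ≥0∞) + ((sys F v m).arr : ℕ) := by
    exact_mod_cast (by have := arr_add_served hb m; omega :
      m ≤ (sys F v m).served + 1 + (sys F v m).arr)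
  exact absurd (h4.trans h3) (not_le.2 hm)

/-- Mass balance for a whole busy period. -/
lemma Good.lost_add_served (hv : Good v) {H : ℕ} (hH : (sys F v H).content = 0) :
    (⨆ e, ENNReal.ofReal (sys F v e).lost) +
      startSum F (fun v s => ENNReal.ofReal (min (v (3, s.served)) s.work)) v =
    ENNReal.ofReal (v (1, 0)) + arrSum F (fun v s => ENNReal.ofReal (v (1, s.arr))) v := by
  classical
  have h1 : (⨆ e, ENNReal.ofReal (sys F v e).lost) = ENNReal.ofReal (sys F v H).lost := by
    refine le_antisymm (iSup_le fun e => ENNReal.ofReal_le_ofReal ?_)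
      (le_iSup (fun e => ENNReal.ofReal (sys F v e).lost) H)
    rcases le_total e H with h | h
    · exact hv.lost_mono F h
    · rw [sys_of_empty hH h]
  have hmb := hv.mass_balance F H
  have hw : (sys F v H).work = 0 := le_antisymm (hH ▸ (hv.sys_inv F H).2.1) (hv.sys_inv F H).1
  rw [hH, hw, min_eq_right (hv.Y_pos _).le, sub_zero, add_zero] at hmb
  have hnn : ∀ e, 0 ≤ (if Starts F v e then min (v (3, (sys F v e).served)) (sys F v e).work
      else 0) := fun e => by
    split_ifs
    exacts [le_min (hv.Y_pos _).le (hv.sys_inv F e).1, le_rfl]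
  have h2 := congrArg ENNReal.ofReal hmb
  rw [ENNReal.ofReal_add (hv.sys_inv F H).2.2.2.1 (Finset.sum_nonneg fun e _ => hnn e),
    ofReal_sum hnn, ofReal_sum fun i => (hv.X_pos i).le,
    ← add_arrSum_of_empty hH fun i => ENNReal.ofReal (v (1, i))] at h2
  rw [h1, startSum_of_empty hH]
  refine Eq.trans ?_ h2
  congr 1
  refine Finset.sum_congr rfl fun e _ => ?_
  split_ifs <;> simp

lemma residual_of_ends {e : ℕ} (he : Ends F v e) : residual F v =
    ENNReal.ofReal (arrTime v (sys F v e).arr - srvTime v ((sys F v e).served + 1)) := by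
  classical
  rw [residual, tsum_eq_single e fun e' h => if_neg fun h' => h (h'.unique he), if_pos he]

/-- The time of the first arrival after a busy period. -/
lemma Good.time_balance (hv : Good v) {H : ℕ} (hH : (sys F v H).content = 0) :
    ENNReal.ofReal (v (0, 0)) + arrSum F (fun v s => ENNReal.ofReal (v (0, s.arr))) v =
    startSum F (fun v s => ENNReal.ofReal (v (2, s.served))) v + residual F v +
      {v : Inp | (sys F v 0).content = 0}.indicator (fun v => ENNReal.ofReal (v (0, 0))) v := by
  classical
  by_cases h0 : (sys F v 0).content = 0
  · have h1 : ∀ e, (sys F v e).content = 0 := fun e => by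
      rw [sys_of_empty h0 (Nat.zero_le e)]; exact h0
    have h2 : arrSum F (fun v s => ENNReal.ofReal (v (0, s.arr))) v = 0 := by
      simp [arrSum, Arrives, h1]
    have h3 : startSum F (fun v s => ENNReal.ofReal (v (2, s.served))) v = 0 := by
      simp [startSum, Starts, h1]
    have h4 : residual F v = 0 := by
      simp [residual, Ends, h1]
    rw [h2, h3, h4, Set.indicator_of_mem (show v ∈ {v : Inp | (sys F v 0).content = 0} from h0)]
    simp
  · obtain ⟨e, he⟩ := exists_Ends h0 hH
    have hE := hv.Ends_cases he
    have hz : (sys F v (e + 1)).content = 0 := he.2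
    have e1 : startSum F (fun v s => ENNReal.ofReal (v (2, s.served))) v = _ :=
      hv.startSum_served_of_empty hz fun i => ENNReal.ofReal (v (2, i))
    have e2 : ENNReal.ofReal (v (0, 0)) + arrSum F (fun v s => ENNReal.ofReal (v (0, s.arr))) v =
      _ := add_arrSum_of_empty hz fun i => ENNReal.ofReal (v (0, i))
    rw [Set.indicator_of_notMem (show v ∉ {v : Inp | (sys F v 0).content = 0} from h0), add_zero,
      residual_of_ends he, e1, e2, ← ofReal_sum fun i => hv.χ_nonneg i,
      ← ofReal_sum fun i => (hv.τ_pos i).le, hE.2]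
    dsimp only
    change ENNReal.ofReal (arrTime v _) = ENNReal.ofReal (srvTime v _) + _
    rw [← ENNReal.ofReal_add (hv.srvTime_nonneg _) (sub_nonneg.2 hE.1.le), add_sub_cancel]

end Pathwise

lemma lintegral_numServices {L : Fin 4 → Measure ℝ} (hF : MeasurableSet F) :
    ∫⁻ v, numServices F v ∂inputLaw L = ∑' e, inputLaw L {v | Starts F v e} := by
  classical
  unfold numServices startSum
  rw [lintegral_tsum fun e =>
    (Measurable.ite (measurableSet_Starts hF e) measurable_const measurable_const).aemeasurable]
  refine tsum_congr fun e => ?_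
  rw [← lintegral_indicator_one (measurableSet_Starts hF e)]
  refine lintegral_congr fun v => ?_
  simp [Set.indicator]

section Law

variable {L : Fin 4 → Measure ℝ} [∀ k, IsProbabilityMeasure (L k)]

/-- Wald's identity, with a summand that may also depend on the mass at the service start, which is
known before the parameters of the service are read. -/
lemma lintegral_startSum (hF : MeasurableSet F) {k : Fin 4} (hk : k = 2 ∨ k = 3)
    {φ : ℝ → ℝ → ℝ≥0∞} (hφ : Measurable (Function.uncurry φ)) :
    ∫⁻ v, startSum F (fun v s => φ (v (k, s.served)) s.work) v ∂inputLaw L =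
      ∫⁻ v, startSum F (fun _ s => ∫⁻ z, φ z s.work ∂L k) v ∂inputLaw L := by
  classical
  have hΦ : Measurable fun m => ∫⁻ z, φ z m ∂L k :=
    Measurable.lintegral_prod_left' (f := fun x : ℝ × ℝ => φ x.1 x.2) hφ
  have h1 : ∀ e, Measurable fun v : Inp => if Starts F v e then
      φ (v (k, (sys F v e).served)) (sys F v e).work else 0 := fun e =>
    Measurable.ite (measurableSet_Starts hF e)
      (hφ.comp ((measurable_served_coord hF k e).prodMk (measurable_sys_work hF e)))
      measurable_const
  have h2 : ∀ e, Measurable fun v : Inp => if Starts F v e then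
      ∫⁻ z, φ z (sys F v e).work ∂L k else 0 := fun e =>
    Measurable.ite (measurableSet_Starts hF e) (hΦ.comp (measurable_sys_work hF e))
      measurable_const
  unfold startSum
  rw [lintegral_tsum fun e => (h1 e).aemeasurable, lintegral_tsum fun e => (h2 e).aemeasurable]
  exact tsum_congr fun e => lintegral_start hF e hk hφ

lemma lintegral_startSum_const (hF : MeasurableSet F) {k : Fin 4} (hk : k = 2 ∨ k = 3)
    {φ : ℝ → ℝ≥0∞} (hφ : Measurable φ) :
    ∫⁻ v, startSum F (fun v s => φ (v (k, s.served))) v ∂inputLaw L =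
      (∫⁻ z, φ z ∂L k) * ∫⁻ v, numServices F v ∂inputLaw L := by
  rw [lintegral_startSum hF hk (φ := fun z _ => φ z) (hφ.comp measurable_fst),
    ← lintegral_const_mul _ (measurable_startSum hF fun e => measurable_const)]
  refine lintegral_congr fun v => ?_
  rw [← startSum_const_mul]
  simp

/-- Wald's identity for arrivals: that a further batch arrives within the busy period is decided
without its mass and without the interarrival time after it. -/
lemma lintegral_arrSum (hF : MeasurableSet F) {k : Fin 4} (hk : k = 0 ∨ k = 1)
    {φ : ℝ → ℝ≥0∞} (hφ : Measurable φ) :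
    ∫⁻ v, (φ (v (k, 0)) + arrSum F (fun v s => φ (v (k, s.arr))) v) ∂inputLaw L =
      (∫⁻ z, φ z ∂L k) * (1 + ∫⁻ v, numArrivals F v ∂inputLaw L) := by
  classical
  have h1 : ∀ e, Measurable fun v : Inp => if Arrives F v e then
      φ (v (k, (sys F v e).arr)) else 0 := fun e =>
    Measurable.ite (measurableSet_Arrives hF e) (hφ.comp (measurable_arr_coord hF k e))
      measurable_const
  have h2 : ∀ e, Measurable fun v : Inp => if Arrives F v e then (1 : ℝ≥0∞) else 0 := fun e =>
    Measurable.ite (measurableSet_Arrives hF e) measurable_const measurable_const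
  have h3 : Measurable fun v : Inp => φ (v (k, 0)) := hφ.comp (measurable_pi_apply _)
  rw [lintegral_add_left h3, lintegral_coord k 0 hφ, mul_add,
    mul_one]
  congr 1
  unfold numArrivals arrSum
  rw [lintegral_tsum fun e => (h1 e).aemeasurable, lintegral_tsum fun e => (h2 e).aemeasurable,
    ← ENNReal.tsum_mul_left]
  exact tsum_congr fun e => lintegral_arrive hF e hk hφ

/-- In a system of finite capacity the mean number of services of a busy period is finite. -/
lemma lintegral_numServices_ne_top (hL : PosLaw L) (hτ : ∀ t, L 0 (Set.Ioi t) ≠ 0) {n : ℝ}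
    (hn : 0 ≤ n) : ∫⁻ v, numServices (Set.Iic n) v ∂inputLaw L ≠ ⊤ := by
  obtain ⟨A, hA, h⟩ := exists_low_bound hL hτ n
  specialize h (Set.Iic n) measurableSet_Iic (fun _ => True) MeasurableSet.univ
  rw [lintegral_numServices measurableSet_Iic]
  refine ne_top_of_le_ne_top (ENNReal.mul_ne_top hA (measure_ne_top _ _)) (le_trans ?_ h)
  refine ENNReal.tsum_le_tsum fun e => measure_mono_ae ?_
  filter_upwards [hL.ae_good] with v hv hs
  exact ⟨hs, hv.work_le hn e, trivial⟩

/-- The mean of the truncated law. -/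
noncomputable def truncMean (ν : Measure ℝ) (c : ℝ) : ℝ≥0∞ := ∫⁻ z, ENNReal.ofReal (min z c) ∂ν

/-- The mean. -/
noncomputable def mean (ν : Measure ℝ) : ℝ≥0∞ := ∫⁻ z, ENNReal.ofReal z ∂ν

/-- Truncation avoids the residual time, so the bound does not presuppose that the busy period ends.
It is used to prove just that, by bounding the mean number of arrivals. -/
lemma truncMean_mul_le (hL : PosLaw L) (hF : MeasurableSet F) {c : ℝ} (hc : 0 ≤ c) :
    truncMean (L 0) c * (1 + ∫⁻ v, numArrivals F v ∂inputLaw L) ≤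
      mean (L 2) * ∫⁻ v, numServices F v ∂inputLaw L + ENNReal.ofReal c := by
  have hm : Measurable fun z : ℝ => ENNReal.ofReal (min z c) := by fun_prop
  rw [truncMean, ← lintegral_arrSum hF (Or.inl rfl) hm, mean,
    ← lintegral_startSum_const hF (Or.inl rfl) ENNReal.measurable_ofReal]
  calc _ ≤ ∫⁻ v, (startSum F (fun v s => ENNReal.ofReal (v (2, s.served))) v + ENNReal.ofReal c)
        ∂inputLaw L := by
        refine lintegral_mono_ae ?_
        filter_upwards [hL.ae_good] with v hv using hv.arrSum_min_le F hc
    _ = _ := by rw [lintegral_add_right _ measurable_const]; simp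

lemma truncMean_pos {ν : Measure ℝ} [IsProbabilityMeasure ν] (h : ∀ᵐ z ∂ν, 0 < z) {c : ℝ}
    (hc : 0 < c) : truncMean ν c ≠ 0 := by
  intro h0
  rw [truncMean, lintegral_eq_zero_iff (by fun_prop)] at h0
  have : ∀ᵐ z ∂ν, False := by
    filter_upwards [h, h0] with z hz hz0
    simp only [Pi.zero_apply, ENNReal.ofReal_eq_zero] at hz0
    exact absurd (lt_min hz hc) (not_lt.2 hz0)
  exact this.exists.elim fun _ h => h

lemma lintegral_numArrivals_ne_top (hL : PosLaw L) (hb : mean (L 2) ≠ ⊤) (hF : MeasurableSet F)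
    (hS : ∫⁻ v, numServices F v ∂inputLaw L ≠ ⊤) :
    ∫⁻ v, numArrivals F v ∂inputLaw L ≠ ⊤ := by
  intro htop
  have h := truncMean_mul_le hL hF zero_le_one
  rw [htop, add_top, ENNReal.mul_top (truncMean_pos hL.τ_pos one_pos), top_le_iff] at h
  exact ENNReal.add_ne_top.2 ⟨ENNReal.mul_ne_top hb hS, ENNReal.ofReal_ne_top⟩ h

lemma ae_exists_empty (hL : PosLaw L) (hb : mean (L 2) ≠ ⊤) (hF : MeasurableSet F)
    (hS : ∫⁻ v, numServices F v ∂inputLaw L ≠ ⊤) :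
    ∀ᵐ v ∂inputLaw L, ∃ H, (sys F v H).content = 0 := by
  filter_upwards [hL.ae_good,
    ae_lt_top (measurable_startSum hF fun _ => measurable_const) hS,
    ae_lt_top (measurable_arrSum hF fun _ => measurable_const)
      (lintegral_numArrivals_ne_top hL hb hF hS)] with v hv h1 h2
  exact hv.exists_empty h1.ne h2.ne

/-- The mass lost during the busy period. -/
noncomputable def lostTotal (F : Set ℝ) (v : Inp) : ℝ≥0∞ := ⨆ e, ENNReal.ofReal (sys F v e).lost

lemma measurable_lostTotal (hF : MeasurableSet F) : Measurable (lostTotal F) :=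
  Measurable.iSup fun e => ENNReal.measurable_ofReal.comp
    (measurable_lost.comp (measurable_sys hF e))

lemma measurable_truncMean (ν : Measure ℝ) [IsProbabilityMeasure ν] : Measurable (truncMean ν) :=
  Measurable.lintegral_prod_left' (f := fun x : ℝ × ℝ => ENNReal.ofReal (min x.1 x.2))
    (by fun_prop)

/-- Mean mass balance of a busy period. -/
lemma lintegral_lost_add (hL : PosLaw L) (hb : mean (L 2) ≠ ⊤) (hF : MeasurableSet F)
    (hS : ∫⁻ v, numServices F v ∂inputLaw L ≠ ⊤) :
    ∫⁻ v, lostTotal F v ∂inputLaw L +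
      ∫⁻ v, startSum F (fun _ s => truncMean (L 3) s.work) v ∂inputLaw L =
    mean (L 1) * (1 + ∫⁻ v, numArrivals F v ∂inputLaw L) := by
  rw [mean, ← lintegral_arrSum hF (Or.inr rfl) ENNReal.measurable_ofReal]
  unfold truncMean
  rw [← lintegral_startSum hF (Or.inr rfl) (φ := fun z w => ENNReal.ofReal (min z w))
    (by fun_prop), ← lintegral_add_left (measurable_lostTotal hF)]
  refine lintegral_congr_ae ?_
  filter_upwards [hL.ae_good, ae_exists_empty hL hb hF hS] with v hv ⟨H, hH⟩
  exact hv.lost_add_served hH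

lemma measurable_residual (hF : MeasurableSet F) : Measurable (residual F) := by
  classical
  refine Measurable.tsum fun e =>
    Measurable.ite (measurableSet_Ends hF e) (ENNReal.measurable_ofReal.comp ?_) measurable_const
  exact (measurable_arrTime (measurable_arr.comp (measurable_sys hF e))).sub
    (measurable_srvTime ((measurable_served.comp (measurable_sys hF e)).add_const 1))

lemma measurableSet_content_zero (hF : MeasurableSet F) :
    MeasurableSet {v : Inp | (sys F v 0).content = 0} :=
  (measurable_content.comp (measurable_sys hF 0)) (measurableSet_singleton 0)

/-- Mean time balance of a busy period. -/
lemma lintegral_time_balance (hL : PosLaw L) (hb : mean (L 2) ≠ ⊤) (hF : MeasurableSet F)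
    (hS : ∫⁻ v, numServices F v ∂inputLaw L ≠ ⊤) :
    mean (L 0) * (1 + ∫⁻ v, numArrivals F v ∂inputLaw L) =
      mean (L 2) * ∫⁻ v, numServices F v ∂inputLaw L + ∫⁻ v, residual F v ∂inputLaw L +
        mean (L 0) * inputLaw L {v | (sys F v 0).content = 0} := by
  have hE := measurableSet_content_zero hF
  -- Whether the starting batch is lost depends only on its mass, so the first interarrival time can
  -- be integrated out.
  have hlast : mean (L 0) * inputLaw L {v | (sys F v 0).content = 0} =
      ∫⁻ v, {v : Inp | (sys F v 0).content = 0}.indicator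
        (fun v => ENNReal.ofReal (v (0, 0))) v ∂inputLaw L := by
    have key := lintegral_of_invariant (L := fun p : Fin 4 × ℕ => L p.1) (0, 0)
      (f := fun v z => {v : Inp | (sys F v 0).content = 0}.indicator 1 v * ENNReal.ofReal z)
      (((measurable_one.indicator hE).comp measurable_fst).mul
        (ENNReal.measurable_ofReal.comp measurable_snd))
      (by
        intro v z w
        have : sys F (Function.update v (0, 0) z) 0 = sys F v 0 := by
          change start F _ = start F v
          unfold start
          rw [Function.update_of_ne (by simp : ((1, 0) : Fin 4 × ℕ) ≠ (0, 0))]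
        simp [Set.indicator, this])
    have e1 : ∀ v : Inp, {v : Inp | (sys F v 0).content = 0}.indicator
        (fun v => ENNReal.ofReal (v (0, 0))) v =
        {v : Inp | (sys F v 0).content = 0}.indicator 1 v * ENNReal.ofReal (v (0, 0)) := by
      intro v
      by_cases h : v ∈ {v : Inp | (sys F v 0).content = 0} <;> simp [h]
    simp_rw [e1]
    rw [key]
    simp_rw [lintegral_const_mul _ ENNReal.measurable_ofReal]
    rw [lintegral_mul_const _ (measurable_one.indicator hE), lintegral_indicator_one hE, mul_comm]
    rfl
  have hm : Measurable ({v : Inp | (sys F v 0).content = 0}.indicator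
      fun v => ENNReal.ofReal (v (0, 0))) :=
    (ENNReal.measurable_ofReal.comp (measurable_pi_apply _)).indicator hE
  rw [hlast, mean, ← lintegral_arrSum hF (Or.inl rfl) ENNReal.measurable_ofReal, mean,
    ← lintegral_startSum_const hF (Or.inl rfl) ENNReal.measurable_ofReal,
    ← lintegral_add_right _ (measurable_residual hF), ← lintegral_add_right _ hm]
  refine lintegral_congr_ae ?_
  filter_upwards [hL.ae_good, ae_exists_empty hL hb hF hS] with v hv ⟨H, hH⟩
  exact hv.time_balance hH

end Law

end BatchQueue

/-! ### The residual interarrival time at the end of a busy period -/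

namespace BatchQueue

open scoped ENNReal

variable {F : Set ℝ} {v : Inp}

/-- The mean excess over the level `x`. -/
noncomputable def excess (ν : Measure ℝ) (x : ℝ) : ℝ≥0∞ := ∫⁻ z, ENNReal.ofReal (z - x) ∂ν

/-- The busy period ends with the event after state `e`, when `k + 1` batches have arrived and `j`
services have been completed; here `t = (e, k, j)`. -/
def EndsAt (F : Set ℝ) (v : Inp) (t : ℕ × ℕ × ℕ) : Prop :=
  Ends F v t.1 ∧ (sys F v t.1).arr = t.2.1 + 1 ∧ (sys F v t.1).served = t.2.2

lemma measurableSet_EndsAt (hF : MeasurableSet F) (t : ℕ × ℕ × ℕ) :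
    MeasurableSet {v | EndsAt F v t} :=
  (measurableSet_Ends hF t.1).inter
    (((measurable_arr.comp (measurable_sys hF t.1)) (measurableSet_singleton _)).inter
      ((measurable_served.comp (measurable_sys hF t.1)) (measurableSet_singleton _)))

open Classical in
lemma tsum_EndsAt {e : ℕ} (he : Ends F v e) (f : ℕ × ℕ × ℕ → ℝ≥0∞) :
    ∑' t, (if EndsAt F v t then f t else 0) =
      f (e, (sys F v e).arr - 1, (sys F v e).served) := by
  rw [tsum_eq_single (e, (sys F v e).arr - 1, (sys F v e).served)]
  · refine if_pos ⟨he, ?_, rfl⟩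
    have := one_le_arr F v e
    dsimp only; omega
  · rintro ⟨e', k, j⟩ hne
    refine if_neg fun h => hne ?_
    obtain ⟨h1, h2, h3⟩ := h
    obtain rfl : e' = e := h1.unique he
    dsimp only at h2 h3
    rw [h2, h3, Nat.add_sub_cancel]

open Classical in
lemma tsum_EndsAt_of_not (h : ∀ e, ¬ Ends F v e) (f : ℕ × ℕ × ℕ → ℝ≥0∞) :
    ∑' t, (if EndsAt F v t then f t else 0) = 0 := by
  simp [EndsAt, h]

open Classical in
lemma residual_eq_tsum (F : Set ℝ) (v : Inp) : residual F v =
    ∑' t : ℕ × ℕ × ℕ, if EndsAt F v t then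
      ENNReal.ofReal (arrTime v (t.2.1 + 1) - srvTime v (t.2.2 + 1)) else 0 := by
  by_cases h : ∃ e, Ends F v e
  · obtain ⟨e, he⟩ := h
    rw [residual_of_ends he, tsum_EndsAt he
      fun t => ENNReal.ofReal (arrTime v (t.2.1 + 1) - srvTime v (t.2.2 + 1))]
    dsimp only
    rw [Nat.sub_add_cancel (one_le_arr F v e)]
  · push Not at h
    rw [tsum_EndsAt_of_not h]
    simp [residual, h]

lemma Good.update (hv : Good v) {k : ℕ} {z : ℝ} (hz : 0 < z) :
    Good (Function.update v (0, k) z) := by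
  refine ⟨fun i => ?_, fun i => ?_, fun i => ?_, fun i => ?_⟩
  · by_cases h : i = k
    · subst h; simpa using hz
    · rw [Function.update_of_ne (by simpa using h)]; exact hv.τ_pos i
  · rw [Function.update_of_ne (by simp)]; exact hv.X_pos i
  · rw [Function.update_of_ne (by simp)]; exact hv.χ_nonneg i
  · rw [Function.update_of_ne (by simp)]; exact hv.Y_pos i

lemma srvTime_update (v : Inp) (k : ℕ) (z : ℝ) (j : ℕ) :
    srvTime (Function.update v (0, k) z) j = srvTime v j :=
  srvTime_congr fun i _ => Function.update_of_ne (by simp) _ _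

lemma arrTime_update (v : Inp) (k : ℕ) (z : ℝ) :
    arrTime (Function.update v (0, k) z) (k + 1) = arrTime v k + z := by
  rw [arrTime_succ, Function.update_self]
  congr 1
  exact arrTime_congr fun i hi => Function.update_of_ne (by simpa using hi.ne) _ _

/-- The dependence of the end of the busy period on the interarrival time in which it falls. -/
lemma Good.EndsAt_update (hv : Good v) (F : Set ℝ) (t : ℕ × ℕ × ℕ) :
    (∀ z, 0 < z → ¬ EndsAt F (Function.update v (0, t.2.1) z) t) ∨
    (0 ≤ srvTime v (t.2.2 + 1) - arrTime v t.2.1 ∧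
      ∀ z, 0 < z → (EndsAt F (Function.update v (0, t.2.1) z) t ↔
        srvTime v (t.2.2 + 1) - arrTime v t.2.1 < z)) := by
  obtain ⟨e, k, j⟩ := t
  dsimp only
  by_cases h : ∃ z, 0 < z ∧ EndsAt F (Function.update v (0, k) z) (e, k, j)
  · right
    obtain ⟨z₀, hz₀, h1, h2, h3⟩ := h
    dsimp only at h1 h2 h3
    have hg := hv.update (k := k) hz₀
    -- The last arrival precedes the end of the current service. This makes the threshold
    -- nonnegative, as NWUE requires.
    have ht := (hg.time_inv F e).1
    rw [Sys.started, if_neg h1.1, h2, h3, Nat.add_sub_cancel, srvTime_update,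
      arrTime_congr (v' := v) fun i hi => Function.update_of_ne (by simpa using hi.ne) _ _] at ht
    refine ⟨sub_nonneg.2 ht, fun z hz => ⟨fun h => ?_, fun h => ?_⟩⟩
    · obtain ⟨h4, h5, h6⟩ := h
      dsimp only at h4 h5 h6
      have := ((hv.update (k := k) hz).Ends_cases h4).1
      rw [h5, h6, srvTime_update, arrTime_update] at this
      linarith
    · obtain ⟨h4, h5⟩ := hg.Ends_of_agree (v' := Function.update v (0, k) z) h1 h2
        (fun p hp => by rw [Function.update_of_ne hp, Function.update_of_ne hp])
        (by rw [h3, srvTime_update, arrTime_update]; linarith)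
      refine ⟨h5, ?_, ?_⟩
      · dsimp only; rw [h4]; exact h2
      · dsimp only; rw [h4]; exact h3
  · left
    push Not at h
    exact h

open Classical in
/-- The part of the mean residual interarrival time that is due to one way of ending the busy
period, compared with the probability of this way, after averaging over the last interarrival
time. -/
lemma Good.lintegral_EndsAt_update {L : Fin 4 → Measure ℝ} (hL : PosLaw L) (hv : Good v)
    (F : Set ℝ) (t : ℕ × ℕ × ℕ) :
    let A := ∫⁻ z, (if EndsAt F (Function.update v (0, t.2.1) z) t then mean (L 0) else 0) ∂L 0
    let B := ∫⁻ z, (if EndsAt F (Function.update v (0, t.2.1) z) t then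
      ENNReal.ofReal (arrTime (Function.update v (0, t.2.1) z) (t.2.1 + 1) -
        srvTime (Function.update v (0, t.2.1) z) (t.2.2 + 1)) else 0) ∂L 0
    ((∀ z, 0 < z → ¬ EndsAt F (Function.update v (0, t.2.1) z) t) ∧ A = 0 ∧ B = 0) ∨
    (0 ≤ srvTime v (t.2.2 + 1) - arrTime v t.2.1 ∧
      A = mean (L 0) * L 0 (Set.Ioi (srvTime v (t.2.2 + 1) - arrTime v t.2.1)) ∧
      B = excess (L 0) (srvTime v (t.2.2 + 1) - arrTime v t.2.1)) := by
  intro A B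
  rcases hv.EndsAt_update F t with h | ⟨h0, h⟩
  · left
    refine ⟨h, ?_, ?_⟩
    all_goals
      refine (lintegral_congr_ae ?_).trans lintegral_zero
      filter_upwards [hL.τ_pos] with z hz using if_neg (h z hz)
  · right
    set x := srvTime v (t.2.2 + 1) - arrTime v t.2.1 with hx
    refine ⟨h0, ?_, ?_⟩
    · rw [← lintegral_indicator_const measurableSet_Ioi]
      refine lintegral_congr_ae ?_
      filter_upwards [hL.τ_pos] with z hz
      simp only [h z hz, Set.indicator, Set.mem_Ioi]
    · refine lintegral_congr_ae ?_
      filter_upwards [hL.τ_pos] with z hz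
      have h1 : arrTime v t.2.1 + z - srvTime v (t.2.2 + 1) = z - x := by rw [hx]; ring
      simp only [h z hz, arrTime_update, srvTime_update, h1]
      split_ifs with h2
      · rfl
      · exact (ENNReal.ofReal_of_nonpos (by linarith)).symm

open Classical in
lemma measurable_EndsAt_residual (hF : MeasurableSet F) (t : ℕ × ℕ × ℕ) :
    Measurable fun v : Inp => if EndsAt F v t then
      ENNReal.ofReal (arrTime v (t.2.1 + 1) - srvTime v (t.2.2 + 1)) else 0 :=
  Measurable.ite (measurableSet_EndsAt hF t) (ENNReal.measurable_ofReal.comp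
      ((measurable_arrTime measurable_const).sub (measurable_srvTime measurable_const)))
    measurable_const

open Classical in
lemma lintegral_residual_eq_tsum {L : Fin 4 → Measure ℝ} (hF : MeasurableSet F) :
    ∫⁻ v, residual F v ∂inputLaw L =
      ∑' t : ℕ × ℕ × ℕ, ∫⁻ v, (if EndsAt F v t then
        ENNReal.ofReal (arrTime v (t.2.1 + 1) - srvTime v (t.2.2 + 1)) else 0) ∂inputLaw L := by
  simp_rw [residual_eq_tsum]
  exact lintegral_tsum fun t => (measurable_EndsAt_residual hF t).aemeasurable

section Law

variable {L : Fin 4 → Measure ℝ} [∀ k, IsProbabilityMeasure (L k)]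

open Classical in
lemma lintegral_EndsAt_eq (hF : MeasurableSet F) (t : ℕ × ℕ × ℕ) {f : Inp → ℝ≥0∞}
    (hf : Measurable f) :
    Measurable (fun v => if EndsAt F v t then f v else 0) ∧
    ∫⁻ v, (if EndsAt F v t then f v else 0) ∂inputLaw L =
      ∫⁻ v, ∫⁻ z, (if EndsAt F (Function.update v (0, t.2.1) z) t then
        f (Function.update v (0, t.2.1) z) else 0) ∂L 0 ∂inputLaw L := by
  have hm : Measurable (fun v => if EndsAt F v t then f v else 0) :=
    Measurable.ite (measurableSet_EndsAt hF t) hf measurable_const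
  exact ⟨hm, lintegral_resample (L := fun p : Fin 4 × ℕ => L p.1) (0, t.2.1) hm⟩

/-- The mean residual life is at least the mean. -/
def NWUELaw (ν : Measure ℝ) : Prop := ∀ x, 0 ≤ x → mean ν * ν (Set.Ioi x) ≤ excess ν x

open Classical in
-- Average over the interarrival time with index `t.2.1`, the others being fixed. Ending in the way
-- `t` is either impossible or means that this time exceeds a threshold `z ≥ 0`; the right side then
-- becomes the mean excess over `z` and the left side the mean times the tail at `z`, and NWUE
-- compares the two.
lemma lintegral_EndsAt_le (hL : PosLaw L) (hN : NWUELaw (L 0)) (hF : MeasurableSet F)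
    (t : ℕ × ℕ × ℕ) :
    ∫⁻ v, (if EndsAt F v t then mean (L 0) else 0) ∂inputLaw L ≤
      ∫⁻ v, (if EndsAt F v t then
        ENNReal.ofReal (arrTime v (t.2.1 + 1) - srvTime v (t.2.2 + 1)) else 0) ∂inputLaw L := by
  have hm : Measurable fun v : Inp =>
      ENNReal.ofReal (arrTime v (t.2.1 + 1) - srvTime v (t.2.2 + 1)) :=
    ENNReal.measurable_ofReal.comp
      ((measurable_arrTime measurable_const).sub (measurable_srvTime measurable_const))
  rw [(lintegral_EndsAt_eq hF t measurable_const).2, (lintegral_EndsAt_eq hF t hm).2]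
  refine lintegral_mono_ae ?_
  filter_upwards [hL.ae_good] with v hv
  rcases hv.lintegral_EndsAt_update hL F t with ⟨-, h1, h2⟩ | ⟨h0, h1, h2⟩
  · rw [h1, h2]
  · rw [h1, h2]; exact hN _ h0

open Classical in
-- A busy period whose starting batch is admitted almost surely ends in exactly one of the ways `t`.
lemma mean_mul_eq_tsum (hF : MeasurableSet F)
    (hend : ∀ᵐ v ∂inputLaw L, ∃ H, (sys F v H).content = 0) :
    mean (L 0) * inputLaw L {v | (sys F v 0).content ≠ 0} =
      ∑' t, ∫⁻ v, (if EndsAt F v t then mean (L 0) else 0) ∂inputLaw L := by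
  rw [← lintegral_tsum fun t => (lintegral_EndsAt_eq (L := L) hF t measurable_const).1.aemeasurable,
    ← lintegral_indicator_const (s := {v : Inp | (sys F v 0).content ≠ 0})
      (measurableSet_content_zero hF).compl]
  refine lintegral_congr_ae ?_
  filter_upwards [hend] with v ⟨H, hH⟩
  by_cases h0 : (sys F v 0).content = 0
  · rw [Set.indicator_of_notMem (by simpa using h0), tsum_EndsAt_of_not]
    exact fun e he => he.1 (by rw [sys_of_empty h0 (Nat.zero_le e)]; exact h0)
  · obtain ⟨e, he⟩ := exists_Ends h0 hH
    rw [Set.indicator_of_mem (by simpa using h0), tsum_EndsAt he]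

lemma mean_mul_le_lintegral_residual (hL : PosLaw L) (hN : NWUELaw (L 0)) (hF : MeasurableSet F)
    (hend : ∀ᵐ v ∂inputLaw L, ∃ H, (sys F v H).content = 0) :
    mean (L 0) * inputLaw L {v | (sys F v 0).content ≠ 0} ≤ ∫⁻ v, residual F v ∂inputLaw L := by
  rw [mean_mul_eq_tsum hF hend, lintegral_residual_eq_tsum hF]
  exact ENNReal.tsum_le_tsum fun t => lintegral_EndsAt_le hL hN hF t

lemma lintegral_residual_of_memoryless (hL : PosLaw L)
    (hN : ∀ x, 0 ≤ x → excess (L 0) x = mean (L 0) * L 0 (Set.Ioi x)) (hF : MeasurableSet F)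
    (hend : ∀ᵐ v ∂inputLaw L, ∃ H, (sys F v H).content = 0) :
    ∫⁻ v, residual F v ∂inputLaw L = mean (L 0) * inputLaw L {v | (sys F v 0).content ≠ 0} := by
  classical
  rw [mean_mul_eq_tsum hF hend, lintegral_residual_eq_tsum hF]
  refine tsum_congr fun t => ?_
  have hm : Measurable fun v : Inp =>
      ENNReal.ofReal (arrTime v (t.2.1 + 1) - srvTime v (t.2.2 + 1)) :=
    ENNReal.measurable_ofReal.comp
      ((measurable_arrTime measurable_const).sub (measurable_srvTime measurable_const))
  rw [(lintegral_EndsAt_eq hF t measurable_const).2, (lintegral_EndsAt_eq hF t hm).2]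
  refine lintegral_congr_ae ?_
  filter_upwards [hL.ae_good] with v hv
  rcases hv.lintegral_EndsAt_update hL F t with ⟨-, h1, h2⟩ | ⟨h0, h1, h2⟩
  · rw [h1, h2]
  · rw [h1, h2]; exact hN _ h0

/-- If the mean residual interarrival time at the end of a busy period is minimal, the mean residual
life equals the mean at every level that can occur. -/
lemma ae_excess_eq (hL : PosLaw L) (hN : NWUELaw (L 0)) (ha : mean (L 0) ≠ ⊤)
    (hF : MeasurableSet F) (hend : ∀ᵐ v ∂inputLaw L, ∃ H, (sys F v H).content = 0)
    (heq : ∫⁻ v, residual F v ∂inputLaw L ≤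
      mean (L 0) * inputLaw L {v | (sys F v 0).content ≠ 0}) (t : ℕ × ℕ × ℕ) :
    ∀ᵐ v ∂inputLaw L, EndsAt F v t →
      excess (L 0) (srvTime v (t.2.2 + 1) - arrTime v t.2.1) =
        mean (L 0) * L 0 (Set.Ioi (srvTime v (t.2.2 + 1) - arrTime v t.2.1)) := by
  classical
  have hm : Measurable fun v : Inp =>
      ENNReal.ofReal (arrTime v (t.2.1 + 1) - srvTime v (t.2.2 + 1)) :=
    ENNReal.measurable_ofReal.comp
      ((measurable_arrTime measurable_const).sub (measurable_srvTime measurable_const))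
  have hfin : mean (L 0) * inputLaw L {v | (sys F v 0).content ≠ 0} ≠ ⊤ :=
    ENNReal.mul_ne_top ha (measure_ne_top _ _)
  rw [mean_mul_eq_tsum hF hend] at heq hfin
  rw [lintegral_residual_eq_tsum hF] at heq
  have hle := fun t => lintegral_EndsAt_le hL hN hF t
  -- Each term of the residual series is at least the corresponding term of the other series, and
  -- the sums agree and are finite, so no term can be strictly larger.
  have h1 : ∫⁻ v, (if EndsAt F v t then
        ENNReal.ofReal (arrTime v (t.2.1 + 1) - srvTime v (t.2.2 + 1)) else 0) ∂inputLaw L ≤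
      ∫⁻ v, (if EndsAt F v t then mean (L 0) else 0) ∂inputLaw L := by
    by_contra hlt
    exact absurd heq (not_le.2 (ENNReal.tsum_lt_tsum hfin hle (not_le.1 hlt)))
  have hfint : ∫⁻ v, (if EndsAt F v t then mean (L 0) else 0) ∂inputLaw L ≠ ⊤ :=
    ne_top_of_le_ne_top hfin (ENNReal.le_tsum t)
  rw [(lintegral_EndsAt_eq hF t measurable_const).2] at h1 hfint
  rw [(lintegral_EndsAt_eq hF t hm).2] at h1
  have hBm : Measurable fun v : Inp => ∫⁻ z, (if EndsAt F (Function.update v (0, t.2.1) z) t then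
      ENNReal.ofReal (arrTime (Function.update v (0, t.2.1) z) (t.2.1 + 1) -
        srvTime (Function.update v (0, t.2.1) z) (t.2.2 + 1)) else 0) ∂L 0 :=
    ((measurable_EndsAt_residual hF t).comp
      (measurable_update_prod (0, t.2.1))).lintegral_prod_right'
  -- The same principle once more, now for the integrals over the last interarrival time as
  -- functions of the remaining inputs.
  have hae := ae_eq_of_ae_le_of_lintegral_le (μ := inputLaw L) (by
      filter_upwards [hL.ae_good] with v hv
      rcases hv.lintegral_EndsAt_update hL F t with ⟨-, h1, h2⟩ | ⟨h0, h1, h2⟩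
      · exact (h1.trans h2.symm).le
      · rw [h1, h2]; exact hN _ h0) hfint hBm.aemeasurable h1
  filter_upwards [hL.ae_good, hae] with v hv hv' hE
  rcases hv.lintegral_EndsAt_update hL F t with ⟨h3, -, -⟩ | ⟨h0, h3, h4⟩
  · refine absurd ?_ (h3 (v (0, t.2.1)) (hv.τ_pos _))
    rwa [Function.update_eq_self]
  · rw [← h3, ← h4]; exact hv'.symm

end Law

end BatchQueue

/-! ### Load below one: the mean loss vanishes as the capacity grows -/

namespace BatchQueue

open scoped ENNReal Topology
open Filter

variable {F : Set ℝ} {v : Inp}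

lemma truncMean_mono (ν : Measure ℝ) : Monotone (truncMean ν) := fun _ _ h =>
  lintegral_mono fun _ => ENNReal.ofReal_le_ofReal (min_le_min_left _ h)

lemma truncMean_le_mean (ν : Measure ℝ) (c : ℝ) : truncMean ν c ≤ mean ν :=
  lintegral_mono fun _ => ENNReal.ofReal_le_ofReal (min_le_left _ _)

lemma iSup_truncMean (ν : Measure ℝ) : ⨆ n : ℕ, truncMean ν n = mean ν := by
  unfold truncMean mean
  rw [← lintegral_iSup (f := fun (n : ℕ) (z : ℝ) => ENNReal.ofReal (min z n))
    (fun n => by fun_prop) fun m n h z =>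
    ENNReal.ofReal_le_ofReal (min_le_min_left _ (by exact_mod_cast h))]
  refine lintegral_congr fun z => le_antisymm
    (iSup_le fun n => ENNReal.ofReal_le_ofReal (min_le_left _ _)) ?_
  obtain ⟨n, hn⟩ := exists_nat_ge z
  refine le_iSup_of_le n ?_
  rw [min_eq_left hn]

/-- A strict inequality between products of means survives truncation. -/
lemma exists_truncMean_lt {ν ν' : Measure ℝ} {r : ℝ≥0∞} (h : r < mean ν * mean ν') :
    ∃ c c' : ℕ, r < truncMean ν c * truncMean ν' c' := by
  rw [← iSup_truncMean ν, ENNReal.iSup_mul, lt_iSup_iff] at h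
  obtain ⟨c, hc⟩ := h
  rw [← iSup_truncMean ν', ENNReal.mul_iSup, lt_iSup_iff] at hc
  obtain ⟨c', hc'⟩ := hc
  exact ⟨c, c', hc'⟩

/-- Absorbs `q * s` into the left side. This needs `s` finite beforehand, which a finite capacity
guarantees, but the resulting bound does not depend on `s`. -/
lemma le_div_sub_of_mul_le {p q r s : ℝ≥0∞} (hs : s ≠ ⊤) (hqp : q < p) (hp : p ≠ ⊤)
    (h : p * s ≤ q * s + r) : s ≤ r / (p - q) := by
  have hq : q ≠ ⊤ := ne_top_of_lt hqp
  rw [ENNReal.le_div_iff_mul_le (Or.inl (tsub_pos_of_lt hqp).ne')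
    (Or.inl (ENNReal.sub_ne_top hp)), mul_comm, ENNReal.sub_mul fun _ _ => hs]
  rw [add_comm] at h
  exact tsub_le_iff_right.2 h

open Classical in
/-- The number of services that start with at most the mass `c` present, in states with
property `Q`. -/
noncomputable abbrev numLow (F : Set ℝ) (c : ℝ) (Q : Sys → Prop) : Inp → ℝ≥0∞ :=
  startSum F fun _ s => if s.work ≤ c ∧ Q s then 1 else 0

lemma measurable_numLow (hF : MeasurableSet F) (c : ℝ) {Q : Sys → Prop}
    (hQ : MeasurableSet {s | Q s}) : Measurable (numLow F c Q) := by
  classical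
  refine measurable_startSum hF fun e => Measurable.ite ?_ measurable_const measurable_const
  exact ((measurable_work.comp (measurable_sys hF e)) measurableSet_Iic).inter
      (measurable_sys hF e hQ)

lemma lintegral_numLow {L : Fin 4 → Measure ℝ} (hF : MeasurableSet F) (c : ℝ) {Q : Sys → Prop}
    (hQ : MeasurableSet {s | Q s}) :
    ∫⁻ v, numLow F c Q v ∂inputLaw L =
      ∑' e, inputLaw L {v | Starts F v e ∧ (sys F v e).work ≤ c ∧ Q (sys F v e)} := by
  classical
  have hm : ∀ e, MeasurableSet {v | Starts F v e ∧ (sys F v e).work ≤ c ∧ Q (sys F v e)} :=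
    fun e => (measurableSet_Starts hF e).inter
    (((measurable_work.comp (measurable_sys hF e)) measurableSet_Iic).inter
      (measurable_sys hF e hQ))
  have e1 : ∀ v, numLow F c Q v = ∑' e,
      {v | Starts F v e ∧ (sys F v e).work ≤ c ∧ Q (sys F v e)}.indicator 1 v := by
    intro v
    refine tsum_congr fun e => ?_
    by_cases h1 : Starts F v e <;> by_cases h2 : (sys F v e).work ≤ c ∧ Q (sys F v e) <;>
      simp [Set.indicator, h1, h2]
  simp_rw [e1]
  rw [lintegral_tsum fun e => (measurable_one.indicator (hm e)).aemeasurable]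
  exact tsum_congr fun e => lintegral_indicator_one (hm e)

/-- Services that do not start with little mass present serve much mass in the mean. -/
lemma mul_numServices_le (F : Set ℝ) (v : Inp) (ν : Measure ℝ) {p q : ℝ≥0∞} {c : ℝ}
    (h : p ≤ q * truncMean ν c) :
    p * numServices F v ≤ q * startSum F (fun _ s => truncMean ν s.work) v +
      p * numLow F c (fun _ => True) v := by
  rw [← startSum_const_mul, ← startSum_const_mul, ← startSum_const_mul, ← startSum_add]
  refine startSum_mono fun s => ?_
  by_cases hs : s.work ≤ c
  · simp [hs]
  · simp only [hs, false_and, if_false, mul_zero, add_zero, mul_one]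
    exact h.trans (by gcongr; exact truncMean_mono ν (not_le.1 hs).le)

section Law

variable {L : Fin 4 → Measure ℝ} [∀ k, IsProbabilityMeasure (L k)]

/-- When the load is less than one, the mean number of services of a busy period is bounded
uniformly in the capacity. -/
lemma exists_numServices_bound (hL : PosLaw L) (hτ : ∀ t, L 0 (Set.Ioi t) ≠ 0)
    (hX : mean (L 1) ≠ ⊤) (hb : mean (L 2) ≠ ⊤) (ha : mean (L 0) ≠ ⊤) (hY : mean (L 3) ≠ ⊤)
    (hρ : mean (L 1) * mean (L 2) < mean (L 0) * mean (L 3)) :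
    ∃ A : ℝ≥0∞, A ≠ ⊤ ∧ ∀ n : ℝ, 0 ≤ n → ∫⁻ v, numServices (Set.Iic n) v ∂inputLaw L ≤ A := by
  -- The interarrival times are truncated at `c` so that the overshoot of the last one costs at most
  -- `c`; the service batches at `c'` so that a service starting with more than `c'` removes at
  -- least `γ` in the mean.
  obtain ⟨c, c', hc⟩ := exists_truncMean_lt hρ
  obtain ⟨A, hA, hlow⟩ := exists_low_bound hL hτ c'
  set α := truncMean (L 0) c
  set γ := truncMean (L 3) c'
  have hα : α ≠ ⊤ := ne_top_of_le_ne_top ha (truncMean_le_mean _ _)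
  have hγ : γ ≠ ⊤ := ne_top_of_le_ne_top hY (truncMean_le_mean _ _)
  refine ⟨(mean (L 1) * ENNReal.ofReal c + α * γ * A) / (α * γ - mean (L 1) * mean (L 2)),
    ENNReal.div_ne_top (by finiteness) (tsub_pos_of_lt hc).ne', fun n hn => ?_⟩
  have hF : MeasurableSet (Set.Iic n) := measurableSet_Iic
  have hS := lintegral_numServices_ne_top hL hτ hn
  refine le_div_sub_of_mul_le hS hc (ENNReal.mul_ne_top hα hγ) ?_
  have h1 := lintegral_lost_add hL hb hF hS
  have h2 := truncMean_mul_le hL hF (c := c) (Nat.cast_nonneg c)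
  have hlow' : ∫⁻ v, numLow (Set.Iic n) c' (fun _ => True) v ∂inputLaw L ≤ A := by
    rw [lintegral_numLow hF _ MeasurableSet.univ]
    exact (hlow _ hF _ MeasurableSet.univ).trans
      ((mul_le_mul_right prob_le_one A).trans (mul_one A).le)
  have hmg : Measurable (startSum (Set.Iic n) fun _ s => truncMean (L 3) s.work) :=
    measurable_startSum hF fun e => (measurable_truncMean _).comp (measurable_sys_work hF e)
  have hmS : Measurable (numServices (Set.Iic n)) :=
    measurable_startSum hF fun e => measurable_const
  calc α * γ * ∫⁻ v, numServices (Set.Iic n) v ∂inputLaw L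
      = ∫⁻ v, α * γ * numServices (Set.Iic n) v ∂inputLaw L := (lintegral_const_mul _ hmS).symm
    _ ≤ ∫⁻ v, (α * startSum (Set.Iic n) (fun _ s => truncMean (L 3) s.work) v +
          α * γ * numLow (Set.Iic n) c' (fun _ => True) v) ∂inputLaw L :=
        lintegral_mono fun v => mul_numServices_le _ v (L 3) le_rfl
    _ = α * ∫⁻ v, startSum (Set.Iic n) (fun _ s => truncMean (L 3) s.work) v ∂inputLaw L +
          α * γ * ∫⁻ v, numLow (Set.Iic n) c' (fun _ => True) v ∂inputLaw L := by
        rw [lintegral_add_left (hmg.const_mul α), lintegral_const_mul _ hmg,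
          lintegral_const_mul _ (measurable_numLow hF _ MeasurableSet.univ)]
    _ ≤ α * (mean (L 1) * (1 + ∫⁻ v, numArrivals (Set.Iic n) v ∂inputLaw L)) + α * γ * A := by
        gcongr
        rw [← h1]
        exact le_add_self
    _ = mean (L 1) * (α * (1 + ∫⁻ v, numArrivals (Set.Iic n) v ∂inputLaw L)) + α * γ * A := by
        ring
    _ ≤ mean (L 1) * (mean (L 2) * ∫⁻ v, numServices (Set.Iic n) v ∂inputLaw L +
          ENNReal.ofReal c) + α * γ * A := by gcongr
    _ = _ := by ring

/-- When the load is less than one, the busy period of the system without capacity bound has a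
finite mean number of services. -/
lemma lintegral_numServices_univ_ne_top (hL : PosLaw L) (hτ : ∀ t, L 0 (Set.Ioi t) ≠ 0)
    (hX : mean (L 1) ≠ ⊤) (hb : mean (L 2) ≠ ⊤) (ha : mean (L 0) ≠ ⊤) (hY : mean (L 3) ≠ ⊤)
    (hρ : mean (L 1) * mean (L 2) < mean (L 0) * mean (L 3)) :
    ∫⁻ v, numServices Set.univ v ∂inputLaw L ≠ ⊤ := by
  classical
  obtain ⟨A, hA, h⟩ := exists_numServices_bound hL hτ hX hb ha hY hρ
  have hm : ∀ n : ℕ, Measurable (numServices (Set.Iic (n : ℝ))) := fun n =>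
    measurable_startSum measurableSet_Iic fun e => measurable_const
  refine ne_top_of_le_ne_top hA ?_
  -- Fatou's lemma: along a fixed path and up to a fixed event, a large capacity loses nothing and
  -- the bounded system coincides with the unbounded one.
  calc ∫⁻ v, numServices Set.univ v ∂inputLaw L
      ≤ ∫⁻ v, liminf (fun n : ℕ => numServices (Set.Iic (n : ℝ)) v) atTop ∂inputLaw L := by
        refine lintegral_mono_ae ?_
        filter_upwards [hL.ae_good] with v hv
        rw [numServices, startSum, ENNReal.tsum_eq_iSup_nat]
        refine iSup_le fun H => ?_
        refine le_liminf_of_le (by isBoundedDefault) ?_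
        obtain ⟨m, hm⟩ := exists_nat_ge
          (∑ i ∈ Finset.range (sys Set.univ v H).arr, v (1, i))
        filter_upwards [eventually_ge_atTop m] with n hn
        have heq : ∀ e ≤ H, sys (Set.Iic (n : ℝ)) v e = sys Set.univ v e := fun e he =>
          hv.sys_eq_univ (hv.lost_eq_zero ((Finset.sum_le_sum_of_subset_of_nonneg
            (Finset.range_mono (arr_mono Set.univ v he)) fun i _ _ => (hv.X_pos i).le).trans
              (hm.trans (by exact_mod_cast hn))))
        refine le_trans (Finset.sum_le_sum fun e he => ?_) (ENNReal.sum_le_tsum (Finset.range H))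
        have h1 := heq e (Finset.mem_range.1 he).le
        have h2 : Starts Set.univ v e ↔ Starts (Set.Iic (n : ℝ)) v e := by
          rw [Starts, Starts, h1]
        simp only [h2, le_refl]
    _ ≤ liminf (fun n : ℕ => ∫⁻ v, numServices (Set.Iic (n : ℝ)) v ∂inputLaw L) atTop :=
        lintegral_liminf_le hm
    _ ≤ A := liminf_le_of_le (by isBoundedDefault) fun b hb => by
        obtain ⟨n, hn⟩ := hb.exists
        exact hn.trans (h n n.cast_nonneg)

/-- The event that something is lost during the busy period. -/
def Losing (F : Set ℝ) : Set Inp := {v | ∃ e, (sys F v e).lost ≠ 0}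

lemma measurableSet_lost_ne_zero : MeasurableSet {s : Sys | s.lost ≠ 0} :=
  measurable_lost (measurableSet_singleton 0).compl

lemma measurableSet_Losing (hF : MeasurableSet F) : MeasurableSet (Losing F) := by
  have : Losing F = ⋃ e, {v | (sys F v e).lost ≠ 0} := by ext; simp [Losing]
  rw [this]
  exact MeasurableSet.iUnion fun e => measurable_sys hF e measurableSet_lost_ne_zero

lemma Good.startSum_eq_univ (hv : Good v) (h : v ∉ Losing F) (φ : Inp → Sys → ℝ≥0∞) :
    startSum F φ v = startSum Set.univ φ v := by
  have heq : ∀ e, sys F v e = sys Set.univ v e := fun e =>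
    hv.sys_eq_univ (by by_contra h'; exact h ⟨e, h'⟩)
  refine tsum_congr fun e => ?_
  have h' : Starts F v e ↔ Starts Set.univ v e := by rw [Starts, Starts, heq]
  rw [heq]
  classical exact if_congr h' rfl rfl

lemma Good.arrSum_eq_univ (hv : Good v) (h : v ∉ Losing F) (φ : Inp → Sys → ℝ≥0∞) :
    arrSum F φ v = arrSum Set.univ φ v := by
  have heq : ∀ e, sys F v e = sys Set.univ v e := fun e =>
    hv.sys_eq_univ (by by_contra h'; exact h ⟨e, h'⟩)
  refine tsum_congr fun e => ?_
  have h' : Arrives F v e ↔ Arrives Set.univ v e := by rw [Arrives, Arrives, heq]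
  rw [heq]
  classical exact if_congr h' rfl rfl

/-- Up to the first loss the system coincides with the unbounded one, so starts without a previous
loss are counted there. -/
lemma Good.numLow_le (hv : Good v) (F : Set ℝ) (c : ℝ) :
    numLow F c (fun _ => True) v ≤ numServices Set.univ v + numLow F c (fun s => s.lost ≠ 0) v := by
  classical
  rw [numLow, numServices, numLow, startSum, startSum, startSum, ← ENNReal.tsum_add]
  refine ENNReal.tsum_le_tsum fun e => ?_
  by_cases hl : (sys F v e).lost = 0
  · have h1 : Starts Set.univ v e ↔ Starts F v e := by rw [Starts, Starts, hv.sys_eq_univ hl]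
    by_cases h2 : Starts F v e
    · simp only [h1, h2, if_true]
      refine le_trans ?_ le_self_add
      split_ifs <;> simp
    · simp [h2]
  · by_cases h2 : Starts F v e
    · simp [h2, hl]
    · simp [h2]

lemma lost_univ (v : Inp) (e : ℕ) : (sys Set.univ v e).lost = 0 := by
  induction e with
  | zero => rw [sys_zero_of_mem (Set.mem_univ _)]
  | succ e ih =>
    rcases sys_succ_cases Set.univ v e with
      ⟨h1, h'⟩ | ⟨h1, h2, hF, h'⟩ | ⟨h1, h2, hF, h'⟩ | ⟨h1, h2, h'⟩
    · rw [h', ih]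
    · rw [h']; exact ih
    · exact absurd (Set.mem_univ _) hF
    · rw [h']; exact ih

/-- The unbounded busy period ends almost surely, so the mass arriving in it is finite, and a
capacity above this mass loses nothing. -/
lemma tendsto_measure_Losing (hL : PosLaw L) (hb : mean (L 2) ≠ ⊤)
    (hS : ∫⁻ v, numServices Set.univ v ∂inputLaw L ≠ ⊤) :
    Tendsto (fun n : ℕ => inputLaw L (Losing (Set.Iic (n : ℝ)))) atTop (𝓝 0) := by
  let B : ℕ → Set Inp := fun n =>
    {v | ∃ e, (n : ℝ) < ∑ i ∈ Finset.range (sys Set.univ v e).arr, v (1, i)}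
  have hBm : ∀ n, MeasurableSet (B n) := fun n => by
    have : B n = ⋃ e, {v | (n : ℝ) < ∑ i ∈ Finset.range (sys Set.univ v e).arr, v (1, i)} := by
      ext; simp [B]
    rw [this]
    refine MeasurableSet.iUnion fun e => measurableSet_lt measurable_const ?_
    have h : Measurable fun x : ℕ × Inp => ∑ i ∈ Finset.range x.1, x.2 (1, i) :=
      measurable_from_prod_countable_right fun i => by
        change Measurable fun v : Inp => ∑ k ∈ Finset.range i, v (1, k)
        fun_prop
    exact h.comp ((measurable_arr.comp (measurable_sys MeasurableSet.univ e)).prodMk measurable_id)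
  have hanti : Antitone B := fun m n hmn v ⟨e, he⟩ =>
    ⟨e, lt_of_le_of_lt (by exact_mod_cast hmn) he⟩
  have h0 : inputLaw L (⋂ n, B n) = 0 := by
    rw [measure_eq_zero_iff_ae_notMem]
    filter_upwards [hL.ae_good, ae_exists_empty hL hb MeasurableSet.univ hS] with v hv ⟨H, hH⟩ hmem
    obtain ⟨n, hn⟩ := exists_nat_ge (∑ i ∈ Finset.range (sys Set.univ v H).arr, v (1, i))
    obtain ⟨e, he⟩ := Set.mem_iInter.1 hmem n
    have hle : (sys Set.univ v e).arr ≤ (sys Set.univ v H).arr := by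
      rcases le_total e H with h | h
      · exact arr_mono Set.univ v h
      · rw [sys_of_empty hH h]
    have := Finset.sum_le_sum_of_subset_of_nonneg (Finset.range_mono hle)
      fun i _ _ => (hv.X_pos i).le
    linarith
  have hlim := tendsto_measure_iInter_atTop (μ := inputLaw L)
    (fun n => (hBm n).nullMeasurableSet) hanti ⟨0, measure_ne_top _ _⟩
  rw [h0] at hlim
  refine tendsto_of_tendsto_of_tendsto_of_le_of_le tendsto_const_nhds hlim
    (fun _ => zero_le) fun n => measure_mono_ae ?_
  filter_upwards [hL.ae_good] with v hv
  rintro ⟨e, he⟩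
  refine ⟨e, ?_⟩
  by_contra hle
  exact he (hv.lost_eq_zero (not_lt.1 hle))

/-- When the load is less than one, the mean mass lost in a busy period is small for large
capacities. -/
lemma tendsto_lintegral_lostTotal (hL : PosLaw L) (hτ : ∀ t, L 0 (Set.Ioi t) ≠ 0)
    (hX : mean (L 1) ≠ ⊤) (hb : mean (L 2) ≠ ⊤) (ha : mean (L 0) ≠ ⊤) (hY : mean (L 3) ≠ ⊤)
    (hρ : mean (L 1) * mean (L 2) < mean (L 0) * mean (L 3)) :
    Tendsto (fun n : ℕ => ∫⁻ v, lostTotal (Set.Iic (n : ℝ)) v ∂inputLaw L) atTop (𝓝 0) := by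
  have hSu := lintegral_numServices_univ_ne_top hL hτ hX hb ha hY hρ
  obtain ⟨c, c', hc⟩ := exists_truncMean_lt hρ
  obtain ⟨A, hA, hlow⟩ := exists_low_bound hL hτ c'
  set α := truncMean (L 0) c with hαdef
  have hα : α ≠ ⊤ := ne_top_of_le_ne_top ha (truncMean_le_mean _ _)
  have hα0 : α ≠ 0 := fun h => by rw [h, zero_mul] at hc; exact not_lt_zero hc
  set x := mean (L 1)
  set b := mean (L 2)
  let S : Set ℝ → Inp → ℝ≥0∞ := fun F v => ENNReal.ofReal (min (v (0, 0)) c) +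
        arrSum F (fun v s => ENNReal.ofReal (min (v (0, s.arr)) c)) v
  let T : Set ℝ → Inp → ℝ≥0∞ := fun F => startSum F fun v s => ENNReal.ofReal (v (2, s.served))
  let Γ : Set ℝ → Inp → ℝ≥0∞ := fun F => startSum F fun _ s => truncMean (L 3) s.work
  -- `U` and `W` are chosen to be compared twice. In the mean, Wald's identities give `α * E
  -- lostTotal + E U = E W`. Pathwise, `S ≤ T + c` and the mass removed by services that do not
  -- start low show that `W` exceeds `U` by at most a constant and a multiple of the number of low
  -- starts.
  let U : Set ℝ → Inp → ℝ≥0∞ := fun F v => α * Γ F v + x * T F v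
  let W : Set ℝ → Inp → ℝ≥0∞ := fun F v => x * S F v + x * b * numServices F v
  have hmT : ∀ F, MeasurableSet F → Measurable (T F) := fun F hF =>
    measurable_startSum hF fun e => ENNReal.measurable_ofReal.comp (measurable_served_coord hF 2 e)
  have hmΓ : ∀ F, MeasurableSet F → Measurable (Γ F) := fun F hF =>
    measurable_startSum hF fun e => (measurable_truncMean _).comp (measurable_sys_work hF e)
  have hmN : ∀ F, MeasurableSet F → Measurable (numServices F) := fun F hF =>
    measurable_startSum hF fun e => measurable_const
  have hmc : Measurable fun z : ℝ => ENNReal.ofReal (min z c) := by fun_prop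
  have hmS : ∀ F, MeasurableSet F → Measurable (S F) := fun F hF =>
    (hmc.comp (measurable_pi_apply _)).add
      (measurable_arrSum hF fun e => hmc.comp (measurable_arr_coord hF 0 e))
  have hmU : ∀ F, MeasurableSet F → Measurable (U F) := fun F hF =>
    ((hmΓ F hF).const_mul _).add ((hmT F hF).const_mul _)
  have hmW : ∀ F, MeasurableSet F → Measurable (W F) := fun F hF =>
    ((hmS F hF).const_mul _).add ((hmN F hF).const_mul _)
  have hbal : ∀ F, MeasurableSet F → ∫⁻ v, numServices F v ∂inputLaw L ≠ ⊤ →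
      α * ∫⁻ v, lostTotal F v ∂inputLaw L + ∫⁻ v, U F v ∂inputLaw L =
        ∫⁻ v, W F v ∂inputLaw L := by
    intro F hF hS
    have h1 := lintegral_lost_add hL hb hF hS
    have h2 := lintegral_arrSum (L := L) hF (k := 0) (Or.inl rfl) hmc
    have h3 := lintegral_startSum_const (L := L) hF (k := 2) (Or.inl rfl) ENNReal.measurable_ofReal
    simp only [U, W]
    rw [lintegral_add_left ((hmΓ F hF).const_mul _), lintegral_add_left ((hmS F hF).const_mul _),
      lintegral_const_mul _ (hmΓ F hF), lintegral_const_mul _ (hmT F hF),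
      lintegral_const_mul _ (hmS F hF), lintegral_const_mul _ (hmN F hF)]
    change α * _ + (α * _ + x * ∫⁻ v, startSum F (fun v s => ENNReal.ofReal (v (2, s.served))) v
      ∂inputLaw L) = x * ∫⁻ v, (ENNReal.ofReal (min (v (0, 0)) c) +
        arrSum F (fun v s => ENNReal.ofReal (min (v (0, s.arr)) c)) v) ∂inputLaw L + _
    rw [h2, h3, ← add_assoc, ← mul_add, h1]
    change α * (x * _) + x * (b * _) = x * (α * _) + _
    ring
  have hUfin : ∀ F, MeasurableSet F → ∫⁻ v, numServices F v ∂inputLaw L ≠ ⊤ →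
      ∫⁻ v, U F v ∂inputLaw L ≠ ⊤ := by
    intro F hF hS
    have h1 := lintegral_lost_add hL hb hF hS
    have hA' := lintegral_numArrivals_ne_top hL hb hF hS
    have h3 := lintegral_startSum_const (L := L) hF (k := 2) (Or.inl rfl) ENNReal.measurable_ofReal
    simp only [U]
    rw [lintegral_add_left ((hmΓ F hF).const_mul _), lintegral_const_mul _ (hmΓ F hF),
      lintegral_const_mul _ (hmT F hF)]
    refine ENNReal.add_ne_top.2 ⟨ENNReal.mul_ne_top hα ?_, ENNReal.mul_ne_top hX ?_⟩
    · refine ne_top_of_le_ne_top ?_ (le_add_self.trans h1.le)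
      exact ENNReal.mul_ne_top hX (ENNReal.add_ne_top.2 ⟨ENNReal.one_ne_top, hA'⟩)
    · exact (h3.trans_ne (ENNReal.mul_ne_top hb hS))
  -- An integrable function that does not depend on the capacity and whose integral over the event
  -- of a loss bounds `α` times the mean loss.
  let V : Inp → ℝ≥0∞ := fun v =>
    (x * ENNReal.ofReal c + x * b * numServices Set.univ v) + x * b * A + U Set.univ v
  have hmR : Measurable fun v => x * ENNReal.ofReal c + x * b * numServices Set.univ v :=
    ((hmN _ MeasurableSet.univ).const_mul _).const_add _
  have hVfin : ∫⁻ v, V v ∂inputLaw L ≠ ⊤ := by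
    simp only [V]
    rw [lintegral_add_right _ (hmU _ MeasurableSet.univ), lintegral_add_right _ measurable_const,
      lintegral_add_right _ ((hmN _ MeasurableSet.univ).const_mul _), lintegral_const,
      lintegral_const, measure_univ, mul_one, mul_one,
      lintegral_const_mul _ (hmN _ MeasurableSet.univ)]
    have := hUfin _ MeasurableSet.univ hSu
    finiteness
  -- The balance of the unbounded system, where nothing is lost, is compared with that of capacity
  -- `n`. Off the event `D` of a loss both have the same `U` and `W`, so only integrals over `D`
  -- remain.
  have hmain : ∀ n : ℕ, α * ∫⁻ v, lostTotal (Set.Iic (n : ℝ)) v ∂inputLaw L ≤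
      ∫⁻ v in Losing (Set.Iic (n : ℝ)), V v ∂inputLaw L := by
    intro n
    set F := Set.Iic (n : ℝ) with hFdef
    have hF : MeasurableSet F := measurableSet_Iic
    have hD := measurableSet_Losing hF
    set D := Losing F
    have hS : ∫⁻ v, numServices F v ∂inputLaw L ≠ ⊤ :=
      lintegral_numServices_ne_top hL hτ n.cast_nonneg
    have b1 := hbal F hF hS
    have b2 := hbal Set.univ MeasurableSet.univ hSu
    -- A start after a loss presupposes `D`, so the mean number of low starts of this kind is at
    -- most `A` times the probability of `D`, which is small.
    have hlow1 : ∫⁻ v in D, numLow F c' (fun s => s.lost ≠ 0) v ∂inputLaw L ≤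
        ∫⁻ _ in D, A ∂inputLaw L := by
      refine (setLIntegral_le_lintegral _ _).trans ?_
      rw [lintegral_numLow hF _ measurableSet_lost_ne_zero, setLIntegral_const]
      refine (hlow F hF _ measurableSet_lost_ne_zero).trans ?_
      refine mul_le_mul_right (measure_mono ?_) A
      rintro v ⟨e, -, he⟩
      exact ⟨e, he⟩
    have hWD : ∫⁻ v in D, W F v ∂inputLaw L ≤ ∫⁻ v in D, U F v ∂inputLaw L +
        (∫⁻ v in D, (x * ENNReal.ofReal c + x * b * numServices Set.univ v) ∂inputLaw L +
          x * b * ∫⁻ _ in D, A ∂inputLaw L) := by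
      calc ∫⁻ v in D, W F v ∂inputLaw L
          ≤ ∫⁻ v in D, (U F v + ((x * ENNReal.ofReal c + x * b * numServices Set.univ v) +
            x * b * numLow F c' (fun s => s.lost ≠ 0) v)) ∂inputLaw L := by
            refine lintegral_mono_ae (ae_restrict_of_ae ?_)
            filter_upwards [hL.ae_good] with v hv
            have h1 : S F v ≤ T F v + ENNReal.ofReal c := hv.arrSum_min_le F (Nat.cast_nonneg c)
            have h2 : x * b * numServices F v ≤ α * Γ F v + x * b * numLow F c' (fun _ => True) v :=
              mul_numServices_le F v (L 3) hc.le
            have h3 := hv.numLow_le F c'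
            calc W F v = x * S F v + x * b * numServices F v := rfl
              _ ≤ x * (T F v + ENNReal.ofReal c) + (α * Γ F v + x * b *
                  (numServices Set.univ v + numLow F c' (fun s => s.lost ≠ 0) v)) :=
                add_le_add (mul_le_mul_right h1 _) (h2.trans
                  (by gcongr))
              _ = _ := by simp only [U]; ring
        _ ≤ _ := by
            rw [lintegral_add_left (hmU F hF), lintegral_add_left hmR,
              lintegral_const_mul _ (measurable_numLow hF _ measurableSet_lost_ne_zero)]
            gcongr
    have hsplit : ∀ f : Inp → ℝ≥0∞, ∫⁻ v, f v ∂inputLaw L =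
        ∫⁻ v in D, f v ∂inputLaw L + ∫⁻ v in Dᶜ, f v ∂inputLaw L := fun f =>
      (lintegral_add_compl f hD).symm
    have hUc : ∫⁻ v in Dᶜ, U Set.univ v ∂inputLaw L = ∫⁻ v in Dᶜ, U F v ∂inputLaw L := by
      refine setLIntegral_congr_fun_ae hD.compl ?_
      filter_upwards [hL.ae_good] with v hv hvD
      simp only [U, Γ, T]
      rw [hv.startSum_eq_univ hvD, hv.startSum_eq_univ hvD]
    have hWc : ∫⁻ v in Dᶜ, W Set.univ v ∂inputLaw L = ∫⁻ v in Dᶜ, W F v ∂inputLaw L := by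
      refine setLIntegral_congr_fun_ae hD.compl ?_
      filter_upwards [hL.ae_good] with v hv hvD
      simp only [W, S, numServices]
      rw [hv.startSum_eq_univ hvD, hv.arrSum_eq_univ hvD]
    have hM : ∀ v, lostTotal Set.univ v = 0 := fun v => by simp [lostTotal, lost_univ]
    simp only [hM, lintegral_zero, mul_zero, zero_add] at b2
    rw [hsplit (U F), hsplit (W F)] at b1
    rw [hsplit (U Set.univ), hsplit (W Set.univ), hUc, hWc] at b2
    have hUF := hUfin F hF hS
    rw [hsplit (U F)] at hUF
    have hVD : ∫⁻ v in D, V v ∂inputLaw L =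
        ∫⁻ v in D, (x * ENNReal.ofReal c + x * b * numServices Set.univ v) ∂inputLaw L +
          x * b * ∫⁻ _ in D, A ∂inputLaw L + ∫⁻ v in D, U Set.univ v ∂inputLaw L := by
      simp only [V]
      rw [lintegral_add_right _ (hmU _ MeasurableSet.univ), lintegral_add_right _ measurable_const,
        lintegral_const_mul _ measurable_const]
    refine (ENNReal.add_le_add_iff_right hUF).1 ?_
    rw [b1, hVD]
    calc _ ≤ _ := add_le_add hWD (le_add_self.trans b2.symm.le)
      _ = _ := by ring
  have hlim := tendsto_setLIntegral_zero hVfin (tendsto_measure_Losing hL hb hSu)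
  have hlim' := ENNReal.Tendsto.const_mul (a := α⁻¹) hlim (Or.inr (ENNReal.inv_ne_top.2 hα0))
  rw [mul_zero] at hlim'
  refine tendsto_of_tendsto_of_tendsto_of_le_of_le tendsto_const_nhds hlim'
    (fun _ => zero_le) fun n => ?_
  rw [mul_comm, ← div_eq_mul_inv]
  refine (ENNReal.le_div_iff_mul_le (Or.inl hα0) (Or.inl hα)).2 ?_
  rw [mul_comm]
  exact hmain n

end Law

end BatchQueue

/-! ### Constant mean loss forces equality in the mean inequalities -/

namespace BatchQueue

open scoped ENNReal Topology
open Filter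

variable {F : Set ℝ} {v : Inp}

lemma ennreal_eq_of_tsum_eq {ι : Type*} {f g : ι → ℝ≥0∞} (hle : ∀ i, f i ≤ g i)
    (h : ∑' i, f i = ∑' i, g i) (hfin : ∑' i, f i ≠ ⊤) (i : ι) : f i = g i := by
  by_contra hne
  exact absurd h (ENNReal.tsum_lt_tsum hfin hle (lt_of_le_of_ne (hle i) hne)).ne

lemma lintegral_startSum_truncMean_le {L : Fin 4 → Measure ℝ} (hF : MeasurableSet F) :
    ∫⁻ v, startSum F (fun _ s => truncMean (L 3) s.work) v ∂inputLaw L ≤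
      mean (L 3) * ∫⁻ v, numServices F v ∂inputLaw L := by
  rw [← lintegral_const_mul _ (measurable_startSum hF fun e => measurable_const)]
  refine lintegral_mono fun v => ?_
  rw [← startSum_const_mul]
  exact startSum_mono fun s => by rw [mul_one]; exact truncMean_le_mean _ _

section Law

variable {L : Fin 4 → Measure ℝ} [∀ k, IsProbabilityMeasure (L k)]

lemma prob_content_zero_add (hF : MeasurableSet F) :
    inputLaw L {v | (sys F v 0).content ≠ 0} + inputLaw L {v | (sys F v 0).content = 0} = 1 := by
  rw [add_comm]
  exact prob_add_prob_compl (measurableSet_content_zero hF)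

/-- For NWUE interarrival times, the mean length of a busy period is at most the mean interarrival
time multiplied by the mean number of arrivals, with equality if and only if the time from the end
of the busy period to the next arrival has the mean of an interarrival time. -/
lemma mean_mul_numServices_le (hL : PosLaw L) (hN : NWUELaw (L 0)) (ha : mean (L 0) ≠ ⊤)
    (hb : mean (L 2) ≠ ⊤) (hF : MeasurableSet F)
    (hS : ∫⁻ v, numServices F v ∂inputLaw L ≠ ⊤) :
    mean (L 2) * ∫⁻ v, numServices F v ∂inputLaw L ≤
      mean (L 0) * ∫⁻ v, numArrivals F v ∂inputLaw L ∧
    (mean (L 2) * ∫⁻ v, numServices F v ∂inputLaw L =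
      mean (L 0) * ∫⁻ v, numArrivals F v ∂inputLaw L ↔
      ∫⁻ v, residual F v ∂inputLaw L = mean (L 0) * inputLaw L {v | (sys F v 0).content ≠ 0}) := by
  have h1 := lintegral_time_balance hL hb hF hS
  have h2 := mean_mul_le_lintegral_residual hL hN hF (ae_exists_empty hL hb hF hS)
  have hA := lintegral_numArrivals_ne_top hL hb hF hS
  have h3 := prob_content_zero_add (L := L) hF
  set A := ∫⁻ v, numArrivals F v ∂inputLaw L
  set s := ∫⁻ v, numServices F v ∂inputLaw L
  set R := ∫⁻ v, residual F v ∂inputLaw L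
  set p := inputLaw L {v | (sys F v 0).content ≠ 0}
  set p0 := inputLaw L {v | (sys F v 0).content = 0}
  set a := mean (L 0)
  set b := mean (L 2)
  have hp : p ≠ ⊤ := measure_ne_top _ _
  have hp0 : p0 ≠ ⊤ := measure_ne_top _ _
  have h4 : a * A + a * p + a * p0 = b * s + R + a * p0 := by
    rw [← h1, add_assoc, ← mul_add, h3]; ring
  have h5 : a * A + a * p = b * s + R :=
    (ENNReal.add_left_inj (ENNReal.mul_ne_top ha hp0)).1 h4
  have hap := ENNReal.mul_ne_top ha hp
  refine ⟨?_, fun h => ?_, fun h => ?_⟩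
  · refine (ENNReal.add_le_add_iff_right hap).1 ?_
    rw [h5]
    gcongr
  · rw [h] at h5
    exact ((ENNReal.add_right_inj (ENNReal.mul_ne_top ha hA)).1 h5).symm
  · rw [h] at h5
    exact ((ENNReal.add_left_inj hap).1 h5).symm

/-- If the mean mass lost in a busy period is always the mean mass of a batch, the load is one and
all inequalities between means are equalities. -/
lemma equalities_of_lost_eq (hL : PosLaw L) (hN : NWUELaw (L 0)) (hτ : ∀ t, L 0 (Set.Ioi t) ≠ 0)
    (hX : mean (L 1) ≠ ⊤) (hX0 : mean (L 1) ≠ 0) (hb : mean (L 2) ≠ ⊤) (ha : mean (L 0) ≠ ⊤)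
    (ha0 : mean (L 0) ≠ 0) (hY : mean (L 3) ≠ ⊤)
    (hM : ∀ n : ℝ, 0 < n → ∫⁻ v, lostTotal (Set.Iic n) v ∂inputLaw L = mean (L 1)) :
    mean (L 1) * mean (L 2) = mean (L 0) * mean (L 3) ∧ ∀ n : ℝ, 0 < n →
      ∫⁻ v, startSum (Set.Iic n) (fun _ s => truncMean (L 3) s.work) v ∂inputLaw L =
        mean (L 3) * ∫⁻ v, numServices (Set.Iic n) v ∂inputLaw L ∧
      ∫⁻ v, residual (Set.Iic n) v ∂inputLaw L =
        mean (L 0) * inputLaw L {v | (sys (Set.Iic n) v 0).content ≠ 0} := by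
  -- Otherwise the mean loss, which is a positive constant, would tend to `0` along the integer
  -- capacities.
  have hρ : mean (L 0) * mean (L 3) ≤ mean (L 1) * mean (L 2) := by
    by_contra h
    have h1 := tendsto_lintegral_lostTotal hL hτ hX hb ha hY (not_le.1 h)
    have h2 : Tendsto (fun n : ℕ => ∫⁻ v, lostTotal (Set.Iic (n : ℝ)) v ∂inputLaw L) atTop
        (𝓝 (mean (L 1))) := by
      refine tendsto_const_nhds.congr' ?_
      filter_upwards [eventually_gt_atTop 0] with n hn
      exact (hM n (by exact_mod_cast hn)).symm
    exact hX0 (tendsto_nhds_unique h2 h1)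
  have main : ∀ n : ℝ, 0 < n →
      (mean (L 1) * mean (L 2) * ∫⁻ v, numServices (Set.Iic n) v ∂inputLaw L =
        mean (L 0) * mean (L 3) * ∫⁻ v, numServices (Set.Iic n) v ∂inputLaw L) ∧
      ∫⁻ v, startSum (Set.Iic n) (fun _ s => truncMean (L 3) s.work) v ∂inputLaw L =
        mean (L 3) * ∫⁻ v, numServices (Set.Iic n) v ∂inputLaw L ∧
      ∫⁻ v, residual (Set.Iic n) v ∂inputLaw L =
        mean (L 0) * inputLaw L {v | (sys (Set.Iic n) v 0).content ≠ 0} := by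
    intro n hn
    have hF : MeasurableSet (Set.Iic n) := measurableSet_Iic
    have hS := lintegral_numServices_ne_top hL hτ hn.le
    have h1 := lintegral_lost_add hL hb hF hS
    have h2 := lintegral_startSum_truncMean_le (L := L) hF
    obtain ⟨h3, h4⟩ := mean_mul_numServices_le hL hN ha hb hF hS
    have hA := lintegral_numArrivals_ne_top hL hb hF hS
    rw [hM n hn] at h1
    rw [← h4]
    set A := ∫⁻ v, numArrivals (Set.Iic n) v ∂inputLaw L
    set s := ∫⁻ v, numServices (Set.Iic n) v ∂inputLaw L
    set g := ∫⁻ v, startSum (Set.Iic n) (fun _ s => truncMean (L 3) s.work) v ∂inputLaw L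
    set a := mean (L 0)
    set b := mean (L 2)
    set x := mean (L 1)
    set y := mean (L 3)
    have h5 : g = x * A := by
      rw [mul_add, mul_one] at h1
      exact (ENNReal.add_right_inj hX).1 h1
    -- The chain `x b s ≤ x a A = a g ≤ a y s ≤ x b s` returns to its beginning. The first link is
    -- NWUE, the second bounds the mass removed by a service by its service batch, the last is the
    -- load bound `hρ`.
    have h6 : x * (b * s) ≤ x * (a * A) := by gcongr
    have h7 : x * (a * A) = a * g := by rw [h5]; ring
    have h8 : a * g ≤ a * (y * s) := by gcongr
    have h9 : a * (y * s) ≤ x * (b * s) := by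
      rw [← mul_assoc, ← mul_assoc]; gcongr
    have e1 : x * (b * s) = x * (a * A) := le_antisymm h6 (h7.trans_le (h8.trans h9))
    have e2 : a * g = a * (y * s) := le_antisymm h8 (h9.trans (h6.trans h7.le))
    exact ⟨by rw [mul_assoc, mul_assoc, ← e2, ← h7, e1],
      (ENNReal.mul_right_inj ha0 ha).1 e2, (ENNReal.mul_right_inj hX0 hX).1 e1⟩
  refine ⟨?_, fun n hn => (main n hn).2⟩
  -- One capacity that admits the starting batch with positive probability suffices: its mean number
  -- of services is neither zero nor infinite and cancels from the equality.
  obtain ⟨B, hB, hB'⟩ := exists_Iic_ne_zero (L 1)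
  have hn : 0 < B + 1 := by linarith
  have hS := lintegral_numServices_ne_top hL hτ hn.le
  have hs0 : ∫⁻ v, numServices (Set.Iic (B + 1)) v ∂inputLaw L ≠ 0 := by
    rw [lintegral_numServices measurableSet_Iic]
    intro h0
    have h1 := ENNReal.tsum_eq_zero.1 h0 0
    have h2 : inputLaw L {v | v (1, 0) ∈ Set.Iic B} = L 1 (Set.Iic B) :=
      (measurePreserving_eval_infinitePi (fun p : Fin 4 × ℕ => L p.1) (1, 0)).measure_preimage
        measurableSet_Iic.nullMeasurableSet
    refine hB' (h2 ▸ measure_mono_null_ae ?_ h1)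
    filter_upwards [hL.ae_good] with v hv hvB
    exact ⟨hv.content_zero_ne_zero_iff.2 (show v (1, 0) ≤ B + 1 from
      (show v (1, 0) ≤ B from hvB).trans (by linarith)), sys_zero_fresh _ _⟩
  exact (ENNReal.mul_left_inj hs0 hS).1 (main _ hn).1

/-- If services remove as much as possible in the mean, service batches always fit. -/
lemma ae_served_le_work (hL : PosLaw L) (hY : mean (L 3) ≠ ⊤) (hF : MeasurableSet F)
    (hS : ∫⁻ v, numServices F v ∂inputLaw L ≠ ⊤)
    (h : ∫⁻ v, startSum F (fun _ s => truncMean (L 3) s.work) v ∂inputLaw L =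
        mean (L 3) * ∫⁻ v, numServices F v ∂inputLaw L) :
    ∀ᵐ v ∂inputLaw L, ∀ e, Starts F v e → v (3, (sys F v e).served) ≤ (sys F v e).work := by
  classical
  have hm : ∀ e, Measurable fun v : Inp =>
      ENNReal.ofReal (min (v (3, (sys F v e).served)) (sys F v e).work) := fun e =>
    ENNReal.measurable_ofReal.comp
      ((measurable_served_coord hF 3 e).min (measurable_sys_work hF e))
  have hm' : ∀ e, Measurable fun v : Inp => ENNReal.ofReal (v (3, (sys F v e).served)) := fun e =>
    ENNReal.measurable_ofReal.comp (measurable_served_coord hF 3 e)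
  have h1 := lintegral_startSum (L := L) hF (k := 3) (Or.inr rfl)
    (φ := fun z w => ENNReal.ofReal (min z w)) (by fun_prop)
  have h2 := lintegral_startSum_const (L := L) hF (k := 3) (Or.inr rfl) ENNReal.measurable_ofReal
  have hle : ∀ v, startSum F (fun v s => ENNReal.ofReal (min (v (3, s.served)) s.work)) v ≤
      startSum F (fun v s => ENNReal.ofReal (v (3, s.served))) v := fun v =>
    startSum_mono fun s => ENNReal.ofReal_le_ofReal (min_le_left _ _)
  have hfin : mean (L 3) * ∫⁻ v, numServices F v ∂inputLaw L ≠ ⊤ := ENNReal.mul_ne_top hY hS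
  have e1 : ∫⁻ v, startSum F (fun v s => ENNReal.ofReal (min (v (3, s.served)) s.work)) v
      ∂inputLaw L = mean (L 3) * ∫⁻ v, numServices F v ∂inputLaw L := h1.trans h
  have e2 : ∫⁻ v, startSum F (fun v s => ENNReal.ofReal (v (3, s.served))) v ∂inputLaw L =
      mean (L 3) * ∫⁻ v, numServices F v ∂inputLaw L := h2
  -- Truncating the service batches at the mass present decreases the sum pathwise but not its
  -- finite mean. Hence it changes no sum, and then no summand, almost surely.
  have hae := ae_eq_of_ae_le_of_lintegral_le (Eventually.of_forall hle) (e1 ▸ hfin)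
    (measurable_startSum hF hm').aemeasurable (e2.trans e1.symm).le
  filter_upwards [hL.ae_good, hae, ae_lt_top (measurable_startSum hF hm) (e1 ▸ hfin)]
    with v hv h3 h4 e he
  have h5 := ennreal_eq_of_tsum_eq
    (f := fun e => if Starts F v e then
      ENNReal.ofReal (min (v (3, (sys F v e).served)) (sys F v e).work) else 0)
    (g := fun e => if Starts F v e then ENNReal.ofReal (v (3, (sys F v e).served)) else 0)
    (fun e => by
      split_ifs
      exacts [ENNReal.ofReal_le_ofReal (min_le_left _ _), le_rfl]) h3 h4.ne e
  simp only [he, if_true] at h5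
  rw [ENNReal.ofReal_eq_ofReal_iff (le_min (hv.Y_pos _).le (hv.sys_inv F e).1)
    (hv.Y_pos _).le] at h5
  exact min_eq_left_iff.1 h5

end Law

end BatchQueue

/-! ### Service batches that always fit are constant -/

namespace BatchQueue

open scoped ENNReal Topology
open Filter

section Resampling

variable {ι : Type*} [DecidableEq ι] {L : ι → Measure ℝ} [∀ i, IsProbabilityMeasure (L i)]

lemma ae_resample (p : ι) {A : (ι → ℝ) → Prop} (h : ∀ᵐ v ∂Measure.infinitePi L, A v) :
    ∀ᵐ v ∂Measure.infinitePi L, ∀ᵐ z ∂L p, A (Function.update v p z) := by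
  rw [← map_update_infinitePi (L := L) p] at h
  exact Measure.ae_ae_of_ae_prod (ae_of_ae_map (measurable_update_prod p).aemeasurable h)

lemma ae_of_ae_resample (p : ι) {E : Set (ι → ℝ)} (hE : MeasurableSet E)
    (h : ∀ᵐ v ∂Measure.infinitePi L, ∀ᵐ z ∂L p, Function.update v p z ∉ E) :
    Measure.infinitePi L E = 0 := by
  rw [← lintegral_indicator_one hE, lintegral_resample p (measurable_one.indicator hE)]
  rw [← lintegral_zero (μ := Measure.infinitePi L)]
  refine lintegral_congr_ae ?_
  filter_upwards [h] with v hv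
  rw [← lintegral_zero (μ := L p)]
  refine lintegral_congr_ae ?_
  filter_upwards [hv] with z hz
  simp [hz]

end Resampling

variable {F : Set ℝ} {v : Inp}

/-- The mass removed by the first `e` services when all service batches fit. -/
noncomputable def srvMass (v : Inp) (e : ℕ) : ℝ := ∑ i ∈ Finset.range e, v (3, i)

lemma srvMass_succ (v : Inp) (e : ℕ) : srvMass v (e + 1) = srvMass v e + v (3, e) :=
  Finset.sum_range_succ _ _

lemma measurable_srvMass (e : ℕ) : Measurable fun v => srvMass v e := by
  unfold srvMass; fun_prop

lemma Good.srvMass_mono (h : Good v) : Monotone (srvMass v) :=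
  monotone_nat_of_le_succ fun i => by rw [srvMass_succ]; linarith [h.Y_pos i]

lemma srvMass_update (v : Inp) {e k : ℕ} (h : e ≤ k) (z : ℝ) :
    srvMass (Function.update v (3, k) z) e = srvMass v e :=
  Finset.sum_congr rfl fun i hi => Function.update_of_ne (by
    have := Finset.mem_range.1 hi
    simp only [ne_eq, Prod.mk.injEq, true_and]; omega) _ _

/-- The starting batch is served without interruption before the next arrival. -/
lemma Good.sys_of_pause (hv : Good v) (h0 : v (1, 0) ∈ F) {e : ℕ} (hS : srvMass v e < v (1, 0))
    (hτ : srvTime v e < arrTime v 1) {k : ℕ} (hk : k ≤ e) :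
    sys F v k = ⟨1, k, v (1, 0) - srvMass v k, v (1, 0) - srvMass v k, 0, true⟩ := by
  induction k with
  | zero => rw [sys_zero_of_mem h0]; simp [srvMass]
  | succ k ih =>
    have ih := ih (by omega)
    have h1 : sys F v (k + 1) = next F v (sys F v k) := rfl
    have h2 := hv.srvMass_mono hk
    have h3 := hv.srvTime_mono hk
    rw [srvMass_succ] at h2
    have hY := hv.Y_pos k
    rw [h1, ih]
    simp only [next]
    rw [if_neg (by linarith), if_neg (by linarith), min_eq_left (by linarith), srvMass_succ]
    simp only [Sys.mk.injEq, true_and, and_true]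
    constructor <;> ring

lemma measurableSet_nat_mul (d : ℝ) : MeasurableSet {x : ℝ | ∃ k : ℕ, x = k * d} := by
  have : {x : ℝ | ∃ k : ℕ, x = k * d} = Set.range fun k : ℕ => (k : ℝ) * d := by
    ext; simp [eq_comm]
  rw [this]
  exact (Set.countable_range _).measurableSet

section Law

variable {L : Fin 4 → Measure ℝ} [∀ k, IsProbabilityMeasure (L k)]

/-- Service batches that always fit fit into the starting batch. -/
lemma ae_srvMass_le (hL : PosLaw L) (hτ : ∀ t, L 0 (Set.Ioi t) ≠ 0)
    (h : ∀ n : ℝ, 0 < n → ∀ᵐ v ∂inputLaw L, ∀ e, Starts (Set.Iic n) v e →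
      v (3, (sys (Set.Iic n) v e).served) ≤ (sys (Set.Iic n) v e).work) :
    ∀ᵐ v ∂inputLaw L, ∀ e, srvMass v e < v (1, 0) → srvMass v (e + 1) ≤ v (1, 0) := by
  obtain ⟨C, hC, hC'⟩ := exists_Iic_ne_zero (L 2)
  -- The event that service batch `e` overshoots the starting batch involves only masses. It is thus
  -- independent of the box where the first interarrival time exceeds `e * C` and the first `e`
  -- services take at most `C` each. On the box the starting batch is served alone, so the overshoot
  -- contradicts `h` at capacity `n + 1`; the box has positive probability, so the overshoot itself
  -- is null.
  have main : ∀ (n : ℕ) (e : ℕ), inputLaw L ({v | srvMass v e < v (1, 0)} ∩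
      ({v | v (1, 0) < srvMass v (e + 1)} ∩ {v | v (1, 0) ≤ n + 1})) = 0 := by
    intro n e
    set E : Set Inp := {v | srvMass v e < v (1, 0)} ∩
      ({v | v (1, 0) < srvMass v (e + 1)} ∩ {v | v (1, 0) ≤ n + 1}) with hEdef
    have hE : MeasurableSet E :=
      (measurableSet_lt (measurable_srvMass e) (measurable_pi_apply _)).inter
        ((measurableSet_lt (measurable_pi_apply _) (measurable_srvMass _)).inter
          (measurableSet_le (measurable_pi_apply _) measurable_const))
    set S : Finset (Fin 4 × ℕ) := insert (0, 0) ((Finset.range e).image fun i => (2, i)) with hS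
    set B : Fin 4 × ℕ → Set ℝ := fun p => if p.1 = 0 then Set.Ioi (e * C) else Set.Iic C with hB
    have hbox := infinitePi_inter_box (L := fun p : Fin 4 × ℕ => L p.1) S hE (B := B)
      (fun p => by simp only [hB]; split_ifs <;> measurability) (by
        intro v v' hvv
        have e1 : v (1, 0) = v' (1, 0) := hvv _ (by simp [hS])
        have e2 : ∀ k, srvMass v k = srvMass v' k := fun k =>
          Finset.sum_congr rfl fun i _ => hvv _ (by simp [hS])
        simp only [hEdef, Set.mem_inter_iff, Set.mem_ofPred_eq, e1, e2])
    have hzero : inputLaw L (E ∩ {v | ∀ i ∈ S, v i ∈ B i}) = 0 := by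
      refine measure_mono_null_ae (t := ∅) ?_ measure_empty
      filter_upwards [hL.ae_good, h (n + 1) (by positivity)] with v hv hfit hvE
      obtain ⟨⟨h1, h2, h3⟩, h4⟩ := hvE
      have hτ0 : e * C < v (0, 0) := h4 (0, 0) (Finset.mem_insert_self _ _)
      have hχ : ∀ i ∈ Finset.range e, v (2, i) ≤ C := fun i hi =>
        h4 (2, i) (Finset.mem_insert_of_mem (Finset.mem_image_of_mem _ hi))
      have hT : srvTime v e ≤ e * C := by
        simpa [srvTime] using Finset.sum_le_card_nsmul _ _ _ hχ
      have hs := hv.sys_of_pause (F := Set.Iic ((n : ℝ) + 1)) (show v (1, 0) ∈ _ from h3) h1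
        (by rw [arrTime_succ]; simp [arrTime]; linarith) le_rfl
      have h5 := hfit e (by
        rw [Starts, hs]
        exact ⟨by dsimp only; simp only [Set.mem_ofPred_eq] at h1; linarith, rfl⟩)
      rw [hs] at h5
      dsimp only at h5
      simp only [Set.mem_ofPred_eq, srvMass_succ] at h2
      exact absurd h5 (by linarith)
    rw [hzero] at hbox
    refine (mul_eq_zero.1 hbox.symm).resolve_right (Finset.prod_ne_zero_iff.2 fun p hp => ?_)
    rcases Finset.mem_insert.1 hp with rfl | hp
    · simpa [hB] using hτ _
    · obtain ⟨i, -, rfl⟩ := Finset.mem_image.1 hp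
      simpa [hB] using hC'
  have h2 : ∀ᵐ v ∂inputLaw L, ∀ n e : ℕ, ¬ (srvMass v e < v (1, 0) ∧ v (1, 0) < srvMass v (e + 1) ∧
      v (1, 0) ≤ n + 1) := by
    refine ae_all_iff.2 fun n => ae_all_iff.2 fun e => ?_
    have := main n e
    rw [measure_eq_zero_iff_ae_notMem] at this
    exact this
  filter_upwards [h2] with v hv e he
  by_contra hlt
  obtain ⟨n, hn⟩ := exists_nat_ge (v (1, 0))
  exact hv n e ⟨he, not_le.1 hlt, by linarith⟩

/-- Otherwise the partial sums of service batches would stay below the starting batch for ever. But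
with positive probability the starting batch is at most `B` and the first `K` service batches, each
at least `δ`, add up to at least `B`. -/
lemma exists_srvMass_eq (hL : PosLaw L)
    (h : ∀ᵐ v ∂inputLaw L, ∀ e, srvMass v e < v (1, 0) → srvMass v (e + 1) ≤ v (1, 0)) :
    ∃ e, inputLaw L {v | srvMass v e < v (1, 0) ∧ srvMass v (e + 1) = v (1, 0)} ≠ 0 := by
  by_contra! hall
  have h1 : ∀ᵐ v ∂inputLaw L, ∀ e, ¬ (srvMass v e < v (1, 0) ∧ srvMass v (e + 1) = v (1, 0)) :=
    ae_all_iff.2 fun e => by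
      have := hall e
      rw [measure_eq_zero_iff_ae_notMem] at this
      exact this
  have h2 : ∀ᵐ v ∂inputLaw L, ∀ e, srvMass v e < v (1, 0) := by
    filter_upwards [h, h1, hL.ae_good] with v hv hv1 hg e
    induction e with
    | zero => simpa [srvMass] using hg.X_pos 0
    | succ e ih => exact lt_of_le_of_ne (hv e ih) fun heq => hv1 e ⟨ih, heq⟩
  obtain ⟨B, -, hB'⟩ := exists_Iic_ne_zero (L 1)
  obtain ⟨δ, hδ, hδ'⟩ := exists_Ici_ne_zero hL.Y_pos
  obtain ⟨K, hK⟩ := exists_nat_ge (B / δ)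
  rw [div_le_iff₀ hδ] at hK
  set S : Finset (Fin 4 × ℕ) := insert (1, 0) ((Finset.range K).image fun i => (3, i)) with hS
  set W : Fin 4 × ℕ → Set ℝ := fun p => if p.1 = 1 then Set.Iic B else Set.Ici δ with hW
  have hbox := infinitePi_inter_box (L := fun p : Fin 4 × ℕ => L p.1) S MeasurableSet.univ (B := W)
      (fun p => by simp only [hW]; split_ifs <;> measurability) (by simp)
  have hzero : inputLaw L (Set.univ ∩ {v | ∀ i ∈ S, v i ∈ W i}) = 0 := by
    refine measure_mono_null_ae (t := ∅) ?_ measure_empty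
    filter_upwards [h2] with v hv hvE
    have hX : v (1, 0) ≤ B := hvE.2 (1, 0) (Finset.mem_insert_self _ _)
    have hY : ∀ i ∈ Finset.range K, δ ≤ v (3, i) := fun i hi =>
      hvE.2 (3, i) (Finset.mem_insert_of_mem (Finset.mem_image_of_mem _ hi))
    have hT : K * δ ≤ srvMass v K := by
      simpa [srvMass] using Finset.card_nsmul_le_sum _ _ _ hY
    exact absurd (hv K) (by linarith)
  rw [hzero, measure_univ, one_mul] at hbox
  refine (Finset.prod_ne_zero_iff.2 fun p hp => ?_) hbox.symm
  rcases Finset.mem_insert.1 hp with rfl | hp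
  · simpa [hW] using hB'
  · obtain ⟨i, -, rfl⟩ := Finset.mem_image.1 hp
    simpa [hW] using hδ'

/-- If the service batches always fit, they are constant. -/
lemma exists_ae_eq_of_fit (hL : PosLaw L)
    (h : ∀ᵐ v ∂inputLaw L, ∀ e, srvMass v e < v (1, 0) → srvMass v (e + 1) ≤ v (1, 0)) :
    ∃ d : ℝ, 0 < d ∧ ∀ᵐ y ∂L 3, y = d := by
  obtain ⟨e, he⟩ := exists_srvMass_eq hL h
  have h1 := ae_resample (L := fun p : Fin 4 × ℕ => L p.1) (3, e)
    (ae_resample (L := fun p : Fin 4 × ℕ => L p.1) (3, e + 1) h)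
  have h2 : ∃ᶠ v in ae (inputLaw L), ¬ ∀ᵐ z ∂L 3, Function.update v (3, e) z ∉
      {v | srvMass v e < v (1, 0) ∧ srvMass v (e + 1) = v (1, 0)} := fun h3 =>
    he (ae_of_ae_resample (L := fun p : Fin 4 × ℕ => L p.1) (3, e)
      ((measurableSet_lt (measurable_srvMass e) (measurable_pi_apply _)).inter
        (measurableSet_eq_fun (measurable_srvMass _) (measurable_pi_apply _)))
      (by simpa only [not_not] using h3))
  obtain ⟨v, h3, h4⟩ := (h2.and_eventually h1).exists
  have u1 : ∀ z, srvMass (Function.update v (3, e) z) e = srvMass v e :=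
    srvMass_update v le_rfl
  have u2 : ∀ z, Function.update v (3, e) z (1, 0) = v (1, 0) := fun z =>
    Function.update_of_ne (by simp) _ _
  simp only [Set.mem_ofPred_eq, srvMass_succ, u1, u2, Function.update_self] at h3
  have hZ : srvMass v e < v (1, 0) := by
    by_contra hn
    exact h3 (Eventually.of_forall fun z hz => hn hz.1)
  -- With all inputs but service batch `e` fixed, the remaining mass `v (1, 0) - srvMass v e` is hit
  -- exactly with positive probability. It is therefore an atom of the law of service batches and
  -- has every almost sure property of that law.
  have hatom : ∀ q : ℝ → Prop, (∀ᵐ y ∂L 3, q y) → q (v (1, 0) - srvMass v e) := by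
    intro q hq
    by_contra hn
    refine h3 ?_
    filter_upwards [hq] with z hz hz'
    exact hn (by rwa [show v (1, 0) - srvMass v e = z by linarith [hz'.2]])
  refine ⟨v (1, 0) - srvMass v e, by linarith, ?_⟩
  filter_upwards [h4, hL.Y_pos] with y hy hpos
  have w1 : ∀ z, srvMass (Function.update (Function.update v (3, e) y) (3, e + 1) z) e =
      srvMass v e := fun z => by rw [srvMass_update _ (Nat.le_succ e), u1]
  have w2 : ∀ z, srvMass (Function.update (Function.update v (3, e) y) (3, e + 1) z) (e + 1) =
      srvMass v e + y := fun z => by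
    rw [srvMass_update _ le_rfl, srvMass_succ, u1, Function.update_self]
  have w3 : ∀ z, Function.update (Function.update v (3, e) y) (3, e + 1) z (1, 0) = v (1, 0) :=
    fun z => by rw [Function.update_of_ne (by simp), u2]
  obtain ⟨y', hy'⟩ := hy.exists
  have k1 := hy' e
  rw [w1, w2, w3] at k1
  -- Fitting at `e` bounds `y` by the atom. If `y` were smaller, some mass less than the atom would
  -- remain, and a next service batch equal to the atom would not fit.
  refine le_antisymm (by linarith [k1 hZ]) (not_lt.1 fun hlt => ?_)
  have k2 := hatom (fun z => srvMass v e + y < v (1, 0) → srvMass v e + y + z ≤ v (1, 0)) (by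
    filter_upwards [hy] with z hz
    have := hz (e + 1)
    rwa [srvMass_succ _ (e + 1), w2, w3, Function.update_self] at this)
  have := k2 (by linarith)
  linarith

/-- For the last `k` with `k * d` below the starting batch, fitting gives that `(k + 1) * d` does
not exceed it, and the choice of `k` gives the reverse inequality. -/
lemma ae_exists_nat_mul_of_fit (hL : PosLaw L)
    (h : ∀ᵐ v ∂inputLaw L, ∀ e, srvMass v e < v (1, 0) → srvMass v (e + 1) ≤ v (1, 0))
    {d : ℝ} (hd : 0 < d) (hY : ∀ᵐ y ∂L 3, y = d) : ∀ᵐ x ∂L 1, ∃ k : ℕ, x = k * d := by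
  classical
  have key : (inputLaw L).map (fun v : Inp => v (1, 0)) = L 1 :=
    (measurePreserving_eval_infinitePi (fun p : Fin 4 × ℕ => L p.1) (1, 0)).map_eq
  rw [← key]
  have hproj : Measurable fun v : Inp => v (1, 0) := measurable_pi_apply _
  refine (ae_map_iff hproj.aemeasurable (measurableSet_nat_mul d)).2 ?_
  filter_upwards [h, hL.ae_good, ae_all_iff.2 fun i => ae_coord hY i] with v hv hg hYv
  have hs : ∀ e, srvMass v e = e * d := fun e => by simp [srvMass, hYv]
  have hex : ∃ k : ℕ, v (1, 0) ≤ k * d := by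
    obtain ⟨k, hk⟩ := exists_nat_ge (v (1, 0) / d)
    exact ⟨k, (div_le_iff₀ hd).1 hk⟩
  obtain ⟨k, hk⟩ := Nat.exists_eq_succ_of_ne_zero (show Nat.find hex ≠ 0 from fun h0 => by
    have := Nat.find_spec hex
    rw [h0] at this
    have := hg.X_pos 0
    simp at *; linarith)
  have h1 := Nat.find_spec hex
  have h2 := Nat.find_min hex (show k < Nat.find hex by omega)
  have h3 := hv k
  rw [hs, hs] at h3
  rw [hk] at h1
  exact ⟨k + 1, le_antisymm h1 (h3 (not_le.1 h2))⟩

end Law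

end BatchQueue

/-! ### A busy period with a prescribed number of services; small interarrival times and least
batches -/

namespace BatchQueue

open scoped ENNReal Topology
open Filter

variable {F : Set ℝ} {v : Inp}

/-- Batches of the smallest size `l d` that arrive during the first `l` services fill the system of
capacity `K l d`; when the next batch comes late, the busy period consists of `K l` services. -/
lemma Good.exists_EndsAt (hv : Good v) {d : ℝ} (hd : 0 < d) {K l k : ℕ} (hK : 0 < K) (hl : 0 < l)
    (hKk : K ≤ k + 1) (hY : ∀ i, v (3, i) = d) (hX : ∀ i < K, v (1, i) = l * d)
    (hX' : ∀ i, l * d ≤ v (1, i)) (h1 : arrTime v k < srvTime v l)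
    (h2 : srvTime v (K * l) < arrTime v (k + 1)) {H : ℕ}
    (hH : (sys (Set.Iic (K * l * d)) v H).content = 0) :
    ∃ e, EndsAt (Set.Iic (K * l * d)) v (e, k, K * l - 1) := by
  have hK' : (1 : ℝ) ≤ K := by exact_mod_cast hK
  have hl' : (1 : ℝ) ≤ l := by exact_mod_cast hl
  have h0 : v (1, 0) ∈ Set.Iic (K * l * d) := by
    rw [hX 0 hK, Set.mem_Iic, mul_assoc]
    exact le_mul_of_one_le_left (by positivity) hK'
  set F : Set ℝ := Set.Iic (K * l * d) with hF
  -- Exactly the first `K` batches are admitted, each of mass `l * d`, and every completion removes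
  -- `d`.
  have inv : ∀ e, (sys F v e).arr ≤ k + 1 ∧
      (sys F v e).content = ((l * min (sys F v e).arr K : ℕ) - (sys F v e).served) * d ∧
      ∃ w : ℕ, (sys F v e).work = w * d := by
    intro e
    induction e with
    | zero =>
      rw [sys_zero_of_mem h0, hX 0 hK]
      refine ⟨by dsimp only; omega, ?_, l, rfl⟩
      simp [Nat.min_eq_left (show 1 ≤ K from hK)]
    | succ e ih =>
      obtain ⟨i1, i2, w, i3⟩ := ih
      have hT := (hv.time_inv F e).2.1
      have hpos := (hv.sys_inv F e).2.2.2.2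
      have hnn := hv.content_nonneg F (e + 1)
      -- Arrivals occur only before the end of the first `l` services: batches up to `k` come
      -- earlier by `h1`, and the next one comes after all `K * l` services by `h2`.
      have early : (sys F v e).content ≠ 0 →
          arrTime v (sys F v e).arr ≤ srvTime v ((sys F v e).served + 1) →
          (sys F v e).arr ≤ k ∧ (sys F v e).served < l := by
        intro hc ha
        have hak : (sys F v e).arr ≤ k := by
          by_contra hn
          have hk1 : (sys F v e).arr = k + 1 := by omega
          have hs : (sys F v e).served < K * l := by
            have h3 := lt_of_le_of_ne (hv.content_nonneg F e) hc.symm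
            rw [i2, hk1, Nat.min_eq_right hKk] at h3
            have h4 := (pos_iff_pos_of_mul_pos h3).2 hd
            have h5 : ((sys F v e).served : ℝ) < (l * K : ℕ) := by linarith
            rw [mul_comm]; exact_mod_cast h5
          rw [hk1] at ha
          linarith [hv.srvTime_mono (show (sys F v e).served + 1 ≤ K * l from hs)]
        refine ⟨hak, ?_⟩
        by_contra hn
        linarith [hv.srvTime_mono (not_lt.1 hn), hv.arrTime_mono hak]
      rcases sys_succ_cases F v e with
        ⟨hc, h'⟩ | ⟨hc, ha, hmem, h'⟩ | ⟨hc, ha, hmem, h'⟩ | ⟨hc, ha, h'⟩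
      · rw [h']; exact ⟨i1, i2, w, i3⟩
      · obtain ⟨hak, hsl⟩ := early hc ha
        -- After `K` admitted batches and fewer than `l` completions, the free capacity is less than
        -- `l * d`, the least size of a batch, so nothing more is admitted.
        have hlt : (sys F v e).arr < K := by
          by_contra hn
          rw [hF, Set.mem_Iic, i2, Nat.min_eq_right (not_lt.1 hn)] at hmem
          have h3 : ((sys F v e).served : ℝ) * d < l * d :=
            mul_lt_mul_of_pos_right (by exact_mod_cast hsl) hd
          have h4 := hX' (sys F v e).arr
          push_cast at hmem
          linarith
        rw [h']
        refine ⟨by dsimp only; omega, ?_, w, i3⟩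
        dsimp only
        rw [i2, hX _ hlt, Nat.min_eq_left hlt.le, Nat.min_eq_left (show _ + 1 ≤ K from hlt)]
        push_cast
        ring
      · obtain ⟨hak, hsl⟩ := early hc ha
        have hge : K ≤ (sys F v e).arr := by
          by_contra hn
          push Not at hn
          refine hmem ?_
          rw [hF, Set.mem_Iic, i2, hX _ hn, Nat.min_eq_left hn.le]
          have h3 : ((sys F v e).arr + 1 : ℝ) * (l * d) ≤ K * (l * d) :=
            mul_le_mul_of_nonneg_right (by exact_mod_cast hn) (by positivity)
          have h4 : 0 ≤ ((sys F v e).served : ℝ) * d := by positivity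
          push_cast
          linarith
        rw [h']
        refine ⟨by dsimp only; omega, ?_, w, i3⟩
        dsimp only
        rw [i2, Nat.min_eq_right hge, Nat.min_eq_right (by omega)]
      · have hw : (1 : ℝ) ≤ w := by
          have h3 := hpos hc
          rw [i3] at h3
          have := (pos_iff_pos_of_mul_pos h3).2 hd
          exact_mod_cast this
        have hmin : min (v (3, (sys F v e).served)) (sys F v e).work = d := by
          rw [hY, i3]
          exact min_eq_left (le_mul_of_one_le_left hd.le hw)
        rw [h'] at hnn ⊢
        rw [hmin, i2] at hnn ⊢
        dsimp only at hnn ⊢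
        have hexp : ((l * min (sys F v e).arr K : ℕ) - ((sys F v e).served : ℝ)) * d - d =
            ((l * min (sys F v e).arr K : ℕ) - ((sys F v e).served + 1 : ℕ)) * d := by
          push_cast; ring
        rw [hexp] at hnn ⊢
        refine ⟨i1, rfl, l * min (sys F v e).arr K - ((sys F v e).served + 1), ?_⟩
        rw [Nat.cast_sub]
        have := nonneg_of_mul_nonneg_left hnn hd
        have h3 : (((sys F v e).served + 1 : ℕ) : ℝ) ≤ (l * min (sys F v e).arr K : ℕ) := by
          linarith
        exact_mod_cast h3
  obtain ⟨e, he⟩ := exists_Ends (hv.content_zero_ne_zero_iff.2 h0) hH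
  obtain ⟨i1, -⟩ := inv e
  obtain ⟨-, i2, -⟩ := inv (e + 1)
  obtain ⟨h3, h4⟩ := hv.Ends_cases he
  rw [he.2, h4] at i2
  dsimp only at i2
  have h5 : (l * min (sys F v e).arr K : ℕ) = (sys F v e).served + 1 := by
    have h6 := (mul_eq_zero.1 i2.symm).resolve_right hd.ne'
    have h7 : ((l * min (sys F v e).arr K : ℕ) : ℝ) = ((sys F v e).served + 1 : ℕ) := by linarith
    exact_mod_cast h7
  have hk1 : (sys F v e).arr = k + 1 := by
    by_contra hn
    have h6 : l ≤ (sys F v e).served + 1 := by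
      rw [← h5]
      exact Nat.le_mul_of_pos_right l (lt_min (one_le_arr F v e) hK)
    linarith [hv.srvTime_mono h6, hv.arrTime_mono (show (sys F v e).arr ≤ k by omega)]
  refine ⟨e, he, hk1, ?_⟩
  rw [hk1, Nat.min_eq_right hKk] at h5
  dsimp only
  rw [mul_comm K l, h5, Nat.add_sub_cancel]

/-- A set of positive measure contains a point of the support. -/
lemma exists_forall_Ioo_ne_zero {ν : Measure ℝ} {s : Set ℝ} (hs : ν s ≠ 0) :
    ∃ x ∈ s, ∀ r, 0 < r → ν (Set.Ioo (x - r) (x + r)) ≠ 0 := by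
  obtain ⟨x, hx, h⟩ := exists_mem_forall_mem_nhdsWithin_pos_measure hs
  exact ⟨x, hx, fun r hr => (h _ (mem_nhdsWithin_of_mem_nhds
    (Ioo_mem_nhds (by linarith) (by linarith)))).ne'⟩

/-- NWUE laws charge every right neighbourhood of `0`. -/
lemma NWUELaw.Ioo_ne_zero {ν : Measure ℝ} [IsProbabilityMeasure ν] (h : NWUELaw ν)
    (hpos : ∀ᵐ z ∂ν, 0 < z) (hm : mean ν ≠ ⊤) {ε : ℝ} (hε : 0 < ε) : ν (Set.Ioo 0 ε) ≠ 0 := by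
  intro h0
  have h1 : ∀ᵐ z ∂ν, ε ≤ z := by
    filter_upwards [hpos, measure_eq_zero_iff_ae_notMem.1 h0] with z hz hz'
    exact not_lt.1 fun hlt => hz' ⟨hz, hlt⟩
  have h2 : ν (Set.Ioi (ε / 2)) = 1 := by
    rw [← prob_compl_eq_zero_iff measurableSet_Ioi, measure_eq_zero_iff_ae_notMem]
    filter_upwards [h1] with z hz hz'
    simp only [Set.mem_compl_iff, Set.mem_Ioi] at hz'
    linarith
  -- If the law lived on `[ε, ∞)`, the level `ε / 2` would be exceeded almost surely, with mean
  -- excess only `mean ν - ε / 2`, against NWUE.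
  have h3 : excess ν (ε / 2) + ENNReal.ofReal (ε / 2) = mean ν := by
    have h4 : ENNReal.ofReal (ε / 2) = ∫⁻ _, ENNReal.ofReal (ε / 2) ∂ν := by simp
    rw [h4, excess, mean, ← lintegral_add_right _ measurable_const]
    refine lintegral_congr_ae ?_
    filter_upwards [h1] with z hz
    rw [← ENNReal.ofReal_add (by linarith) (by linarith), sub_add_cancel]
  have h5 := h (ε / 2) (by linarith)
  rw [h2, mul_one] at h5
  have h6 : mean ν + ENNReal.ofReal (ε / 2) ≤ mean ν + 0 := by
    rw [add_zero]; exact (add_le_add_left h5 _).trans h3.le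
  have h7 := (ENNReal.add_le_add_iff_left hm).1 h6
  simp at h7
  linarith

lemma excess_le_add (ν : Measure ℝ) [IsProbabilityMeasure ν] {x y ε : ℝ}
    (h : x ≤ y + ε) : excess ν y ≤ excess ν x + ENNReal.ofReal ε := by
  have h4 : ENNReal.ofReal ε = ∫⁻ _, ENNReal.ofReal ε ∂ν := by simp
  rw [h4, excess, excess, ← lintegral_add_right _ measurable_const]
  refine lintegral_mono fun z => ?_
  refine le_trans (ENNReal.ofReal_le_ofReal ?_) ENNReal.ofReal_add_le
  linarith

section Law

variable {L : Fin 4 → Measure ℝ} [∀ k, IsProbabilityMeasure (L k)]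

lemma exists_mem_box (S : Finset (Fin 4 × ℕ)) {B : Fin 4 × ℕ → Set ℝ}
    (hB : ∀ p, MeasurableSet (B p)) (hpos : ∀ p ∈ S, L p.1 (B p) ≠ 0) {q : Inp → Prop}
    (hq : ∀ᵐ v ∂inputLaw L, q v) : ∃ v, q v ∧ ∀ p ∈ S, v p ∈ B p := by
  have hbox := infinitePi_inter_box (L := fun p : Fin 4 × ℕ => L p.1) S MeasurableSet.univ hB
    (by simp)
  rw [measure_univ, one_mul, Set.univ_inter] at hbox
  have h : ∃ᶠ v in ae (inputLaw L), v ∈ {v : Inp | ∀ p ∈ S, v p ∈ B p} :=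
    frequently_ae_mem_iff.2 (hbox ▸ Finset.prod_ne_zero_iff.2 hpos)
  obtain ⟨v, h1, h2⟩ := (h.and_eventually hq).exists
  exact ⟨v, h2, h1⟩

/-- A lattice law on the positive half-line has a smallest atom. -/
lemma exists_least_atom {ν : Measure ℝ} [IsProbabilityMeasure ν] (hpos : ∀ᵐ z ∂ν, 0 < z) {d : ℝ}
    (hd : 0 < d) (h : ∀ᵐ z ∂ν, ∃ k : ℕ, z = k * d) :
    ∃ l : ℕ, 0 < l ∧ ν {(l : ℝ) * d} ≠ 0 ∧ ∀ᵐ z ∂ν, l * d ≤ z := by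
  classical
  have hex : ∃ l : ℕ, ν {(l : ℝ) * d} ≠ 0 := by
    by_contra! h0
    have h1 : ∀ᵐ z ∂ν, ∀ k : ℕ, z ≠ k * d := ae_all_iff.2 fun k =>
      measure_eq_zero_iff_ae_notMem.1 (h0 k)
    obtain ⟨z, ⟨k, hk⟩, hz⟩ := (h.and h1).exists
    exact hz k hk
  refine ⟨Nat.find hex, Nat.pos_of_ne_zero fun h0 => ?_, Nat.find_spec hex, ?_⟩
  · have h1 := Nat.find_spec hex
    rw [h0] at h1
    refine h1 (measure_eq_zero_iff_ae_notMem.2 ?_)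
    filter_upwards [hpos] with z hz hz'
    simp at hz'
    linarith
  · have h1 : ∀ᵐ z ∂ν, ∀ k : ℕ, k < Nat.find hex → z ≠ k * d := ae_all_iff.2 fun k => by
      by_cases hk : k < Nat.find hex
      · filter_upwards [measure_eq_zero_iff_ae_notMem.1 (not_not.1 (Nat.find_min hex hk))]
          with z hz _ using hz
      · exact Eventually.of_forall fun z h2 => absurd h2 hk
    filter_upwards [h, h1] with z ⟨k, hk⟩ hz
    have : Nat.find hex ≤ k := not_lt.1 fun hlt => hz k hlt hk
    rw [hk]
    gcongr

end Law

end BatchQueue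

/-! ### Levels that occur are dense; constant mean residual life -/

namespace BatchQueue

open scoped ENNReal Topology
open Filter

section Law

variable {L : Fin 4 → Measure ℝ} [∀ k, IsProbabilityMeasure (L k)]

lemma abs_sum_sub_le {f : ℕ → ℝ} {c r : ℝ} {m : ℕ} (h : ∀ i < m, f i ∈ Set.Ioo (c - r) (c + r)) :
    |∑ i ∈ Finset.range m, f i - m * c| ≤ m * r := by
  have h1 := Finset.sum_le_card_nsmul (Finset.range m) f (c + r) fun i hi =>
    (h i (Finset.mem_range.1 hi)).2.le
  have h2 := Finset.card_nsmul_le_sum (Finset.range m) f (c - r) fun i hi =>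
    (h i (Finset.mem_range.1 hi)).1.le
  simp only [Finset.card_range, nsmul_eq_mul] at h1 h2
  rw [abs_le]
  constructor <;> linarith

/-- `K * c` is the first multiple of `c` beyond `y`, so its surplus over `y` is at most `c`. Nearly
all of the surplus is removed by `k` steps of a tiny length `t` satisfying `P`. The margins `η / 4`
leave room for random sums that only approximate `K * c` and `k * t`. -/
lemma exists_step_counts {c y ε : ℝ} (hc : 0 < c) (hy : 0 ≤ y) (hε : 0 < ε) {P : ℝ → Prop}
    (hP : ∀ η, 0 < η → ∃ t ∈ Set.Ioo 0 η, P t) :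
    ∃ K k : ℕ, ∃ t η : ℝ, 0 < K ∧ K ≤ k ∧ P t ∧ 0 < η ∧ k * t + η / 4 ≤ c ∧
      y + η / 4 ≤ K * c - k * t ∧ K * c - k * t + η / 4 ≤ y + ε := by
  obtain ⟨K, hK, hy1, hy2⟩ : ∃ K : ℕ, 0 < K ∧ (K - 1 : ℝ) * c ≤ y ∧ y < K * c := by
    refine ⟨⌊y / c⌋₊ + 1, Nat.succ_pos _, ?_, ?_⟩
    · rw [← le_div_iff₀ hc]; push_cast
      rw [add_sub_cancel_right]
      exact Nat.floor_le (by positivity)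
    · rw [← div_lt_iff₀ hc]; push_cast
      exact Nat.lt_floor_add_one _
  obtain ⟨η, hη0, hηε, hηu⟩ : ∃ η, 0 < η ∧ η ≤ ε ∧ η ≤ K * c - y :=
    ⟨_, lt_min hε (sub_pos.2 hy2), min_le_left _ _, min_le_right _ _⟩
  obtain ⟨t, ⟨ht0, ht1⟩, ht⟩ := hP (η / (4 * (K + 1))) (by positivity)
  rw [lt_div_iff₀ (by positivity)] at ht1
  have hKt : 0 ≤ K * t := by positivity
  have hk1 := Nat.floor_le (div_nonneg (show 0 ≤ K * c - y - η / 4 by linarith) ht0.le)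
  have hk2 := Nat.lt_floor_add_one ((K * c - y - η / 4) / t)
  rw [le_div_iff₀ ht0] at hk1
  rw [div_lt_iff₀ ht0] at hk2
  refine ⟨K, ⌊(K * c - y - η / 4) / t⌋₊, t, η, hK, Nat.le_floor ?_, ht, hη0, ?_, ?_, ?_⟩
  · rw [le_div_iff₀ ht0]; linarith
  all_goals linarith

lemma exists_mem_rows {k m m' : ℕ} {A T C D : Set ℝ} (hA : L 0 A ≠ 0) (hT : L 0 T ≠ 0)
    (hC : L 2 C ≠ 0) (hD : L 1 D ≠ 0) (mA : MeasurableSet A) (mT : MeasurableSet T)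
    (mC : MeasurableSet C) (mD : MeasurableSet D) {q : Inp → Prop} (hq : ∀ᵐ v ∂inputLaw L, q v) :
    ∃ v, q v ∧ (∀ i < k, v (0, i) ∈ T) ∧ v (0, k) ∈ A ∧ (∀ i < m, v (2, i) ∈ C) ∧
      ∀ i < m', v (1, i) ∈ D := by
  obtain ⟨v, hv, hvB⟩ := exists_mem_box
    ((Finset.range (k + 1)).image (fun i => ((0 : Fin 4), i)) ∪
      ((Finset.range m).image (fun i => ((2 : Fin 4), i)) ∪
        (Finset.range m').image (fun i => ((1 : Fin 4), i))))
    (B := fun p => if p.1 = 0 then (if p.2 = k then A else T) else if p.1 = 2 then C else D)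
    (fun p => by split_ifs <;> assumption) (fun p hp => by
      rw [Finset.mem_union, Finset.mem_union] at hp
      rcases hp with hp | hp | hp
      · obtain ⟨i, -, rfl⟩ := Finset.mem_image.1 hp
        simp only [if_true]
        split_ifs
        exacts [hA, hT]
      · obtain ⟨i, -, rfl⟩ := Finset.mem_image.1 hp
        simpa using hC
      · obtain ⟨i, -, rfl⟩ := Finset.mem_image.1 hp
        simpa using hD) hq
  refine ⟨v, hv, fun i hi => ?_, ?_, fun i hi => ?_, fun i hi => ?_⟩
  · have := hvB (0, i) (Finset.mem_union_left _
      (Finset.mem_image_of_mem _ (Finset.mem_range.2 (by omega))))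
    simpa only [if_true, if_neg hi.ne] using this
  · have := hvB (0, k) (Finset.mem_union_left _
      (Finset.mem_image_of_mem _ (Finset.mem_range.2 (by omega))))
    simpa only [if_true] using this
  · have := hvB (2, i) (Finset.mem_union_right _ (Finset.mem_union_left _
      (Finset.mem_image_of_mem _ (Finset.mem_range.2 hi))))
    simpa using this
  · have := hvB (1, i) (Finset.mem_union_right _ (Finset.mem_union_right _
      (Finset.mem_image_of_mem _ (Finset.mem_range.2 hi))))
    simpa using this

/-- The times from the last arrival in a busy period to its end are dense among those at which the
interarrival law looks memoryless. -/
lemma exists_excess_eq (hL : PosLaw L) (hN : NWUELaw (L 0)) (hτ : ∀ t, L 0 (Set.Ioi t) ≠ 0)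
    (ha : mean (L 0) ≠ ⊤) (hχ : L 2 (Set.Ioi 0) ≠ 0) {d : ℝ} (hd : 0 < d)
    (hY : ∀ᵐ y ∂L 3, y = d) (hX : ∀ᵐ x ∂L 1, ∃ k : ℕ, x = k * d)
    (hend : ∀ n : ℝ, 0 < n → ∀ᵐ v ∂inputLaw L, ∃ H, (sys (Set.Iic n) v H).content = 0)
    (heq : ∀ n : ℝ, 0 < n → ∫⁻ v, residual (Set.Iic n) v ∂inputLaw L =
        mean (L 0) * inputLaw L {v | (sys (Set.Iic n) v 0).content ≠ 0})
    {y ε : ℝ} (hy : 0 ≤ y) (hε : 0 < ε) :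
    ∃ x ∈ Set.Ioo y (y + ε), excess (L 0) x = mean (L 0) * L 0 (Set.Ioi x) := by
  obtain ⟨l, hl, hl1, hl2⟩ := exists_least_atom hL.X_pos hd hX
  obtain ⟨c, hc, hc'⟩ := exists_forall_Ioo_ne_zero hχ
  have hc : 0 < c := hc
  have hlr : (1 : ℝ) ≤ l := by exact_mod_cast hl
  have hlc : 0 < l * c := by positivity
  obtain ⟨K, k, t, η, hK, hKk, ht', hη0, hk1, hx1, hx2⟩ := exists_step_counts hlc hy hε
    (P := fun t => ∀ r, 0 < r → L 0 (Set.Ioo (t - r) (t + r)) ≠ 0)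
    fun η hη => exists_forall_Ioo_ne_zero (hN.Ioo_ne_zero hL.τ_pos ha hη)
  have hK1 : (1 : ℝ) ≤ K := by exact_mod_cast hK
  -- With tolerance `r` for each of `K * l` service times and `k` interarrival times, the total
  -- error is at most `η / 8`, half of the margin.
  obtain ⟨r, hr0, hr1⟩ : ∃ r : ℝ, 0 < r ∧ K * l * r + k * r = η / 8 :=
    ⟨η / (8 * (K * l + k)), by positivity, by field_simp⟩
  have hKl : (l : ℝ) ≤ K * l := le_mul_of_one_le_left (by linarith) hK1
  have hlr1 : l * r ≤ K * l * r := by gcongr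
  have hn : 0 < (K : ℝ) * l * d := by positivity
  have hev : ∀ᵐ v ∂inputLaw L, Good v ∧ (∀ i, v (3, i) = d) ∧ (∀ i, l * d ≤ v (1, i)) ∧
      (∃ H, (sys (Set.Iic (K * l * d)) v H).content = 0) ∧
      ∀ s : ℕ × ℕ × ℕ, EndsAt (Set.Iic (K * l * d)) v s →
      excess (L 0) (srvTime v (s.2.2 + 1) - arrTime v s.2.1) =
        mean (L 0) * L 0 (Set.Ioi (srvTime v (s.2.2 + 1) - arrTime v s.2.1)) := by
    filter_upwards [hL.ae_good, ae_all_iff.2 fun i => ae_coord hY i,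
      ae_all_iff.2 fun i => ae_coord hl2 i, hend _ hn,
      ae_all_iff.2 fun s => ae_excess_eq hL hN ha measurableSet_Iic (hend _ hn) (heq _ hn).le s]
      with v h1 h2 h3 h4 h5
    exact ⟨h1, h2, h3, h4, h5⟩
  -- A path with `k` interarrival times near `t` followed by one that outlasts all services, `K * l`
  -- service times near `c`, and first `K` batches of least size. Its busy period ends at a time
  -- near `K * l * c - k * t` after the last arrival, within `(y, y + ε)`.
  obtain ⟨v, ⟨hv, hvY, hvX, ⟨H, hH⟩, hvE⟩, b0, bk, b2, b1⟩ := exists_mem_rows (k := k) (m := K * l)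
    (m' := K) (hτ (K * l * (c + r))) (ht' r hr0) (hc' r hr0) hl1 measurableSet_Ioi
    measurableSet_Ioo measurableSet_Ioo (measurableSet_singleton _) hev
  have a1 := abs_le.1 (abs_sum_sub_le b0)
  have a2 := abs_le.1 (abs_sum_sub_le b2)
  have a3 := abs_le.1 (abs_sum_sub_le (m := l) fun i hi =>
    b2 i (hi.trans_le (Nat.le_mul_of_pos_left l (by omega))))
  change _ ≤ arrTime v k - _ ∧ arrTime v k - _ ≤ _ at a1
  change _ ≤ srvTime v (K * l) - _ ∧ srvTime v (K * l) - _ ≤ _ at a2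
  change _ ≤ srvTime v l - _ ∧ srvTime v l - _ ≤ _ at a3
  push_cast at a2
  have hkr : 0 ≤ k * r := by positivity
  have hlr0 : 0 ≤ l * r := by positivity
  have hassoc : (K : ℝ) * l * c = K * (l * c) := by ring
  obtain ⟨e, he⟩ := hv.exists_EndsAt hd (hK) hl (show K ≤ k + 1 by omega) hvY b1
    hvX (by linarith) (by rw [arrTime_succ]; linarith [hv.arrTime_nonneg k, Set.mem_Ioi.1 bk]) hH
  have hx := hvE _ he
  dsimp only at hx
  rw [Nat.sub_add_cancel (show 1 ≤ K * l from Nat.mul_pos (by omega) hl)] at hx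
  exact ⟨_, ⟨by linarith, by linarith⟩, hx⟩

/-- Only levels slightly above `y` are at hand. The excess at `y` is larger than at such a level by
at most their distance, and the tail at that level is at most the tail at `y`; so no continuity of
the law is needed, and NWUE gives the other inequality. -/
lemma memoryless_of_residual_eq (hL : PosLaw L) (hN : NWUELaw (L 0))
    (hτ : ∀ t, L 0 (Set.Ioi t) ≠ 0)
    (ha : mean (L 0) ≠ ⊤) (hχ : L 2 (Set.Ioi 0) ≠ 0) {d : ℝ} (hd : 0 < d)
    (hY : ∀ᵐ y ∂L 3, y = d) (hX : ∀ᵐ x ∂L 1, ∃ k : ℕ, x = k * d)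
    (hend : ∀ n : ℝ, 0 < n → ∀ᵐ v ∂inputLaw L, ∃ H, (sys (Set.Iic n) v H).content = 0)
    (heq : ∀ n : ℝ, 0 < n → ∫⁻ v, residual (Set.Iic n) v ∂inputLaw L =
        mean (L 0) * inputLaw L {v | (sys (Set.Iic n) v 0).content ≠ 0}) {y : ℝ} (hy : 0 ≤ y) :
    excess (L 0) y = mean (L 0) * L 0 (Set.Ioi y) := by
  refine le_antisymm (ENNReal.le_of_forall_pos_le_add fun ε hε _ => ?_) (hN y hy)
  obtain ⟨x, ⟨hx1, hx2⟩, hx⟩ := exists_excess_eq hL hN hτ ha hχ hd hY hX hend heq hy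
    (show (0 : ℝ) < ε from hε)
  refine (excess_le_add (L 0) hx2.le).trans ?_
  rw [hx, ENNReal.ofReal_coe_nnreal]
  gcongr

end Law

end BatchQueue

/-! ### Constant mean residual life characterizes the exponential law -/

namespace BatchQueue

open scoped ENNReal Topology
open Filter

section Exponential

variable {ν : Measure ℝ} [IsProbabilityMeasure ν]

lemma real_Ioi_eq (ν : Measure ℝ) [IsProbabilityMeasure ν] (x : ℝ) :
    ν.real (Set.Ioi x) = 1 - cdf ν x := by
  rw [cdf_eq_real, ← Set.compl_Iic, probReal_compl_eq_one_sub measurableSet_Iic]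

lemma real_expMeasure_Ioi {r : ℝ} (hr : 0 < r) {x : ℝ} (hx : 0 ≤ x) :
    (expMeasure r).real (Set.Ioi x) = Real.exp (-(r * x)) := by
  have := isProbabilityMeasure_expMeasure hr
  rw [real_Ioi_eq, cdf_expMeasure_eq hr, if_pos hx, sub_sub_cancel]

/-- The memoryless property implies that the mean residual life is constant. -/
lemma excess_eq_of_Ioi_add (ν : Measure ℝ) {x : ℝ}
    (h : ∀ t, 0 < t → ν (Set.Ioi (x + t)) = ν (Set.Ioi x) * ν (Set.Ioi t)) :
    excess ν x = mean ν * ν (Set.Ioi x) := by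
  -- The layer cake formula: the excess is the integral of the tail beyond `y`.
  have key : ∀ y : ℝ, excess ν y = ∫⁻ t in Set.Ioi (0 : ℝ), ν (Set.Ioi (y + t)) := by
    intro y
    have h1 := lintegral_eq_lintegral_meas_lt ν (f := fun z => max (z - y) 0)
      (Eventually.of_forall fun z => le_max_right _ _) (by fun_prop)
    have h2 : excess ν y = ∫⁻ z, ENNReal.ofReal (max (z - y) 0) ∂ν :=
      lintegral_congr fun z => by
        rcases le_total (z - y) 0 with hz | hz
        · rw [max_eq_right hz, ENNReal.ofReal_of_nonpos hz, ENNReal.ofReal_zero]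
        · rw [max_eq_left hz]
    rw [h2, h1]
    refine setLIntegral_congr_fun measurableSet_Ioi fun t ht => ?_
    congr 1
    ext z
    rw [Set.mem_ofPred_eq, lt_max_iff, Set.mem_Ioi, lt_sub_iff_add_lt']
    exact or_iff_left (not_lt.2 (le_of_lt ht))
  have h0 : mean ν = excess ν 0 := by simp [mean, excess]
  have hm : Measurable fun t : ℝ => ν (Set.Ioi t) :=
    Antitone.measurable fun s t hst => measure_mono (Set.Ioi_subset_Ioi hst)
  rw [h0, key, key, mul_comm, ← lintegral_const_mul _ (by simpa using hm)]
  refine setLIntegral_congr_fun measurableSet_Ioi fun t ht => ?_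
  rw [h t ht, zero_add]

lemma excess_expMeasure {r : ℝ} (hr : 0 < r) {x : ℝ} (hx : 0 ≤ x) :
    excess (expMeasure r) x = mean (expMeasure r) * expMeasure r (Set.Ioi x) := by
  have := isProbabilityMeasure_expMeasure hr
  refine excess_eq_of_Ioi_add _ fun t ht => ?_
  have h : ∀ y, 0 ≤ y → expMeasure r (Set.Ioi y) = ENNReal.ofReal (Real.exp (-(r * y))) :=
    fun y hy => by rw [← real_expMeasure_Ioi hr hy, ofReal_measureReal]
  rw [h _ (by linarith), h _ hx, h _ ht.le, ← ENNReal.ofReal_mul (Real.exp_nonneg _),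
    ← Real.exp_add]
  congr 2
  ring

/-- Lowering the level from `x + h` to `x` raises the positive part of `z - x - h` by at most `h`,
by nothing unless `z > x`, and by exactly `h` when `z > x + h`. This is the integrated form of the
rule that the derivative of the excess is minus the tail. -/
lemma excess_le_excess_add (ν : Measure ℝ) (x : ℝ) {h : ℝ} (hh : 0 ≤ h) :
    excess ν x ≤ excess ν (x + h) + ENNReal.ofReal h * ν (Set.Ioi x) ∧
    excess ν (x + h) + ENNReal.ofReal h * ν (Set.Ioi (x + h)) ≤ excess ν x := by
  have hind : ∀ y, ENNReal.ofReal h * ν (Set.Ioi y) =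
      ∫⁻ z, (Set.Ioi y).indicator (fun _ => ENNReal.ofReal h) z ∂ν := fun y => by
    rw [lintegral_indicator_const measurableSet_Ioi]
  rw [hind, hind, excess, excess,
    ← lintegral_add_right _ (measurable_const.indicator measurableSet_Ioi),
    ← lintegral_add_right _ (measurable_const.indicator measurableSet_Ioi)]
  constructor
  · refine lintegral_mono fun z => ?_
    by_cases hz : z ∈ Set.Ioi x
    · rw [Set.indicator_of_mem hz]
      refine le_trans (ENNReal.ofReal_le_ofReal ?_) ENNReal.ofReal_add_le
      linarith
    · rw [ENNReal.ofReal_of_nonpos (by simpa using hz)]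
      exact zero_le
  · refine lintegral_mono fun z => ?_
    by_cases hz : z ∈ Set.Ioi (x + h)
    · rw [Set.indicator_of_mem hz, ← ENNReal.ofReal_add (by linarith [Set.mem_Ioi.1 hz]) hh]
      exact ENNReal.ofReal_le_ofReal (by linarith)
    · rw [Set.indicator_of_notMem hz, add_zero]
      exact ENNReal.ofReal_le_ofReal (by linarith)

/-- If the mean residual life is constant, the tail is exponential. -/
lemma real_Ioi_eq_exp (hpos : ∀ᵐ z ∂ν, 0 < z) (hm : mean ν ≠ ⊤) (hm0 : mean ν ≠ 0)
    (h : ∀ x, 0 ≤ x → excess ν x = mean ν * ν (Set.Ioi x)) {x : ℝ} (hx : 0 ≤ x) :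
    ν.real (Set.Ioi x) = Real.exp (-(x / (mean ν).toReal)) := by
  set a := (mean ν).toReal with ha
  have ha0 : 0 < a := ENNReal.toReal_pos hm0 hm
  set p : ℝ → ℝ := fun y => ν.real (Set.Ioi y) with hp
  have hex : ∀ y, 0 ≤ y → (excess ν y).toReal = a * p y := fun y hy => by
    rw [h y hy, ENNReal.toReal_mul]; rfl
  have hfin : ∀ y, 0 ≤ y → excess ν y ≠ ⊤ := fun y hy => by
    rw [h y hy]; exact ENNReal.mul_ne_top hm (measure_ne_top _ _)
  -- Since the excess is `a` times the tail `p`, the two bounds on its increment become difference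
  -- inequalities for `p`, discrete forms of `p' = -p / a`.
  have hstep : ∀ y δ, 0 ≤ y → 0 ≤ δ →
      p y * (1 - δ / a) ≤ p (y + δ) ∧ p (y + δ) * (1 + δ / a) ≤ p y := by
    intro y δ hy hδ
    obtain ⟨h1, h2⟩ := excess_le_excess_add ν y hδ
    have hyδ : 0 ≤ y + δ := by linarith
    have hc : ∀ z, ENNReal.ofReal δ * ν (Set.Ioi z) ≠ ⊤ := fun z =>
      ENNReal.mul_ne_top ENNReal.ofReal_ne_top (measure_ne_top _ _)
    have hr : ∀ z, (ENNReal.ofReal δ * ν (Set.Ioi z)).toReal = δ * p z := fun z => by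
      rw [ENNReal.toReal_mul, ENNReal.toReal_ofReal hδ]; rfl
    have e1 := ENNReal.toReal_mono (ENNReal.add_ne_top.2 ⟨hfin _ hyδ, hc _⟩) h1
    have e2 := ENNReal.toReal_mono (hfin _ hy) h2
    rw [ENNReal.toReal_add (hfin _ hyδ) (hc _), hr, hex _ hy, hex _ hyδ] at e1 e2
    constructor
    · refine le_of_mul_le_mul_left ?_ ha0
      have : a * (p y * (1 - δ / a)) = a * p y - δ * p y := by field_simp
      linarith
    · refine le_of_mul_le_mul_left ?_ ha0
      have : a * (p (y + δ) * (1 + δ / a)) = a * p (y + δ) + δ * p (y + δ) := by field_simp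
      linarith
  have hp0 : p 0 = 1 := by
    have : ν (Set.Ioi 0) = 1 := (prob_compl_eq_zero_iff measurableSet_Ioi).1 hpos
    simp [hp, measureReal_def, this]
  have hit : ∀ δ, 0 ≤ δ → δ ≤ a → ∀ k : ℕ,
      (1 - δ / a) ^ k ≤ p (k * δ) ∧ p (k * δ) * (1 + δ / a) ^ k ≤ 1 := by
    intro δ hδ hδa k
    have hd1 : 0 ≤ 1 - δ / a := by rw [sub_nonneg, div_le_one ha0]; exact hδa
    have hd2 : 0 ≤ 1 + δ / a := by positivity
    induction k with
    | zero => simp [hp0]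
    | succ k ih =>
      obtain ⟨s1, s2⟩ := hstep (k * δ) δ (by positivity) hδ
      have e : ((k + 1 : ℕ) : ℝ) * δ = k * δ + δ := by push_cast; ring
      rw [e, pow_succ, pow_succ]
      refine ⟨(mul_le_mul_of_nonneg_right ih.1 hd1).trans s1, le_trans (Eq.le (by ring))
        ((mul_le_mul_of_nonneg_left s2 (pow_nonneg hd2 k)).trans (le_trans (Eq.le (by ring)) ih.2))⟩
  -- `N` steps of length `x / N` lead from `0` to `x`; `N` is large enough for a step to be at most
  -- `a`, so that the factor `1 - δ / a` is nonnegative. As `N` grows, the two bounds meet at the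
  -- exponential.
  have hN : ∀ᶠ N : ℕ in atTop, (1 + -(x / a) / N) ^ N ≤ p x ∧ p x * (1 + x / a / N) ^ N ≤ 1 := by
    obtain ⟨N₀, hN₀⟩ := exists_nat_ge (x / a)
    filter_upwards [eventually_ge_atTop (N₀ + 1)] with N hN
    have hN' : (N₀ : ℝ) + 1 ≤ N := by exact_mod_cast hN
    have hNpos : (0 : ℝ) < N := by linarith [N₀.cast_nonneg (α := ℝ)]
    have h3 := hit (x / N) (by positivity) (by
      rw [div_le_iff₀ hNpos]
      rw [div_le_iff₀ ha0] at hN₀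
      nlinarith) N
    rw [mul_div_cancel₀ _ hNpos.ne', div_right_comm] at h3
    rwa [neg_div, ← sub_eq_add_neg]
  refine le_antisymm ?_ ?_
  · have h4 := le_of_tendsto ((Real.tendsto_one_add_div_pow_exp (x / a)).const_mul (p x))
      (hN.mono fun N hN => hN.2)
    rw [Real.exp_neg, ← one_div, le_div_iff₀ (Real.exp_pos _)]
    exact h4
  · exact le_of_tendsto (Real.tendsto_one_add_div_pow_exp (-(x / a))) (hN.mono fun N hN => hN.1)

lemma eq_expMeasure_of_excess_eq (hpos : ∀ᵐ z ∂ν, 0 < z) (hm : mean ν ≠ ⊤) (hm0 : mean ν ≠ 0)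
    (h : ∀ x, 0 ≤ x → excess ν x = mean ν * ν (Set.Ioi x)) :
    ν = expMeasure (1 / (mean ν).toReal) := by
  have hr : 0 < 1 / (mean ν).toReal := one_div_pos.2 (ENNReal.toReal_pos hm0 hm)
  have := isProbabilityMeasure_expMeasure hr
  refine Measure.eq_of_cdf _ _ (StieltjesFunction.ext fun x => ?_)
  rw [cdf_expMeasure_eq hr]
  split_ifs with hx
  · have h1 := real_Ioi_eq_exp hpos hm hm0 h hx
    rw [real_Ioi_eq] at h1
    rw [one_div_mul_eq_div]
    linarith
  · rw [cdf_eq_real, measureReal_eq_zero_iff, measure_eq_zero_iff_ae_notMem]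
    filter_upwards [hpos] with z hz hz'
    exact hx (hz.le.trans hz')

end Exponential

end BatchQueue

/-! ### Both implications in terms of the input laws -/

namespace BatchQueue

open scoped ENNReal Topology
open Filter

variable {F : Set ℝ} {v : Inp}

/-- With constant service batches and arriving batches on their lattice, the masses stay on the
lattice. -/
lemma Good.exists_nat_mul (hv : Good v) {d : ℝ} (hd : 0 < d) (hX : ∀ i, ∃ k : ℕ, v (1, i) = k * d)
    (hY : ∀ i, v (3, i) = d) (F : Set ℝ) (e : ℕ) :
    (∃ k : ℕ, (sys F v e).content = k * d) ∧ ∃ k : ℕ, (sys F v e).work = k * d := by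
  induction e with
  | zero =>
    obtain ⟨k, hk⟩ := hX 0
    by_cases h : v (1, 0) ∈ F
    · rw [sys_zero_of_mem h]; exact ⟨⟨k, hk⟩, k, hk⟩
    · rw [sys_zero_of_notMem h]; exact ⟨⟨0, by simp⟩, 0, by simp⟩
  | succ e ih =>
    obtain ⟨⟨c, hc⟩, w, hw⟩ := ih
    obtain ⟨k, hk⟩ := hX (sys F v e).arr
    rcases sys_succ_cases F v e with ⟨-, h'⟩ | ⟨-, -, -, h'⟩ | ⟨-, -, -, h'⟩ | ⟨h0, -, h'⟩
    · rw [h']; exact ⟨⟨c, hc⟩, w, hw⟩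
    · rw [h']; exact ⟨⟨c + k, by dsimp only; rw [hc, hk]; push_cast; ring⟩, w, hw⟩
    · rw [h']; exact ⟨⟨c, hc⟩, w, hw⟩
    · have h1 := (hv.sys_inv F e).2.2.2.2 h0
      have h2 := (hv.sys_inv F e).2.1
      rw [hw] at h1 h2
      have hw1 : (1 : ℝ) ≤ w := by exact_mod_cast (pos_iff_pos_of_mul_pos h1).2 hd
      have hwc : (w : ℝ) ≤ c := by rw [hc] at h2; exact le_of_mul_le_mul_right h2 hd
      have hc1 : 1 ≤ c := by exact_mod_cast hw1.trans hwc
      have hkey : (sys F v e).content - min (v (3, (sys F v e).served)) (sys F v e).work =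
          (c - 1 : ℕ) * d := by
        rw [hY, hw, hc, min_eq_left (le_mul_of_one_le_left hd.le hw1), Nat.cast_sub hc1]
        push_cast; ring
      rw [h', hkey]
      exact ⟨⟨_, rfl⟩, _, rfl⟩

lemma mean_eq_of_ae_eq {ν : Measure ℝ} [IsProbabilityMeasure ν] {d : ℝ} (h : ∀ᵐ y ∂ν, y = d) :
    mean ν = ENNReal.ofReal d := by
  rw [mean, lintegral_congr_ae (g := fun _ => ENNReal.ofReal d)
    (h.mono fun y hy => by rw [hy])]
  simp

section Law

variable {L : Fin 4 → Measure ℝ} [∀ k, IsProbabilityMeasure (L k)]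

/-- Exponential interarrival times and batches on the lattice of the constant service batches give a
mean loss that does not depend on the capacity. -/
theorem lintegral_lostTotal_eq (hL : PosLaw L) (hτ : ∀ t, L 0 (Set.Ioi t) ≠ 0)
    (ha : mean (L 0) ≠ ⊤) (ha0 : mean (L 0) ≠ 0) (hb : mean (L 2) ≠ ⊤)
    (hmem : ∀ x, 0 ≤ x → excess (L 0) x = mean (L 0) * L 0 (Set.Ioi x)) {d : ℝ} (hd : 0 < d)
    (hY : ∀ᵐ y ∂L 3, y = d) (hX : ∀ᵐ x ∂L 1, ∃ k : ℕ, x = k * d)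
    (hmean : mean (L 1) * mean (L 2) = mean (L 0) * mean (L 3)) {n : ℝ} (hn : 0 < n) :
    ∫⁻ v, lostTotal (Set.Iic n) v ∂inputLaw L = mean (L 1) := by
  have hF : MeasurableSet (Set.Iic n) := measurableSet_Iic
  have hS := lintegral_numServices_ne_top hL hτ hn.le
  have hN : NWUELaw (L 0) := fun x hx => (hmem x hx).ge
  have h1 := lintegral_lost_add hL hb hF hS
  have h2 := (mean_mul_numServices_le hL hN ha hb hF hS).2.2
    (lintegral_residual_of_memoryless hL hmem hF (ae_exists_empty hL hb hF hS))
  -- At every start the mass present is a positive multiple of `d`, so a service batch `d` fits and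
  -- truncation has no effect.
  have h3 : ∫⁻ v, startSum (Set.Iic n) (fun _ s => truncMean (L 3) s.work) v ∂inputLaw L =
      mean (L 3) * ∫⁻ v, numServices (Set.Iic n) v ∂inputLaw L := by
    rw [← lintegral_const_mul _ (measurable_startSum hF fun e => measurable_const)]
    refine lintegral_congr_ae ?_
    filter_upwards [hL.ae_good, ae_all_iff.2 fun i => ae_coord hY i,
      ae_all_iff.2 fun i => ae_coord hX i] with v hv hvY hvX
    rw [← startSum_const_mul]
    refine tsum_congr fun e => ?_
    split_ifs with he
    · obtain ⟨w, hw⟩ := (hv.exists_nat_mul hd hvX hvY (Set.Iic n) e).2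
      have hpos := (hv.sys_inv (Set.Iic n) e).2.2.2.2 he.1
      rw [hw] at hpos
      have hw1 : (1 : ℝ) ≤ w := by exact_mod_cast (pos_iff_pos_of_mul_pos hpos).2 hd
      simp only [mul_one, truncMean, mean]
      refine lintegral_congr_ae ?_
      filter_upwards [hY] with y hy
      rw [hy, hw, min_eq_left (le_mul_of_one_le_left hd.le hw1)]
    · rfl
  rw [h3, mul_add, mul_one] at h1
  -- Memorylessness makes the time inequality an equality, and load one turns it into equality of
  -- the mean mass arriving after the first batch and the mean mass served. The first batch is what
  -- remains to be lost in the mean.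
  have h4 : mean (L 1) * ∫⁻ v, numArrivals (Set.Iic n) v ∂inputLaw L =
      mean (L 3) * ∫⁻ v, numServices (Set.Iic n) v ∂inputLaw L := by
    refine (ENNReal.mul_right_inj ha0 ha).1 ?_
    rw [mul_left_comm, ← h2, ← mul_assoc, ← mul_assoc, hmean]
  rw [h4] at h1
  refine (ENNReal.add_left_inj (ENNReal.mul_ne_top ?_ hS)).1 h1
  rw [mean_eq_of_ae_eq hY]
  exact ENNReal.ofReal_ne_top

/-- If the mean loss does not depend on the capacity, the interarrival times are exponential, the
service batches are constant, and the arriving batches lie on their lattice. -/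
theorem exists_of_lintegral_lostTotal_eq (hL : PosLaw L) (hN : NWUELaw (L 0))
    (hτ : ∀ t, L 0 (Set.Ioi t) ≠ 0) (hX : mean (L 1) ≠ ⊤) (hX0 : mean (L 1) ≠ 0)
    (hb : mean (L 2) ≠ ⊤) (hb0 : mean (L 2) ≠ 0) (ha : mean (L 0) ≠ ⊤) (ha0 : mean (L 0) ≠ 0)
    (hY : mean (L 3) ≠ ⊤)
    (hM : ∀ n : ℝ, 0 < n → ∫⁻ v, lostTotal (Set.Iic n) v ∂inputLaw L = mean (L 1)) :
    ∃ d : ℝ, 0 < d ∧ L 0 = expMeasure (1 / (mean (L 0)).toReal) ∧ (∀ᵐ y ∂L 3, y = d) ∧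
      (∀ᵐ x ∂L 1, ∃ k : ℕ, x = k * d) ∧ mean (L 1) * mean (L 2) = mean (L 0) * mean (L 3) := by
  obtain ⟨hmean, heq⟩ := equalities_of_lost_eq hL hN hτ hX hX0 hb ha ha0 hY hM
  have hS : ∀ n : ℝ, 0 < n → _ := fun n hn => lintegral_numServices_ne_top hL hτ hn.le
  have hfit := ae_srvMass_le hL hτ fun n hn =>
    ae_served_le_work hL hY measurableSet_Iic (hS n hn) (heq n hn).1
  obtain ⟨d, hd, hYd⟩ := exists_ae_eq_of_fit hL hfit
  have hXd := ae_exists_nat_mul_of_fit hL hfit hd hYd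
  have hχ : L 2 (Set.Ioi 0) ≠ 0 := fun h0 => hb0 (by
    rw [mean, ← lintegral_zero (μ := L 2)]
    refine lintegral_congr_ae ?_
    filter_upwards [measure_eq_zero_iff_ae_notMem.1 h0] with z hz
    exact ENNReal.ofReal_of_nonpos (not_lt.1 hz))
  exact ⟨d, hd, eq_expMeasure_of_excess_eq hL.τ_pos ha ha0 fun y hy =>
    memoryless_of_residual_eq hL hN hτ ha hχ hd hYd hXd
      (fun n hn => ae_exists_empty hL hb measurableSet_Iic (hS n hn))
      (fun n hn => (heq n hn).2) hy, hYd, hXd, hmean⟩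

end Law

end BatchQueue

/-! ### Transfer to the random variables of the statement -/

namespace BatchQueue

open scoped ENNReal Topology
open Filter

/-- The two descriptions of the system agree. -/
lemma state_eq_sys (n : ℝ) {τ X χ Y : ℕ → ℝ} {v : Inp} (hτ : ∀ i, v (0, i) = τ i)
    (hX : ∀ i, v (1, i) = X i) (hχ : ∀ i, v (2, i) = χ i) (hY : ∀ i, v (3, i) = Y i) (e : ℕ) :
    (state n τ X χ Y e).arrived = (sys (Set.Iic n) v e).arr ∧
    (state n τ X χ Y e).served = (sys (Set.Iic n) v e).served ∧
    (state n τ X χ Y e).content = (sys (Set.Iic n) v e).content ∧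
    (state n τ X χ Y e).lost = (sys (Set.Iic n) v e).lost ∧
    ((sys (Set.Iic n) v e).content ≠ 0 → (state n τ X χ Y e).inService =
      min (v (3, (sys (Set.Iic n) v e).served)) (sys (Set.Iic n) v e).work) := by
  induction e with
  | zero =>
    change (init n X Y).arrived = _ ∧ (init n X Y).served = _ ∧ (init n X Y).content = _ ∧
      (init n X Y).lost = _ ∧ (_ → (init n X Y).inService = _)
    by_cases h : X 0 ≤ n
    · rw [sys_zero_of_mem (show v (1, 0) ∈ Set.Iic n by rw [hX]; exact h), init, if_pos h]
      simp [hX, hY]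
    · rw [sys_zero_of_notMem (show v (1, 0) ∉ Set.Iic n by rw [hX]; exact h), init, if_neg h]
      simp [hX]
  | succ e ih =>
    obtain ⟨i1, i2, i3, i4, i5⟩ := ih
    have hs : state n τ X χ Y (e + 1) = step n τ X χ Y (state n τ X χ Y e) :=
      Function.iterate_succ_apply' _ _ _
    have hA : arrivalTime τ (state n τ X χ Y e).arrived =
        arrTime v (sys (Set.Iic n) v e).arr := by
      rw [i1, arrivalTime, arrTime]
      simp only [hτ]
    have hC : completionTime χ (state n τ X χ Y e).served =
        srvTime v ((sys (Set.Iic n) v e).served + 1) := by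
      rw [i2, completionTime, srvTime]
      simp only [hχ]
    rw [hs, step, hA, hC, i3]
    rcases sys_succ_cases (Set.Iic n) v e with
      ⟨h1, h'⟩ | ⟨h1, h2, hF, h'⟩ | ⟨h1, h2, hF, h'⟩ | ⟨h1, h2, h'⟩
    · rw [if_pos h1, h']
      exact ⟨i1, i2, i3, i4, i5⟩
    · rw [hX, Set.mem_Iic] at hF
      rw [if_neg h1, if_pos h2, h', arrive, i3, i1, if_pos hF]
      simp only [hX]
      exact ⟨trivial, i2, trivial, i4, fun _ => i5 h1⟩
    · rw [hX, Set.mem_Iic] at hF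
      rw [if_neg h1, if_pos h2, h', arrive, i3, i1, if_neg hF]
      simp only [hX]
      exact ⟨trivial, i2, trivial, by rw [i4], fun _ => i5 h1⟩
    · rw [if_neg h1, if_neg (not_le.2 h2), h', complete, i3, i5 h1, i2]
      simp only [hY]
      exact ⟨i1, trivial, trivial, i4, fun _ => trivial⟩

lemma lostMass_eq_lostTotal (n : ℝ) {τ X χ Y : ℕ → ℝ} {v : Inp} (hτ : ∀ i, v (0, i) = τ i)
    (hX : ∀ i, v (1, i) = X i) (hχ : ∀ i, v (2, i) = χ i) (hY : ∀ i, v (3, i) = Y i) :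
    lostMass n τ X χ Y = lostTotal (Set.Iic n) v :=
  iSup_congr fun e => by rw [(state_eq_sys n hτ hX hχ hY e).2.2.2.1]

section Transfer

variable {Ω : Type*} [MeasurableSpace Ω] {μ : Measure Ω} {τ X χ Y : ℕ → Ω → ℝ}

/-- The laws of the four control sequences. -/
noncomputable def rowLaw (μ : Measure Ω) (τ X χ Y : ℕ → Ω → ℝ) (k : Fin 4) : Measure ℝ :=
  μ.map (![τ, X, χ, Y] k 0)

/-- The input sequences as a random element. -/
def inputs (τ X χ Y : ℕ → Ω → ℝ) (ω : Ω) : Inp := fun p => ![τ, X, χ, Y] p.1 p.2 ω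

lemma _root_.IsControl.measurable_row (h : IsControl μ τ X χ Y) (k : Fin 4) (i : ℕ) :
    Measurable (![τ, X, χ, Y] k i) := by
  fin_cases k
  exacts [h.measurable_τ i, h.measurable_X i, h.measurable_χ i, h.measurable_Y i]

lemma _root_.IsControl.map_row (h : IsControl μ τ X χ Y) (k : Fin 4) (i : ℕ) :
    μ.map (![τ, X, χ, Y] k i) = rowLaw μ τ X χ Y k := by
  fin_cases k
  exacts [(h.identDistrib_τ i).map_eq, (h.identDistrib_X i).map_eq, (h.identDistrib_χ i).map_eq,
    (h.identDistrib_Y i).map_eq]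

lemma _root_.IsControl.measurable_inputs (h : IsControl μ τ X χ Y) : Measurable (inputs τ X χ Y) :=
  measurable_pi_iff.2 fun p => h.measurable_row p.1 p.2

lemma _root_.IsControl.map_inputs [IsProbabilityMeasure μ] (h : IsControl μ τ X χ Y) :
    μ.map (inputs τ X χ Y) = inputLaw (rowLaw μ τ X χ Y) := by
  have h1 := h.indep.map_fun_eq_infinitePi_map fun p : Fin 4 × ℕ => h.measurable_row p.1 p.2
  simp only [h.map_row] at h1
  exact h1

lemma _root_.IsControl.posLaw (h : IsControl μ τ X χ Y) : PosLaw (rowLaw μ τ X χ Y) where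
  τ_pos := (ae_map_iff (h.measurable_τ 0).aemeasurable measurableSet_Ioi).2 (h.τ_pos 0)
  X_pos := (ae_map_iff (h.measurable_X 0).aemeasurable measurableSet_Ioi).2 (h.X_pos 0)
  χ_nonneg := (ae_map_iff (h.measurable_χ 0).aemeasurable measurableSet_Ici).2 (h.χ_nonneg 0)
  Y_pos := (ae_map_iff (h.measurable_Y 0).aemeasurable measurableSet_Ioi).2 (h.Y_pos 0)

lemma mean_map {ξ : Ω → ℝ} (hm : Measurable ξ) (hi : Integrable ξ μ) (h0 : ∀ᵐ ω ∂μ, 0 ≤ ξ ω) :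
    mean (μ.map ξ) = ENNReal.ofReal (μ[ξ]) := by
  rw [mean, lintegral_map ENNReal.measurable_ofReal hm, ofReal_integral_eq_lintegral_ofReal hi h0]

lemma integral_pos_of_ae_pos [IsProbabilityMeasure μ] {ξ : Ω → ℝ} (hi : Integrable ξ μ)
    (h0 : ∀ᵐ ω ∂μ, 0 < ξ ω) : 0 < μ[ξ] := by
  have hnn : 0 ≤ᵐ[μ] ξ := h0.mono fun ω h => h.le
  refine lt_of_le_of_ne (integral_nonneg_of_ae hnn) fun heq => ?_
  have h1 := (integral_eq_zero_iff_of_nonneg_ae hnn hi).1 heq.symm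
  obtain ⟨ω, h2, h3⟩ := (h0.and h1).exists
  exact h2.ne' h3

/-- For a null event the conditional measure is zero, so the integral in the definition is zero,
less than the positive mean. -/
lemma _root_.IsNWUE.measure_ne_zero [IsProbabilityMeasure μ] {ξ : Ω → ℝ} (h : IsNWUE μ ξ)
    (hi : Integrable ξ μ) (h0 : ∀ᵐ ω ∂μ, 0 < ξ ω) {x : ℝ} (hx : 0 ≤ x) :
    μ {ω | x < ξ ω} ≠ 0 := by
  intro hz
  have h1 := h x hx
  rw [cond_eq_zero_of_meas_eq_zero hz, integral_zero_measure] at h1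
  exact absurd (integral_pos_of_ae_pos hi h0) (not_lt.2 h1)

lemma _root_.IsNWUE.nwueLaw [IsProbabilityMeasure μ] {ξ : Ω → ℝ} (h : IsNWUE μ ξ)
    (hm : Measurable ξ) (hi : Integrable ξ μ) (h0 : ∀ᵐ ω ∂μ, 0 < ξ ω) :
    NWUELaw (μ.map ξ) := by
  intro x hx
  have hne := h.measure_ne_zero hi h0 hx
  have hS : MeasurableSet {ω | x < ξ ω} := measurableSet_lt measurable_const hm
  have h1 := h x hx
  rw [ProbabilityTheory.cond, integral_smul_measure, smul_eq_mul, ENNReal.toReal_inv,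
    ← div_eq_inv_mul, le_div_iff₀ (ENNReal.toReal_pos hne (measure_ne_top _ _))] at h1
  have h2 : excess (μ.map ξ) x = ∫⁻ ω in {ω | x < ξ ω}, ENNReal.ofReal (ξ ω - x) ∂μ := by
    rw [excess, lintegral_map (by fun_prop) hm, ← lintegral_indicator hS]
    refine lintegral_congr fun ω => ?_
    by_cases hω : x < ξ ω
    · rw [Set.indicator_of_mem (show ω ∈ {ω | x < ξ ω} from hω)]
    · rw [Set.indicator_of_notMem (show ω ∉ {ω | x < ξ ω} from hω),
        ENNReal.ofReal_of_nonpos (by linarith)]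
  have h3 : 0 ≤ᵐ[μ.restrict {ω | x < ξ ω}] fun ω => ξ ω - x := by
    filter_upwards [ae_restrict_mem hS] with ω hω
    exact sub_nonneg.2 (le_of_lt hω)
  have h5 : Integrable (fun ω => ξ ω - x) (μ.restrict {ω | x < ξ ω}) :=
    (hi.sub (integrable_const x)).restrict
  rw [h2, ← ofReal_integral_eq_lintegral_ofReal h5 h3,
    mean_map hm hi (h0.mono fun ω h => h.le), Measure.map_apply hm measurableSet_Ioi]
  have h4 : μ (ξ ⁻¹' Set.Ioi x) = ENNReal.ofReal (μ {ω | x < ξ ω}).toReal :=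
    (ENNReal.ofReal_toReal (measure_ne_top _ _)).symm
  rw [h4, ← ENNReal.ofReal_mul (integral_pos_of_ae_pos hi h0).le]
  exact ENNReal.ofReal_le_ofReal h1

end Transfer

end BatchQueue

theorem theorem1 {Ω : Type*} [MeasurableSpace Ω] (μ : Measure Ω) [IsProbabilityMeasure μ]
    (τ X χ Y : ℕ → Ω → ℝ) (hctrl : IsControl μ τ X χ Y) (hA : IsNWUE μ (τ 0)) :
    (∀ n : ℝ, 0 < n →
      ∫⁻ ω, BatchQueue.lostMass n (fun i => τ i ω) (fun i => X i ω) (fun i => χ i ω)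
        (fun i => Y i ω) ∂μ = ENNReal.ofReal (μ[X 0])) ↔
    ∃ d : ℝ,
      (∃ r : ℝ, 0 < r ∧ μ.map (τ 0) = expMeasure r) ∧
      (∀ᵐ ω ∂μ, Y 0 ω = d) ∧
      (∀ᵐ ω ∂μ, ∃ k : ℤ, X 0 ω = k * d) ∧
      μ[X 0] = μ[τ 0] * d / μ[χ 0] := by
  set L := BatchQueue.rowLaw μ τ X χ Y with hLdef
  have hmk := hctrl.measurable_row
  have : ∀ k, IsProbabilityMeasure (L k) := fun k =>
    Measure.isProbabilityMeasure_map (hmk k 0).aemeasurable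
  have hL : BatchQueue.PosLaw L := hctrl.posLaw
  have ma : BatchQueue.mean (L 0) = ENNReal.ofReal (μ[τ 0]) := BatchQueue.mean_map
    (hctrl.measurable_τ 0) hctrl.integrable_τ ((hctrl.τ_pos 0).mono fun ω h => h.le)
  have mx : BatchQueue.mean (L 1) = ENNReal.ofReal (μ[X 0]) := BatchQueue.mean_map
    (hctrl.measurable_X 0) hctrl.integrable_X ((hctrl.X_pos 0).mono fun ω h => h.le)
  have mb : BatchQueue.mean (L 2) = ENNReal.ofReal (μ[χ 0]) := BatchQueue.mean_map
    (hctrl.measurable_χ 0) hctrl.integrable_χ (hctrl.χ_nonneg 0)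
  have my : BatchQueue.mean (L 3) = ENNReal.ofReal (μ[Y 0]) := BatchQueue.mean_map
    (hctrl.measurable_Y 0) hctrl.integrable_Y ((hctrl.Y_pos 0).mono fun ω h => h.le)
  have ha := BatchQueue.integral_pos_of_ae_pos hctrl.integrable_τ (hctrl.τ_pos 0)
  have hx := BatchQueue.integral_pos_of_ae_pos hctrl.integrable_X (hctrl.X_pos 0)
  have hb := hctrl.mean_χ_pos
  have hne : ∀ {z : ℝ}, 0 < z → ENNReal.ofReal z ≠ 0 := fun h => (ENNReal.ofReal_pos.2 h).ne'
  have hN : BatchQueue.NWUELaw (L 0) :=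
    hA.nwueLaw (hctrl.measurable_τ 0) hctrl.integrable_τ (hctrl.τ_pos 0)
  -- NWUE speaks only of nonnegative levels, hence the passage to `max t 0`.
  have hτ : ∀ t, L 0 (Set.Ioi t) ≠ 0 := by
    intro t h0
    have h1 := measure_mono_null (Set.Ioi_subset_Ioi (le_max_left t 0)) h0
    rw [hLdef, BatchQueue.rowLaw, Measure.map_apply (hmk 0 0) measurableSet_Ioi] at h1
    exact hA.measure_ne_zero hctrl.integrable_τ (hctrl.τ_pos 0) (le_max_right t 0) h1
  have hmean : ∀ d : ℝ, 0 < d → (∀ᵐ y ∂L 3, y = d) →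
      (BatchQueue.mean (L 1) * BatchQueue.mean (L 2) =
        BatchQueue.mean (L 0) * BatchQueue.mean (L 3) ↔ μ[X 0] = μ[τ 0] * d / μ[χ 0]) := by
    intro d hd hY
    rw [BatchQueue.mean_eq_of_ae_eq hY, ma, mx, mb, ← ENNReal.ofReal_mul hx.le,
      ← ENNReal.ofReal_mul ha.le, eq_div_iff hb.ne',
      ENNReal.ofReal_eq_ofReal_iff (mul_pos hx hb).le (mul_pos ha hd).le]
  have hlost : ∀ n : ℝ, ∫⁻ ω, BatchQueue.lostMass n (fun i => τ i ω) (fun i => X i ω)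
      (fun i => χ i ω) (fun i => Y i ω) ∂μ =
      ∫⁻ v, BatchQueue.lostTotal (Set.Iic n) v ∂BatchQueue.inputLaw L := by
    intro n
    rw [← hctrl.map_inputs, lintegral_map (BatchQueue.measurable_lostTotal measurableSet_Iic)
      hctrl.measurable_inputs]
    exact lintegral_congr fun ω => BatchQueue.lostMass_eq_lostTotal n (fun _ => rfl)
      (fun _ => rfl) (fun _ => rfl) (fun _ => rfl)
  simp only [hlost, ← mx]
  constructor
  · intro hM
    obtain ⟨d, hd, h0, h3, h1, h4⟩ := BatchQueue.exists_of_lintegral_lostTotal_eq hL hN hτ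
      (mx ▸ ENNReal.ofReal_ne_top) (mx ▸ hne hx) (mb ▸ ENNReal.ofReal_ne_top) (mb ▸ hne hb)
      (ma ▸ ENNReal.ofReal_ne_top) (ma ▸ hne ha) (my ▸ ENNReal.ofReal_ne_top) hM
    refine ⟨d, ⟨_, ?_, h0⟩, ae_of_ae_map (hmk 3 0).aemeasurable h3, ?_, (hmean d hd h3).1 h4⟩
    · rw [ma, ENNReal.toReal_ofReal ha.le]
      exact one_div_pos.2 ha
    · filter_upwards [ae_of_ae_map (hmk 1 0).aemeasurable h1] with ω ⟨k, hk⟩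
      exact ⟨k, by exact_mod_cast hk⟩
  · rintro ⟨d, ⟨r, hr, h0⟩, h3, h1, h4⟩ n hn
    -- Positivity of `d` comes from that of the service batches, and turns the integer multiples in
    -- the statement into natural ones.
    have hd : 0 < d := by
      obtain ⟨ω, e1, e2⟩ := (h3.and (hctrl.Y_pos 0)).exists
      exact e1 ▸ e2
    have hY : ∀ᵐ y ∂L 3, y = d :=
      (ae_map_iff (hmk 3 0).aemeasurable (measurableSet_singleton d)).2 h3
    have hX : ∀ᵐ x ∂L 1, ∃ k : ℕ, x = k * d := by
      refine (ae_map_iff (hmk 1 0).aemeasurable (BatchQueue.measurableSet_nat_mul d)).2 ?_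
      filter_upwards [h1, hctrl.X_pos 0] with ω ⟨k, hk⟩ hpos
      rw [hk] at hpos
      have hk0 : 0 ≤ k := by exact_mod_cast ((pos_iff_pos_of_mul_pos hpos).2 hd).le
      obtain ⟨m, rfl⟩ := Int.eq_ofNat_of_zero_le hk0
      exact ⟨m, by exact_mod_cast hk⟩
    have h0' : L 0 = expMeasure r := h0
    exact BatchQueue.lintegral_lostTotal_eq hL hτ (ma ▸ ENNReal.ofReal_ne_top) (ma ▸ hne ha)
      (mb ▸ ENNReal.ofReal_ne_top) (fun x hx => by
        rw [h0']; exact BatchQueue.excess_expMeasure hr hx) hd hY hX ((hmean d hd hY).2 h4) hn
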